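/- Let $m>0$, $p(w)=-w^3-mw$, and consider the system of nonlinear elastodynamics for $u=(w,v)$, $$w_t-v_x=0,\qquad v_t+p(w)_x=0,\qquad (t,x)\in\mathbb R^+\times\mathbb R,$$ i.e. $u_t+f(u)_x=0$ with $f(w,v)=(-v,p(w))$, with a compact state space $\mathcal V\subset\mathbb R^2$. Its characteristic speeds are $\lambda_{1,2}(u)=\mp\sqrt{3w^2+m}$; it has the strictly convex entropy $\eta(u)=\frac{v^2}{2}+\frac{w^4}{4}+\frac{mw^2}{2}$ with entropy flux $q(u)=v\,p(w)$. Put $$\eta(u|b)=\eta(u)-\eta(b)-\eta'(b)(u-b),\qquad q(u;b)=q(u)-q(b)-\eta'(b)(f(u)-f(b)).$$ The 1-shock curve issuing from a left state $u_L=(w_L,v_L)$ and the 2-shock curve issuing from a right state $u_R=(w_R,v_R)$ are $$S^1_{u_L}(s)=\Bigl(w_L+s,\ v_L+s\sqrt{\tfrac{-(p(w_L+s)-p(w_L))}{s}}\Bigr),\qquad S^2_{u_R}(s)=\Bigl(w_R+s,\ v_R-s\sqrt{\tfrac{-(p(w_R+s)-p(w_R))}{s}}\Bigr).$$ A function $u\in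 L^\infty(\mathbb R^+\times\mathbb R)$ has the strong trace property if along every Lipschitz curve $t\mapsto h(t)$, $t\ge 0$, it has strong traces $u_\pm\in L^\infty(\mathbb R^+)$, that is, for every $T>0$, $$\lim_{n\to\infty}\int_0^T\operatorname*{ess\,sup}_{y\in(0,1/n)}|u(t,h(t)+y)-u_+(t)|\,dt=\lim_{n\to\infty}\int_0^T\operatorname*{ess\,sup}_{y\in(-1/n,0)}|u(t,h(t)+y)-u_-(t)|\,dt=0 .$$ Let $\mathcal S_{weak}$ be the set of $u\in L^\infty(\mathbb R^+\times\mathbb R;\mathcal V)$ which solve $u_t+f(u)_x=0$ and satisfy $\eta(u)_t+q(u)_x\le 0$ in the sense of distributions on $(0,\infty)\times\mathbb R$, have the strong trace property, and whose shocks obey the Lax condition: along every Lipschitz curve $h$, for a.e. $t$ with $u_-(t)\ne u_+(t)$ there is $i\in\{1,2\}$ with $\lambda_i(u_-(t))\ge\dot h(t)\ge\lambda_i(u_+(t))$. **1-shocks.** For every $u_L\in\mathcal V$ with $w_L\neq0$ there exist $\epsilon>0$, $0<a<1$ and $C>0$ such that the following holds for every $0<s_0<\epsilon$ for which $u_R:=S^1_{u_L}(\operatorname{sgn}(w_L)\,s_0)$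 lies in $\mathcal V$. For any $u\in\mathcal S_{weak}$ there is a Lipschitz function $h:[0,\infty)\to\mathbb R$ with $h(0)=0$ such that, $u_\pm$ denoting the traces of $u$ along $h$, $$\dot h(t)\,\eta(u_-(t)|u_L)-q(u_-(t);u_L)-a\bigl(\dot h(t)\,\eta(u_+(t)|u_R)-q(u_+(t);u_R)\bigr)\le 0\quad\text{for a.e. }t\in[0,\infty),$$ and such that, with $S(x)=u_L$ for $x<0$ and $S(x)=u_R$ for $x>0$, whenever $u_0$ is the initial value of $u$ (attained in $L^1_{loc}(\mathbb R)$ in the mean: $\frac1\delta\int_0^\delta\int_{-R}^R|u(t,x)-u_0(x)|\,dx\,dt\to0$ as $\delta\to0^+$ for every $R>0$), $$\|u(t,\cdot+h(t))-S\|_{L^2(\mathbb R)}\le C\,\|u_0-S\|_{L^2(\mathbb R)}\quad\text{for a.e. }t>0 .$$ **2-shocks.** For every $u_R\in\mathcal V$ with $w_R\neq0$ there exist $\epsilon>0$, $1<a<\infty$ and $C>0$ such that the same conclusions hold for every $0<s_0<\epsilon$ for which $u_L:=S^2_{u_R}(\operatorname{sgn}(w_R)\,s_0)$ lies in $\mathcal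 V$. -/

import Mathlib

open MeasureTheory Filter Set
open scoped ENNReal NNReal Topology ContDiff

namespace Elastodynamics

noncomputable section

/-- States `u = (w, v)`: `u 0 = w` is the deformation gradient, `u 1 = v` the velocity. -/
abbrev State := EuclideanSpace ℝ (Fin 2)

/-- The stress-strain law `p(w) = -w³ - m w`. -/
def stress (m w : ℝ) : ℝ := -w ^ 3 - m * w

/-- The flux `f(w, v) = (-v, p(w))` of `w_t - v_x = 0`, `v_t + p(w)_x = 0`. -/
def flux (m : ℝ) (u : State) : State := !₂[-(u 1), stress m (u 0)]

/-- The entropy `η(w, v) = v²/2 + w⁴/4 + m w²/2`. -/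
def entropy (m : ℝ) (u : State) : ℝ := (u 1) ^ 2 / 2 + (u 0) ^ 4 / 4 + m * (u 0) ^ 2 / 2

/-- The entropy flux `q(w, v) = v p(w)`, for which `q' = η' f'`. -/
def entropyFlux (m : ℝ) (u : State) : ℝ := u 1 * stress m (u 0)

/-- The relative entropy `η(u|b) = η(u) - η(b) - η'(b)(u - b)`. -/
def relEntropy (m : ℝ) (u b : State) : ℝ :=
  entropy m u - entropy m b - fderiv ℝ (entropy m) b (u - b)

/-- The relative entropy flux `q(u;b) = q(u) - q(b) - η'(b)(f(u) - f(b))`. -/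
def relEntropyFlux (m : ℝ) (u b : State) : ℝ :=
  entropyFlux m u - entropyFlux m b - fderiv ℝ (entropy m) b (flux m u - flux m b)

/-- The first characteristic speed `λ₁(u) = -√(3w² + m)`. -/
def speed1 (m : ℝ) (u : State) : ℝ := -√(3 * (u 0) ^ 2 + m)

/-- The second characteristic speed `λ₂(u) = √(3w² + m)`. -/
def speed2 (m : ℝ) (u : State) : ℝ := √(3 * (u 0) ^ 2 + m)

/-- The 1-shock curve through the left state `uL`, parametrized by the increment of `w`. -/
def shockCurve1 (m : ℝ) (uL : State) (s : ℝ) : State :=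
  !₂[uL 0 + s, uL 1 + √(-(stress m (s + uL 0) - stress m (uL 0)) / s) * s]

/-- The 2-shock curve through the right state `uR`, parametrized by the increment of `w`. -/
def shockCurve2 (m : ℝ) (uR : State) (s : ℝ) : State :=
  !₂[uR 0 + s, uR 1 - √(-(stress m (s + uR 0) - stress m (uR 0)) / s) * s]

/-- The Lax condition `λᵢ(u₋) ≥ σ ≥ λᵢ(u₊)`, for the field `i = 1` or `i = 2`. -/
def LaxCondition (m : ℝ) (um up : State) (σ : ℝ) : Prop :=
  (σ ≤ speed1 m um ∧ speed1 m up ≤ σ) ∨ (σ ≤ speed2 m um ∧ speed2 m up ≤ σ)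

/-- The domain `(0, ∞) × ℝ` of pairs `(t, x)`. -/
def spaceTime : Set (ℝ × ℝ) := Ioi 0 ×ˢ univ

/-- Smooth real functions with compact support in `(0, ∞) × ℝ`. -/
def IsTestFunction (ψ : ℝ × ℝ → ℝ) : Prop :=
  ContDiff ℝ ∞ ψ ∧ HasCompactSupport ψ ∧ tsupport ψ ⊆ spaceTime

/-- `u_t + f(u)_x = 0` in the sense of distributions on `(0, ∞) × ℝ`. -/
def IsWeakSolution (m : ℝ) (u : ℝ × ℝ → State) : Prop :=
  ∀ ψ : ℝ × ℝ → ℝ, IsTestFunction ψ →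
    ∫ z in spaceTime, (fderiv ℝ ψ z (1, 0) • u z + fderiv ℝ ψ z (0, 1) • flux m (u z)) = 0

/-- `η(u)_t + q(u)_x ≤ 0` in the sense of distributions on `(0, ∞) × ℝ`. -/
def IsEntropic (m : ℝ) (u : ℝ × ℝ → State) : Prop :=
  ∀ ψ : ℝ × ℝ → ℝ, IsTestFunction ψ → (∀ z, 0 ≤ ψ z) →
    0 ≤ ∫ z in spaceTime,
      (fderiv ℝ ψ z (1, 0) * entropy m (u z) + fderiv ℝ ψ z (0, 1) * entropyFlux m (u z))

/-- A curve `t ↦ h(t)` that is Lipschitz on `[0, ∞)`. -/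
def IsLipschitzCurve (h : ℝ → ℝ) : Prop := ∃ K : ℝ≥0, LipschitzOnWith K h (Ici 0)

/-- `um` and `up` are the strong left and right traces of `u` along the curve `h`. Elements of
`L^∞` being classes modulo null sets, the suprema in `y` are essential suprema. -/
def AreStrongTraces (u : ℝ × ℝ → State) (h : ℝ → ℝ) (um up : ℝ → State) : Prop :=
  MemLp um ∞ (volume.restrict (Ioi 0)) ∧ MemLp up ∞ (volume.restrict (Ioi 0)) ∧
    ∀ T : ℝ, 0 < T →
      Tendsto (fun n : ℕ => ∫⁻ t in Ioo 0 T,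
        essSup (fun y => ‖u (t, h t + y) - up t‖ₑ) (volume.restrict (Ioo 0 (1 / ((n : ℝ) + 1)))))
        atTop (𝓝 0) ∧
      Tendsto (fun n : ℕ => ∫⁻ t in Ioo 0 T,
        essSup (fun y => ‖u (t, h t + y) - um t‖ₑ)
          (volume.restrict (Ioo (-(1 / ((n : ℝ) + 1))) 0)))
        atTop (𝓝 0)

/-- The strong trace property: strong traces exist along every Lipschitz curve. -/
def HasStrongTraces (u : ℝ × ℝ → State) : Prop :=
  ∀ h : ℝ → ℝ, IsLipschitzCurve h → ∃ um up : ℝ → State, AreStrongTraces u h um up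

/-- All shocks of `u` satisfy the Lax condition: wherever the traces along a Lipschitz curve `h`
differ, they do so with speed `h'(t)`. -/
def ShocksAreLax (m : ℝ) (u : ℝ × ℝ → State) : Prop :=
  ∀ (h : ℝ → ℝ) (um up : ℝ → State), IsLipschitzCurve h → AreStrongTraces u h um up →
    ∀ᵐ t ∂(volume.restrict (Ioi 0)), um t ≠ up t → LaxCondition m (um t) (up t) (deriv h t)

/-- The class `S_weak` of solutions with values in the state space `V`. -/
structure IsSWeak (m : ℝ) (V : Set State) (u : ℝ × ℝ → State) : Prop where
  aestronglyMeasurable : AEStronglyMeasurable u (volume.restrict spaceTime)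
  mem_stateSpace : ∀ᵐ z ∂(volume.restrict spaceTime), u z ∈ V
  weakSolution : IsWeakSolution m u
  entropic : IsEntropic m u
  strongTraces : HasStrongTraces u
  lax : ShocksAreLax m u

/-- `u₀` is the initial value of `u`, attained in `L¹_loc` in the mean as `t → 0+`. -/
def IsInitialValue (u : ℝ × ℝ → State) (u₀ : ℝ → State) : Prop :=
  AEStronglyMeasurable u₀ volume ∧
    ∀ R : ℝ, 0 < R →
      Tendsto (fun δ : ℝ =>
        (∫⁻ z in Ioo 0 δ ×ˢ Ioo (-R) R, ‖u z - u₀ z.2‖ₑ) / ENNReal.ofReal δ)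
        (𝓝[>] 0) (𝓝 0)

/-- The step function equal to `uL` for `x < 0` and to `uR` for `x > 0`. -/
def shockProfile (uL uR : State) (x : ℝ) : State := if x < 0 then uL else uR

/-- The dissipation functional
`σ η(u₋|u_L) - q(u₋;u_L) - a (σ η(u₊|u_R) - q(u₊;u_R))` for the shift speed `σ`. -/
def dissipation (m a : ℝ) (uL uR um up : State) (σ : ℝ) : ℝ :=
  σ * relEntropy m um uL - relEntropyFlux m um uL
    - a * (σ * relEntropy m up uR - relEntropyFlux m up uR)

/-- The `a`-contraction up to a Lipschitz shift for the shock `(uL, uR)`, and the stability in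
`L²` with constant `C` up to the same shift, among all solutions in `S_weak`. -/
def IsStableUpToShift (m : ℝ) (V : Set State) (a C : ℝ) (uL uR : State) : Prop :=
  ∀ u : ℝ × ℝ → State, IsSWeak m V u →
    ∃ h : ℝ → ℝ, IsLipschitzCurve h ∧ h 0 = 0 ∧
      (∃ um up : ℝ → State, AreStrongTraces u h um up ∧
        ∀ᵐ t ∂(volume.restrict (Ioi 0)), dissipation m a uL uR (um t) (up t) (deriv h t) ≤ 0) ∧
      ∀ u₀ : ℝ → State, IsInitialValue u u₀ →
        ∀ᵐ t ∂(volume.restrict (Ioi 0)),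
          eLpNorm (fun x => u (t, x + h t) - shockProfile uL uR x) 2 volume ≤
            ENNReal.ofReal C * eLpNorm (fun x => u₀ x - shockProfile uL uR x) 2 volume

end

end Elastodynamics

/-! The quantity to control is the entropy of u relative to u_L on the left of the shift h, plus a
times its entropy relative to u_R on the right. Its balance law has one boundary term along h, the
dissipation. If h can be steered so that this term is nonpositive, the weighted relative entropy
does not increase. Since relative entropies are comparable to squared distances on the compact set
V, L² stability follows with a constant that depends only on m, V and a.

Steering. The shift follows a continuous velocity field Λ(u) = λ₁(u) - N max(c(u), 0), where c(u) =
η(u|u_L) - a η(u|u_R). As u is discontinuous, h is a Filippov curve (`exists_filippov_curve`,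
`exists_shift`): h' lies between the values of Λ at the two traces. If the traces agree, h' is the
prescribed velocity. If they differ, h' is the speed of a Lax shock; being negative, it forces a
1-shock, and since it is strictly larger than λ₁(u₊) ≥ Λ(u₊) it is at most Λ(u₋). Where c(u₋) ≥ 0
this slowness, together with the entropy produced by the jump, gives the sign. Where c(u₋) ≤ 0, the
left trace lies in a set that shrinks to u_L with the strength s₀, and a direct estimate is needed
(`exists_isAdmissibleVelocity`).

The estimate near u_L. By the symmetry u ↦ -u one may take w_L > 0. The constraint on u₋ gives |w₋ -
w_L| ≤ κ α s₀ when a = α². For a 1-shock of speed -θ, completing the square in the velocities writes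
2θ times the dissipation as -y² + α²(y + r)² minus a polynomial in w₋ and w₊. The error r is
controlled by s₀|θ² - θ₀²|, where θ₀ is the speed of the reference shock in absolute value, and what
remains is `contraction_polynomial`. The Lax condition leaves w₊ ≥ w₋ or w₊ ≤ -2w₋, the latter
because p'' vanishes at w = 0. A possibly negative cubic term in w₋ - w_L is of size (κ α s₀)³,
which loses against a gain of size α² s₀³ once α is small. The smallness of α does not involve s₀,
so one weight serves all weak shocks.

2-shocks are the image of 1-shocks under (w, v, x) ↦ (w, -v, -x), which replaces a by 1/a
(`dissipation_reflect`).

The analysis. Distributional inequalities extend to Lipschitz test functions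
(`IsSubPair.lipschitz`), then to one side of a Lipschitz curve with a trace term
(`IsSubPair.trace`). This yields the Rankine–Hugoniot condition on h (`IsSWeak.rankineHugoniot`) and
the decay of the weighted entropy (`IsSWeak.integral_weightedEntropy_nonneg`). A backward cone
cutoff localizes the mass (`ae_coneMass_le`), and `exists_average_coneMass_le` compares it with the
initial value, which is attained only in the mean. -/

namespace Elastodynamics

/-! ### Polynomial inequalities behind the contraction of small 1-shocks -/

/-- Lower bound for the coefficient of `(w₊ - w_R)²` when `w₋ ≤ w₊`. -/
lemma plus_coeff_lower_of_le {m b s₀ x p : ℝ} (hm : 0 < m) (hb : 0 < b) (hs : 0 < s₀)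
    (hs' : s₀ ≤ b / 1000) (hx : |x| ≤ s₀ / 100) (hp : b + x ≤ p) :
    b ^ 3 * s₀ / 4 ≤
      (p ^ 2 + p * (b + s₀) + (b + s₀) ^ 2 + m) * (p ^ 2 - (b + s₀) ^ 2) / 2
        + ((p ^ 2 + 2 * p * (b + s₀) + 3 * (b + s₀) ^ 2) / 2 + m) * (s₀ - x)
          * (p + (b + x) + (b + s₀)) - 4 * s₀ ^ 2 * (p + (b + s₀) + (b + x)) ^ 2 := by
  obtain ⟨hx1, hx2⟩ := abs_le.1 hx
  set R := b + s₀ with hR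
  set g := (p ^ 2 + 2 * p * R + 3 * R ^ 2) / 2 + m with hg
  set S := p + (b + x) + R with hS
  have hp0 : 0 < p := by linarith
  have hR0 : 0 < R := by linarith
  have hS0 : 2 * b ≤ S := by linarith
  have hgb : b ^ 2 ≤ g := by
    have : b ^ 2 ≤ R ^ 2 := by gcongr; linarith
    have : 0 < p * R := by positivity
    nlinarith [sq_nonneg p]
  have hg0 : 0 < g := by positivity
  have hS2 : S ^ 2 ≤ 8 * g := by
    have h1 : S ≤ 2 * p + R := by linarith
    have h2 : S ^ 2 ≤ (2 * p + R) ^ 2 := pow_le_pow_left₀ (by linarith) h1 2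
    nlinarith [mul_pos hp0 hR0, sq_nonneg R]
  have hmain : g * (s₀ - x) * (b / 1) ≤
      (p ^ 2 + p * R + R ^ 2 + m) * (p ^ 2 - R ^ 2) / 2 + g * (s₀ - x) * S := by
    have hk0 : 0 < p ^ 2 + p * R + R ^ 2 + m := by positivity
    rcases le_total R p with h | h
    · have : 0 ≤ p ^ 2 - R ^ 2 := by nlinarith
      have h1 : 0 ≤ (p ^ 2 + p * R + R ^ 2 + m) * (p ^ 2 - R ^ 2) := by positivity
      have h2 : g * (s₀ - x) * (b / 1) ≤ g * (s₀ - x) * S := by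
        have : 0 ≤ s₀ - x := by linarith
        gcongr; linarith
      linarith
    -- Below R the first term is negative. It is absorbed by the second: p ≥ b + x bounds R - p by
    -- s₀ - x, and the factor in front is at most g exactly because p² ≤ R².
    · have hkg : p ^ 2 + p * R + R ^ 2 + m ≤ g := by nlinarith
      have h1 : (p ^ 2 + p * R + R ^ 2 + m) * (R ^ 2 - p ^ 2) ≤ g * ((s₀ - x) * (R + p)) := by
        have h3 : R ^ 2 - p ^ 2 ≤ (s₀ - x) * (R + p) := by nlinarith
        have h4 : 0 ≤ R ^ 2 - p ^ 2 := by nlinarith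
        gcongr
      have h2 : 0 ≤ g * (s₀ - x) * (S - b - (R + p) / 2) := by
        have : 0 ≤ s₀ - x := by linarith
        have : 0 ≤ S - b - (R + p) / 2 := by linarith
        positivity
      nlinarith
  have h5 : g * s₀ * b / 2 ≤ g * (s₀ - x) * (b / 1) := by
    have : 0 ≤ g * b * (s₀ / 2 - x) := by
      have : 0 ≤ s₀ / 2 - x := by linarith
      positivity
    nlinarith
  have h6 : 4 * s₀ ^ 2 * S ^ 2 ≤ g * s₀ * b / 4 := by
    have h7 : 4 * s₀ ^ 2 * S ^ 2 ≤ 4 * s₀ ^ 2 * (8 * g) := by gcongr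
    have h8 : 0 ≤ g * s₀ * (b / 4 - 32 * s₀) := by
      have : 0 ≤ b / 4 - 32 * s₀ := by linarith
      positivity
    nlinarith
  have h9 : b ^ 3 * s₀ / 4 ≤ g * s₀ * b / 4 := by
    have : 0 ≤ (g - b ^ 2) * (s₀ * b) := mul_nonneg (by linarith) (by positivity)
    nlinarith
  have h10 : p + R + (b + x) = S := by ring
  rw [h10]
  linarith

/-- Lower bound for the coefficient of `(w₊ - w_R)²` when `w₊ ≤ -2 w₋`. -/
lemma plus_coeff_lower_of_le_neg {m b s₀ x p : ℝ} (hm : 0 < m) (hb : 0 < b) (hs : 0 < s₀)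
    (hs' : s₀ ≤ b / 1000) (hx : |x| ≤ s₀ / 100) (hp : p ≤ -2 * (b + x)) :
    b ^ 4 / 2 ≤
      (p ^ 2 + p * (b + s₀) + (b + s₀) ^ 2 + m) * (p ^ 2 - (b + s₀) ^ 2) / 2
        + ((p ^ 2 + 2 * p * (b + s₀) + 3 * (b + s₀) ^ 2) / 2 + m) * (s₀ - x)
          * (p + (b + x) + (b + s₀)) - 4 * s₀ ^ 2 * (p + (b + s₀) + (b + x)) ^ 2 := by
  obtain ⟨hx1, hx2⟩ := abs_le.1 hx
  set R := b + s₀ with hR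
  set g := (p ^ 2 + 2 * p * R + 3 * R ^ 2) / 2 + m with hg
  set k := p ^ 2 + p * R + R ^ 2 + m with hk
  set S := p + (b + x) + R with hS
  have hpb : 19 / 10 * b ≤ -p := by linarith
  have hR0 : 0 < R := by linarith
  have hR1 : R ≤ 11 / 20 * (-p) := by linarith
  have hR2 : R ^ 2 ≤ (11 / 20 * (-p)) ^ 2 := by gcongr
  have hpp : (19 / 10 * b) ^ 2 ≤ (-p) ^ 2 := by gcongr
  have hp0 : 0 < -p := by linarith
  have hpR : R * (-p) ≤ 11 / 20 * (-p) * (-p) := by gcongr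
  have hb2 : 0 < b ^ 2 := by positivity
  have hk1 : 3 / 4 * p ^ 2 ≤ k := by linarith [sq_nonneg (p / 2 + R)]
  have hk0 : 0 < k := by linarith
  have hg0 : 0 ≤ g := by linarith [sq_nonneg (p + R), sq_nonneg R]
  have hgk : g ≤ 4 / 3 * k := by linarith
  clear_value g k S R
  have hS1 : |S| ≤ 3 * (-p) := abs_le.2 ⟨by linarith, by linarith⟩
  -- The bound R ≤ 11/20 |p| makes the first term at least 30% of k p². Since s₀ ≤ b/1000, each of
  -- the other two terms costs at most 1%, so 28% remains.
  have hA : k * (p ^ 2 * (3 / 10)) ≤ k * (p ^ 2 - R ^ 2) / 2 := by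
    have : 0 ≤ k * (p ^ 2 - R ^ 2 - p ^ 2 * (6 / 10)) := by
      apply mul_nonneg hk0.le; linarith
    linarith
  have hB : -(k * (p ^ 2 * (1 / 100))) ≤ g * (s₀ - x) * S := by
    have h1 : |g * (s₀ - x) * S| ≤ 4 / 3 * k * (2 * s₀) * (3 * (-p)) := by
      rw [abs_mul, abs_mul, abs_of_nonneg hg0]
      have : |s₀ - x| ≤ 2 * s₀ := abs_le.2 ⟨by linarith, by linarith⟩
      gcongr
    have h2 : 4 / 3 * k * (2 * s₀) * (3 * (-p)) ≤ k * (p ^ 2 * (1 / 100)) := by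
      have : 0 ≤ k * (-p) * ((-p) / 100 - 8 * s₀) := by
        have : 0 ≤ (-p) / 100 - 8 * s₀ := by linarith
        positivity
      linarith
    linarith [neg_abs_le (g * (s₀ - x) * S)]
  have hC : 4 * s₀ ^ 2 * S ^ 2 ≤ k * (p ^ 2 * (1 / 100)) := by
    have h1 : S ^ 2 ≤ (3 * (-p)) ^ 2 := sq_le_sq' (by linarith [(abs_le.1 hS1).1]) (abs_le.1 hS1).2
    have h2 : s₀ ^ 2 ≤ (b / 1000) ^ 2 := by gcongr
    have h3 : 4 * s₀ ^ 2 * S ^ 2 ≤ 4 * s₀ ^ 2 * (3 * (-p)) ^ 2 := by gcongr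
    have h4 : 0 ≤ p ^ 2 * (k / 100 - 36 * s₀ ^ 2) := by
      apply mul_nonneg (sq_nonneg p); linarith
    linarith
  have hD : b ^ 4 / 2 ≤ k * (p ^ 2 * (28 / 100)) := by
    have h1 : 2 * b ^ 2 ≤ k := by linarith
    have h2 : 3 * b ^ 2 ≤ p ^ 2 := by linarith
    have h3 : 2 * b ^ 2 * (3 * b ^ 2) ≤ k * p ^ 2 := by gcongr
    have h4 : 0 ≤ b ^ 4 := by positivity
    linarith
  have h10 : p + R + (b + x) = S := by rw [hS]; ring
  rw [h10]
  linarith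

/-- Lower bound for the coefficient of `(w₋ - w_L)²` for jumps that are not small. -/
lemma minus_coeff_lower_of_large {m b s₀ x p : ℝ} (hm : 0 < m) (hb : 0 < b) (hs : 0 < s₀)
    (hs' : s₀ ≤ b / 1000) (hx : |x| ≤ s₀ / 100) (hp : b + x + s₀ / 2 ≤ p) :
    b ^ 3 * s₀ / 2 ≤
      (((b + x) ^ 2 + 2 * (b + x) * b + 3 * b ^ 2) / 2 + m) * (p - b) * (p + (b + x) + b)
        - ((b + x) ^ 2 + (b + x) * b + b ^ 2 + m) * x * ((b + x) + b) / 2 := by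
  obtain ⟨hx1, hx2⟩ := abs_le.1 hx
  set w := b + x with hw
  set g := (w ^ 2 + 2 * w * b + 3 * b ^ 2) / 2 + m with hg
  have hw0 : 0 < w := by linarith
  have hgb : b ^ 2 ≤ g := by nlinarith [mul_pos hw0 hb, sq_nonneg w]
  have hg0 : 0 < g := by positivity
  have hk0 : 0 < w ^ 2 + w * b + b ^ 2 + m := by positivity
  have hkg : w ^ 2 + w * b + b ^ 2 + m ≤ 2 * g := by nlinarith [mul_pos hw0 hb, sq_nonneg w]
  have h1 : g * (s₀ * (2 / 5)) * (2 * b) ≤ g * (p - b) * (p + w + b) := by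
    have : s₀ * (2 / 5) ≤ p - b := by linarith
    have : 2 * b ≤ p + w + b := by linarith
    have : 0 ≤ p - b := by linarith
    gcongr
  have h2 : (w ^ 2 + w * b + b ^ 2 + m) * x * (w + b) ≤ 2 * g * (s₀ / 100) * (3 * b) := by
    calc _ ≤ (w ^ 2 + w * b + b ^ 2 + m) * (s₀ / 100) * (w + b) := by gcongr
      _ ≤ 2 * g * (s₀ / 100) * (3 * b) := by gcongr; linarith
  have h3 : 0 ≤ (g - b ^ 2) * (s₀ * b) := mul_nonneg (by linarith) (by positivity)
  have h4 : 0 < b ^ 3 * s₀ := by positivity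
  linarith

/-- Rough lower bound for the coefficient of `(w₋ - w_L)²`. -/
lemma minus_coeff_lower {m b s₀ x p : ℝ} (hm : 0 < m) (hb : 0 < b) (hs : 0 < s₀)
    (hs' : s₀ ≤ b / 1000) (hx : |x| ≤ s₀ / 100)
    (hp : (b + x ≤ p ∧ p ≤ b + x + s₀ / 2) ∨ p ≤ -2 * (b + x)) :
    -(6 * b * (4 * b ^ 2 + m) * |x|) ≤
      (((b + x) ^ 2 + 2 * (b + x) * b + 3 * b ^ 2) / 2 + m) * (p - b) * (p + (b + x) + b)
        - ((b + x) ^ 2 + (b + x) * b + b ^ 2 + m) * x * ((b + x) + b) / 2 := by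
  obtain ⟨hx1, hx2⟩ := abs_le.1 hx
  set w := b + x with hw
  set g := (w ^ 2 + 2 * w * b + 3 * b ^ 2) / 2 + m with hg
  have hw0 : 0 < w := by linarith
  have hw1 : w ≤ 11 / 10 * b := by linarith
  have hw2 : w ^ 2 ≤ (11 / 10 * b) ^ 2 := by gcongr
  have hwb : w * b ≤ 11 / 10 * b * b := by gcongr
  have hg0 : 0 < g := by positivity
  have hg1 : g ≤ 4 * b ^ 2 + m := by nlinarith
  have hk0 : 0 < w ^ 2 + w * b + b ^ 2 + m := by positivity
  have hk1 : w ^ 2 + w * b + b ^ 2 + m ≤ 4 * b ^ 2 + m := by nlinarith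
  have h2 : (w ^ 2 + w * b + b ^ 2 + m) * x * (w + b) ≤ (4 * b ^ 2 + m) * |x| * (3 * b) := by
    calc _ ≤ (w ^ 2 + w * b + b ^ 2 + m) * |x| * (w + b) := by gcongr; exact le_abs_self x
      _ ≤ _ := by gcongr; linarith
  have h1 : -((4 * b ^ 2 + m) * |x| * (4 * b)) ≤ g * (p - b) * (p + w + b) := by
    rcases hp with ⟨hp1, hp2⟩ | hp
    · have e1 : g * (-|x|) * (p + w + b) ≤ g * (p - b) * (p + w + b) := by
        have : -|x| ≤ p - b := by linarith [neg_abs_le x]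
        have : 0 ≤ p + w + b := by linarith
        gcongr
      have e2 : g * |x| * (p + w + b) ≤ (4 * b ^ 2 + m) * |x| * (4 * b) := by
        gcongr
        · linarith
        · linarith
      linarith
    -- Here p - b is negative, so the product can be negative only when p + w + b > 0; then p ≤ -2w
    -- bounds this factor by b - w = -x.
    · rcases le_total (p + w + b) 0 with h | h
      · have e1 : 0 ≤ g * ((b - p) * (-(p + w + b))) := by
          have : 0 ≤ b - p := by linarith
          have : 0 ≤ -(p + w + b) := by linarith
          positivity
        have e2 : 0 ≤ (4 * b ^ 2 + m) * |x| * (4 * b) := by positivity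
        linarith
      · have e1 : g * (b - p) * (p + w + b) ≤ (4 * b ^ 2 + m) * (4 * b) * |x| := by
          have : p + w + b ≤ |x| := by linarith [neg_abs_le x]
          have : b - p ≤ 4 * b := by linarith
          have : 0 ≤ b - p := by linarith
          gcongr
        linarith
  have h3 : 0 ≤ (4 * b ^ 2 + m) * |x| * b := by positivity
  linarith

/-- The polynomial inequality behind the contraction near `u_L`, with weight `a = α²`. -/
lemma contraction_polynomial {m b κ α s₀ x p : ℝ} (hm : 0 < m) (hb : 0 < b) (hκ : 0 < κ)
    (hα : 0 < α) (hα1 : α ≤ 1 / 2) (hα2 : κ * α ≤ 1 / 100)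
    (hα3 : 6 * b * (4 * b ^ 2 + m) * κ ^ 3 * α ≤ b ^ 3 / 128) (hs : 0 < s₀)
    (hs' : s₀ ≤ b / 1000) (hs'' : 6 * b * (4 * b ^ 2 + m) * κ ^ 2 * s₀ ≤ 2 * b ^ 4)
    (hx : |x| ≤ κ * α * s₀) (hp : b + x ≤ p ∨ p ≤ -2 * (b + x)) :
    4 * α ^ 2 * s₀ ^ 2 * ((p - (b + s₀)) ^ 2 * (p + (b + s₀) + (b + x)) ^ 2
        + x ^ 2 * ((b + x) + b + (b + s₀)) ^ 2) ≤
      x ^ 2 * ((((b + x) ^ 2 + 2 * (b + x) * b + 3 * b ^ 2) / 2 + m) * (p - b) * (p + (b + x) + b)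
        - ((b + x) ^ 2 + (b + x) * b + b ^ 2 + m) * x * ((b + x) + b) / 2)
      + α ^ 2 * (p - (b + s₀)) ^ 2 *
        ((p ^ 2 + p * (b + s₀) + (b + s₀) ^ 2 + m) * (p ^ 2 - (b + s₀) ^ 2) / 2
        + ((p ^ 2 + 2 * p * (b + s₀) + 3 * (b + s₀) ^ 2) / 2 + m) * (s₀ - x)
          * (p + (b + x) + (b + s₀))) := by
  have hx' : |x| ≤ s₀ / 100 := hx.trans ((mul_le_mul_of_nonneg_right hα2 hs.le).trans_eq (by ring))
  obtain ⟨hx1, hx2⟩ := abs_le.1 hx'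
  have hxx : x ^ 2 ≤ (κ * α * s₀) ^ 2 := by
    rw [← sq_abs x]; gcongr
  have hxs : x ^ 2 ≤ (s₀ / 100) ^ 2 := by
    rw [← sq_abs x]; gcongr
  have hT : ((b + x) + b + (b + s₀)) ^ 2 ≤ 16 * b ^ 2 := by
    have h1 : (b + x) + b + (b + s₀) ≤ 4 * b := by linarith
    have h2 : 0 ≤ (b + x) + b + (b + s₀) := by linarith
    nlinarith
  have hα4 : α ^ 2 ≤ 1 / 4 := by linarith [pow_le_pow_left₀ hα.le hα1 2]
  set A := (((b + x) ^ 2 + 2 * (b + x) * b + 3 * b ^ 2) / 2 + m) * (p - b) * (p + (b + x) + b)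
        - ((b + x) ^ 2 + (b + x) * b + b ^ 2 + m) * x * ((b + x) + b) / 2 with hA
  set B := (p ^ 2 + p * (b + s₀) + (b + s₀) ^ 2 + m) * (p ^ 2 - (b + s₀) ^ 2) / 2
        + ((p ^ 2 + 2 * p * (b + s₀) + 3 * (b + s₀) ^ 2) / 2 + m) * (s₀ - x)
          * (p + (b + x) + (b + s₀)) with hB
  set S := p + (b + s₀) + (b + x) with hS
  set T := (b + x) + b + (b + s₀) with hT'
  set X := p - (b + s₀) with hX
  have hxT : 4 * α ^ 2 * s₀ ^ 2 * (x ^ 2 * T ^ 2) ≤ 4 * α ^ 2 * s₀ ^ 2 * (x ^ 2 * (16 * b ^ 2)) := by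
    gcongr
  suffices h : 4 * α ^ 2 * s₀ ^ 2 * (x ^ 2 * (16 * b ^ 2))
      ≤ x ^ 2 * A + α ^ 2 * X ^ 2 * (B - 4 * s₀ ^ 2 * S ^ 2) by linarith
  have hα2' : 0 < α ^ 2 := by positivity
  -- The part of the error carried by x is of order α² s₀⁴ and is dominated by α² s₀³.
  have hsmall : 4 * α ^ 2 * s₀ ^ 2 * (x ^ 2 * (16 * b ^ 2)) ≤ α ^ 2 * (b ^ 3 * s₀ ^ 3 / 128) := by
    have e1 : 4 * α ^ 2 * s₀ ^ 2 * (x ^ 2 * (16 * b ^ 2))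
        ≤ 4 * α ^ 2 * s₀ ^ 2 * ((s₀ / 100) ^ 2 * (16 * b ^ 2)) := by gcongr
    have e2 : 0 ≤ α ^ 2 * s₀ ^ 3 * b ^ 2 * (b / 128 - 64 / 10000 * s₀) := by
      have : 0 ≤ b / 128 - 64 / 10000 * s₀ := by linarith
      positivity
    linarith
  have hneg : ∀ (_ : -(6 * b * (4 * b ^ 2 + m) * |x|) ≤ A),
      -((κ * α * s₀) ^ 2 * (6 * b * (4 * b ^ 2 + m) * (κ * α * s₀))) ≤ x ^ 2 * A := by
    intro h
    have e1 : x ^ 2 * (6 * b * (4 * b ^ 2 + m) * |x|)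
        ≤ (κ * α * s₀) ^ 2 * (6 * b * (4 * b ^ 2 + m) * (κ * α * s₀)) := by gcongr
    have e2 : x ^ 2 * (-(6 * b * (4 * b ^ 2 + m) * |x|)) ≤ x ^ 2 * A := by gcongr
    linarith
  -- There are three regimes. For p ≥ w₋ + s₀/2 both coefficients are positive. For w₋ ≤ p ≤ w₋ +
  -- s₀/2 the coefficient of x² may be negative of order |x|, but p stays at distance s₀/4 from b +
  -- s₀, and the gain α² s₀³ beats (κ α s₀)³. For p ≤ -2w₋ that distance is at least 5b/2, and the
  -- gain is of order α² b⁶.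
  rcases hp with hp | hp
  · have hBl := plus_coeff_lower_of_le hm hb hs hs' hx' hp
    have hBl' : b ^ 3 * s₀ / 4 ≤ B - 4 * s₀ ^ 2 * S ^ 2 := hBl
    rcases le_total (b + x + s₀ / 2) p with h | h
    · have hAl : b ^ 3 * s₀ / 2 ≤ A := minus_coeff_lower_of_large hm hb hs hs' hx' h
      have e1 : 0 ≤ α ^ 2 * X ^ 2 * (B - 4 * s₀ ^ 2 * S ^ 2) := by
        have : 0 ≤ B - 4 * s₀ ^ 2 * S ^ 2 := le_trans (by positivity) hBl'
        positivity
      have e2 : x ^ 2 * (b ^ 3 * s₀ / 2) ≤ x ^ 2 * A := by gcongr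
      have e3 : 4 * α ^ 2 * s₀ ^ 2 * (x ^ 2 * (16 * b ^ 2))
          ≤ 4 * (1 / 4) * s₀ ^ 2 * (x ^ 2 * (16 * b ^ 2)) := by gcongr
      have e4 : 0 ≤ x ^ 2 * s₀ * b ^ 2 * (b / 2 - 16 * s₀) := by
        have : 0 ≤ b / 2 - 16 * s₀ := by linarith
        positivity
      linarith
    · have hAl := hneg (minus_coeff_lower hm hb hs hs' hx' (Or.inl ⟨hp, h⟩))
      have hX2 : (s₀ / 4) ^ 2 ≤ X ^ 2 := by
        have : s₀ / 4 ≤ -X := by linarith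
        rw [← neg_sq X]; gcongr
      have e1 : α ^ 2 * (s₀ / 4) ^ 2 * (b ^ 3 * s₀ / 4)
          ≤ α ^ 2 * X ^ 2 * (B - 4 * s₀ ^ 2 * S ^ 2) := by gcongr
      have e2 : (κ * α * s₀) ^ 2 * (6 * b * (4 * b ^ 2 + m) * (κ * α * s₀))
          ≤ α ^ 2 * s₀ ^ 3 * (b ^ 3 / 128) := by
        have : α ^ 2 * s₀ ^ 3 * (6 * b * (4 * b ^ 2 + m) * κ ^ 3 * α)
          ≤ α ^ 2 * s₀ ^ 3 * (b ^ 3 / 128) := by gcongr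
        linarith
      linarith
  · have hBl' : b ^ 4 / 2 ≤ B - 4 * s₀ ^ 2 * S ^ 2 :=
      plus_coeff_lower_of_le_neg hm hb hs hs' hx' hp
    have hAl := hneg (minus_coeff_lower hm hb hs hs' hx' (Or.inr hp))
    have hX2 : (5 / 2 * b) ^ 2 ≤ X ^ 2 := by
      have : 5 / 2 * b ≤ -X := by linarith
      rw [← neg_sq X]; gcongr
    have e1 : α ^ 2 * (5 / 2 * b) ^ 2 * (b ^ 4 / 2)
        ≤ α ^ 2 * X ^ 2 * (B - 4 * s₀ ^ 2 * S ^ 2) := by gcongr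
    have e2 : (κ * α * s₀) ^ 2 * (6 * b * (4 * b ^ 2 + m) * (κ * α * s₀))
        ≤ α ^ 2 * s₀ ^ 2 * (2 * b ^ 4) := by
      have h1 : κ * α * s₀ ≤ s₀ := mul_le_of_le_one_left hs.le (by linarith)
      have h2 : (κ * α * s₀) ^ 2 * (6 * b * (4 * b ^ 2 + m) * (κ * α * s₀))
        ≤ (κ * α * s₀) ^ 2 * (6 * b * (4 * b ^ 2 + m) * s₀) := by gcongr
      have h3 : α ^ 2 * s₀ ^ 2 * (6 * b * (4 * b ^ 2 + m) * κ ^ 2 * s₀)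
        ≤ α ^ 2 * s₀ ^ 2 * (2 * b ^ 4) := by gcongr
      linarith
    have e3 : s₀ ^ 2 ≤ (b / 1000) ^ 2 := by gcongr
    have e4 : α ^ 2 * s₀ ^ 2 * (2 * b ^ 4) ≤ α ^ 2 * (b / 1000) ^ 2 * (2 * b ^ 4) := by gcongr
    have e5 : s₀ ^ 3 ≤ (b / 1000) ^ 3 := by gcongr
    have e6 : α ^ 2 * (b ^ 3 * s₀ ^ 3 / 128) ≤ α ^ 2 * (b ^ 3 * (b / 1000) ^ 3 / 128) := by gcongr
    have e7 : 0 < α ^ 2 * b ^ 6 := by positivity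
    linarith

/-! ### Relative entropy and relative flux in explicit form -/

lemma hasFDerivAt_entropy (m : ℝ) (b : State) :
    HasFDerivAt (entropy m)
      ((b 0 ^ 3 + m * b 0) • (EuclideanSpace.proj 0 : State →L[ℝ] ℝ)
        + b 1 • (EuclideanSpace.proj 1 : State →L[ℝ] ℝ)) b := by
  have h0 : HasFDerivAt (fun u : State => u 0) (EuclideanSpace.proj 0 : State →L[ℝ] ℝ) b :=
    (EuclideanSpace.proj 0 : State →L[ℝ] ℝ).hasFDerivAt
  have h1 : HasFDerivAt (fun u : State => u 1) (EuclideanSpace.proj 1 : State →L[ℝ] ℝ) b :=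
    (EuclideanSpace.proj 1 : State →L[ℝ] ℝ).hasFDerivAt
  have := (((h1.pow 2).mul_const (1 / 2)).add ((h0.pow 4).mul_const (1 / 4))).add
    ((h0.pow 2).const_mul (m / 2))
  refine (this.congr_fderiv ?_).congr_of_eventuallyEq (.of_forall fun u => ?_)
  · ext u
    simp
    ring
  · simp only [entropy, Pi.add_apply]; ring

/-- The quartic Taylor remainder is divisible by the squared increment of w. The quotient is a
positive definite quadratic form plus m/2, from which coercivity and upper bounds are read off. -/
lemma relEntropy_eq (m : ℝ) (u b : State) :
    relEntropy m u b = (u 1 - b 1) ^ 2 / 2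
      + (u 0 - b 0) ^ 2 * ((u 0 ^ 2 + 2 * u 0 * b 0 + 3 * b 0 ^ 2) / 4 + m / 2) := by
  rw [relEntropy, (hasFDerivAt_entropy m b).fderiv]
  simp [entropy]
  ring

lemma relEntropyFlux_eq (m : ℝ) (u b : State) :
    relEntropyFlux m u b = (u 1 - b 1) * (stress m (u 0) - stress m (b 0)) := by
  rw [relEntropyFlux, (hasFDerivAt_entropy m b).fderiv]
  simp [entropyFlux, flux, stress]
  ring

lemma State.norm_sq_eq (u : State) : ‖u‖ ^ 2 = u 0 ^ 2 + u 1 ^ 2 := by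
  rw [EuclideanSpace.norm_sq_eq]
  simp [Fin.sum_univ_two]

lemma State.abs_apply_le (u : State) (i : Fin 2) : |u i| ≤ ‖u‖ := by
  simpa using PiLp.norm_apply_le u i

lemma relEntropy_nonneg {m : ℝ} (hm : 0 < m) (u b : State) : 0 ≤ relEntropy m u b := by
  rw [relEntropy_eq]
  have : 0 ≤ u 0 ^ 2 + 2 * u 0 * b 0 + 3 * b 0 ^ 2 := by
    nlinarith [sq_nonneg (u 0 + b 0), sq_nonneg (b 0)]
  positivity

lemma le_relEntropy {m : ℝ} (u b : State) :
    min 1 m / 2 * ‖u - b‖ ^ 2 ≤ relEntropy m u b := by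
  rw [relEntropy_eq, State.norm_sq_eq]
  have h1 : 0 ≤ u 0 ^ 2 + 2 * u 0 * b 0 + 3 * b 0 ^ 2 := by
    nlinarith [sq_nonneg (u 0 + b 0), sq_nonneg (b 0)]
  have h2 : min 1 m / 2 * (u 1 - b 1) ^ 2 ≤ 1 / 2 * (u 1 - b 1) ^ 2 := by
    gcongr; exact min_le_left _ _
  have h3 : (min 1 m / 2) * (u 0 - b 0) ^ 2
      ≤ ((u 0 ^ 2 + 2 * u 0 * b 0 + 3 * b 0 ^ 2) / 4 + m / 2) * (u 0 - b 0) ^ 2 := by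
    gcongr
    linarith [min_le_right 1 m]
  simp only [PiLp.sub_apply]
  linarith

lemma relEntropy_le {m M : ℝ} (hm : 0 < m) {u b : State} (hu : ‖u‖ ≤ M) (hb : ‖b‖ ≤ M) :
    relEntropy m u b ≤ (1 + 2 * M ^ 2 + m) * ‖u - b‖ ^ 2 := by
  rw [relEntropy_eq, State.norm_sq_eq]
  have hM : 0 ≤ M := (norm_nonneg u).trans hu
  have h0 := sq_le_sq' (by linarith [neg_abs_le (u 0), State.abs_apply_le u 0])
    ((le_abs_self _).trans ((State.abs_apply_le u 0).trans hu))
  have h1 := sq_le_sq' (by linarith [neg_abs_le (b 0), State.abs_apply_le b 0])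
    ((le_abs_self _).trans ((State.abs_apply_le b 0).trans hb))
  have h3 : ((u 0 ^ 2 + 2 * u 0 * b 0 + 3 * b 0 ^ 2) / 4 + m / 2) * (u 0 - b 0) ^ 2
      ≤ (1 + 2 * M ^ 2 + m) * (u 0 - b 0) ^ 2 := by
    refine mul_le_mul_of_nonneg_right ?_ (sq_nonneg _)
    nlinarith [sq_nonneg (u 0 - b 0)]
  have h2 : 1 / 2 * (u 1 - b 1) ^ 2 ≤ (1 + 2 * M ^ 2 + m) * (u 1 - b 1) ^ 2 := by
    gcongr; nlinarith
  simp only [PiLp.sub_apply]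
  linarith

/-- The stress is odd, so u ↦ -u is a symmetry of the system; this reduces the shock estimates to
w_L > 0. -/
lemma dissipation_neg (m a : ℝ) (uL uR um up : State) (σ : ℝ) :
    dissipation m a (-uL) (-uR) (-um) (-up) σ = dissipation m a uL uR um up σ := by
  simp only [dissipation, relEntropy_eq, relEntropyFlux_eq, stress, PiLp.neg_apply]
  ring

/-! ### Dissipation of 1-shocks that start near the left state -/

/-- The square of the speed of a shock between the deformation gradients `w` and `z`. -/
def shockSpeedSq (m w z : ℝ) : ℝ := z ^ 2 + z * w + w ^ 2 + m

lemma shockSpeedSq_pos {m : ℝ} (hm : 0 < m) (w z : ℝ) : 0 < shockSpeedSq m w z := by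
  unfold shockSpeedSq; nlinarith [sq_nonneg (z + w / 2), sq_nonneg w]

lemma shockCurve1_eq {m : ℝ} (uL : State) {s : ℝ} (hs : s ≠ 0) :
    shockCurve1 m uL s = !₂[uL 0 + s, uL 1 + √(shockSpeedSq m (uL 0) (uL 0 + s)) * s] := by
  have : -(stress m (s + uL 0) - stress m (uL 0)) / s = shockSpeedSq m (uL 0) (uL 0 + s) := by
    unfold stress shockSpeedSq; field_simp; ring
  rw [shockCurve1, this]

lemma neg_shockCurve1 {m : ℝ} (uL : State) {s : ℝ} (hs : s ≠ 0) :
    -shockCurve1 m uL s = shockCurve1 m (-uL) (-s) := by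
  rw [shockCurve1_eq _ hs, shockCurve1_eq _ (neg_ne_zero.2 hs)]
  have : shockSpeedSq m ((-uL) 0) ((-uL) 0 + -s) = shockSpeedSq m (uL 0) (uL 0 + s) := by
    simp only [shockSpeedSq, PiLp.neg_apply]; ring
  rw [this]
  ext i; fin_cases i <;> simp <;> ring

/-- The dissipation is nonpositive for shocks whose left state has a deformation gradient close
to that of `u_L`. -/
lemma dissipation_nonpos_of_pos {m b κ α s₀ : ℝ} (hm : 0 < m) (hb : 0 < b) (hκ : 0 < κ)
    (hα : 0 < α) (hα1 : α ≤ 1 / 2) (hα2 : κ * α ≤ 1 / 100)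
    (hα3 : 6 * b * (4 * b ^ 2 + m) * κ ^ 3 * α ≤ b ^ 3 / 128) (hs : 0 < s₀)
    (hs' : s₀ ≤ b / 1000) (hs'' : 6 * b * (4 * b ^ 2 + m) * κ ^ 2 * s₀ ≤ 2 * b ^ 4)
    {uL um up : State} (hbL : uL 0 = b) (hx : |um 0 - b| ≤ κ * α * s₀)
    (hp : 3 * um 0 ^ 2 ≤ up 0 ^ 2 + up 0 * um 0 + um 0 ^ 2)
    (hRH : up 1 - um 1 = √(shockSpeedSq m (um 0) (up 0)) * (up 0 - um 0)) :
    dissipation m (α ^ 2) uL (shockCurve1 m uL s₀) um up (-√(shockSpeedSq m (um 0) (up 0))) ≤ 0 := by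
  obtain ⟨x, hxw⟩ : ∃ x, um 0 = b + x := ⟨um 0 - b, by ring⟩
  obtain ⟨p, hpw⟩ : ∃ p, up 0 = p := ⟨_, rfl⟩
  obtain ⟨d, hd⟩ : ∃ d, um 1 = uL 1 + d := ⟨um 1 - uL 1, by ring⟩
  rw [shockCurve1_eq _ hs.ne']
  simp only [dissipation, relEntropy_eq, relEntropyFlux_eq, stress]
  simp only [Matrix.cons_val_zero, Matrix.cons_val_one]
  rw [hpw, hd, hxw] at hRH
  rw [hpw, hxw] at hp
  rw [hxw] at hx
  have hup1 : up 1 = uL 1 + d + √(shockSpeedSq m (b + x) p) * (p - (b + x)) := by linarith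
  rw [hup1, hpw, hd, hxw, hbL]
  have hx' : |x| ≤ κ * α * s₀ := by simpa using hx
  have hxs : |x| ≤ s₀ / 100 :=
    hx'.trans ((mul_le_mul_of_nonneg_right hα2 hs.le).trans_eq (by ring))
  obtain ⟨hx1, hx2⟩ := abs_le.1 hxs
  -- The hypothesis `hp` is (p - w₋)(p + 2w₋) ≥ 0 in expanded form.
  have hcase : b + x ≤ p ∨ p ≤ -2 * (b + x) := by
    by_contra! hcon
    linarith [mul_pos (sub_pos.2 hcon.1) (sub_pos.2 hcon.2)]
  have hpoly := contraction_polynomial hm hb hκ hα hα1 hα2 hα3 hs hs' hs'' hx' hcase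
  have hT := Real.sq_sqrt (shockSpeedSq_pos hm (b + x) p).le
  have hT0 := Real.sq_sqrt (shockSpeedSq_pos hm b (b + s₀)).le
  have hθ := Real.sqrt_pos.2 (shockSpeedSq_pos hm (b + x) p)
  have hθ0 := Real.sqrt_pos.2 (shockSpeedSq_pos hm b (b + s₀))
  set θ := √(shockSpeedSq m (b + x) p) with hθdef
  set θ₀ := √(shockSpeedSq m b (b + s₀)) with hθ0def
  unfold shockSpeedSq at hT hT0
  clear_value θ θ₀
  -- Completing the square: y = θ(v₋ - v_L) + p(w₋) - p(w_L), in which the stress is written p(·).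
  -- The Rankine–Hugoniot relations of the two shocks turn the same expression for u₊ and u_R into y
  -- + r with r = θ₀ s₀ (θ₀ - θ).
  have hy : (θ * d - ((b + x) ^ 2 + (b + x) * b + b ^ 2 + m) * x + θ₀ * s₀ * (θ₀ - θ)) ^ 2
      ≤ 2 * (θ * d - ((b + x) ^ 2 + (b + x) * b + b ^ 2 + m) * x) ^ 2
        + 2 * (θ₀ * s₀ * (θ₀ - θ)) ^ 2 := by
    rw [← mul_add]; exact add_sq_le
  -- Replacing θ₀ by θ + θ₀ leaves the difference of squares θ² - θ₀², which is free of square roots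
  -- and is split below into a multiple of p - (b + s₀) and a multiple of x.
  have hdiff : (θ₀ * s₀ * (θ₀ - θ)) ^ 2 ≤ s₀ ^ 2 * (θ ^ 2 - θ₀ ^ 2) ^ 2 := by
    have h1 : θ₀ ^ 2 * (θ₀ - θ) ^ 2 ≤ (θ + θ₀) ^ 2 * (θ₀ - θ) ^ 2 := by
      gcongr; linarith
    have h2 : s₀ ^ 2 * (θ₀ ^ 2 * (θ₀ - θ) ^ 2) ≤ s₀ ^ 2 * ((θ + θ₀) ^ 2 * (θ₀ - θ) ^ 2) := by gcongr
    linarith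
  have hsq : (θ ^ 2 - θ₀ ^ 2) ^ 2 ≤ 2 * ((p - (b + s₀)) ^ 2 * (p + (b + s₀) + (b + x)) ^ 2
        + x ^ 2 * ((b + x) + b + (b + s₀)) ^ 2) := by
    have : θ ^ 2 - θ₀ ^ 2 = (p - (b + s₀)) * (p + (b + s₀) + (b + x))
        + x * ((b + x) + b + (b + s₀)) := by rw [hT, hT0]; ring
    rw [this]
    rw [← mul_pow, ← mul_pow]; exact add_sq_le
  set y := θ * d - ((b + x) ^ 2 + (b + x) * b + b ^ 2 + m) * x with hydef
  set r := θ₀ * s₀ * (θ₀ - θ) with hrdef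
  have hα4 : α ^ 2 ≤ 1 / 4 := by linarith [pow_le_pow_left₀ hα.le hα1 2]
  have h1 : α ^ 2 * (y + r) ^ 2 ≤ α ^ 2 * (2 * y ^ 2 + 2 * r ^ 2) := by gcongr
  -- With α ≤ 1/2 this half of the square is absorbed by -y².
  have h2 : α ^ 2 * (2 * y ^ 2) ≤ 1 / 4 * (2 * y ^ 2) := by gcongr
  have h3 : α ^ 2 * (2 * r ^ 2) ≤ α ^ 2 * (2 * (s₀ ^ 2 * (2 * ((p - (b + s₀)) ^ 2 *
      (p + (b + s₀) + (b + x)) ^ 2 + x ^ 2 * ((b + x) + b + (b + s₀)) ^ 2)))) := by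
    gcongr; exact hdiff.trans (by gcongr)
  have hfin : -y ^ 2 + α ^ 2 * (y + r) ^ 2
      - x ^ 2 * ((((b + x) ^ 2 + 2 * (b + x) * b + 3 * b ^ 2) / 2 + m) * (p - b) * (p + (b + x) + b)
        - ((b + x) ^ 2 + (b + x) * b + b ^ 2 + m) * x * ((b + x) + b) / 2)
      - α ^ 2 * (p - (b + s₀)) ^ 2 *
        ((p ^ 2 + p * (b + s₀) + (b + s₀) ^ 2 + m) * (p ^ 2 - (b + s₀) ^ 2) / 2
        + ((p ^ 2 + 2 * p * (b + s₀) + 3 * (b + s₀) ^ 2) / 2 + m) * (s₀ - x)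
          * (p + (b + x) + (b + s₀))) ≤ 0 := by
    have := sq_nonneg y
    clear_value y r
    linarith
  refine nonpos_of_mul_nonpos_right (a := 2 * θ) (le_trans (le_of_eq ?_) hfin) (by positivity)
  linear_combination (-((((b + x) ^ 2 + 2 * (b + x) * b + 3 * b ^ 2) / 2 + m) * x ^ 2)
      + α ^ 2 * ((p ^ 2 + 2 * p * (b + s₀) + 3 * (b + s₀) ^ 2) / 2 + m) * (p - (b + s₀)) ^ 2
      + α ^ 2 * (p - (b + x)) * (2 * (y + r)
        + ((θ ^ 2 - (p ^ 2 + p * (b + x) + (b + x) ^ 2 + m)) * (p - (b + x))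
          - (θ₀ ^ 2 - ((b + s₀) ^ 2 + (b + s₀) * b + b ^ 2 + m)) * s₀))) * hT
    - α ^ 2 * s₀ * (2 * (y + r)
        + ((θ ^ 2 - (p ^ 2 + p * (b + x) + (b + x) ^ 2 + m)) * (p - (b + x))
          - (θ₀ ^ 2 - ((b + s₀) ^ 2 + (b + s₀) * b + b ^ 2 + m)) * s₀)) * hT0

/-- The conditions on α involve only m, b, κ and δ. What is asked of s₀ is left to ε, so the weight
is fixed before the shock strength. A negative b is reached through u ↦ -u. -/
lemma exists_weight_dissipation_nonpos {m b κ δ : ℝ} (hm : 0 < m) (hb : b ≠ 0) (hκ : 0 < κ)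
    (hδ : 0 < δ) :
    ∃ α : ℝ, 0 < α ∧ α ≤ 1 / 2 ∧ α ≤ δ ∧ ∃ ε > 0, ∀ s₀ : ℝ, 0 < s₀ → s₀ < ε →
      ∀ uL um up : State, uL 0 = b → |um 0 - b| ≤ κ * α * s₀ →
        3 * um 0 ^ 2 ≤ up 0 ^ 2 + up 0 * um 0 + um 0 ^ 2 →
        up 1 - um 1 = √(shockSpeedSq m (um 0) (up 0)) * (up 0 - um 0) →
        dissipation m (α ^ 2) uL (shockCurve1 m uL (Real.sign b * s₀)) um up
          (-√(shockSpeedSq m (um 0) (up 0))) ≤ 0 := by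
  have hb' : 0 < |b| := abs_pos.2 hb
  set D := 6 * |b| * (4 * |b| ^ 2 + m) with hD
  have hD0 : 0 < D := by positivity
  refine ⟨min (min (1 / 2) δ) (min (1 / (100 * κ)) (|b| ^ 3 / (128 * (D * κ ^ 3)))),
    by positivity, (min_le_left _ _).trans (min_le_left _ _),
    (min_le_left _ _).trans (min_le_right _ _), min (|b| / 1000) (2 * |b| ^ 4 / (D * κ ^ 2)),
    by positivity, ?_⟩
  set α := min (min (1 / 2) δ) (min (1 / (100 * κ)) (|b| ^ 3 / (128 * (D * κ ^ 3)))) with hαdef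
  have hα : 0 < α := by positivity
  have hα1 : α ≤ 1 / 2 := (min_le_left _ _).trans (min_le_left _ _)
  have hα2 : κ * α ≤ 1 / 100 := by
    have : α ≤ 1 / (100 * κ) := (min_le_right _ _).trans (min_le_left _ _)
    calc κ * α ≤ κ * (1 / (100 * κ)) := by gcongr
      _ = 1 / 100 := by field_simp
  have hα3 : D * κ ^ 3 * α ≤ |b| ^ 3 / 128 := by
    have : α ≤ |b| ^ 3 / (128 * (D * κ ^ 3)) := (min_le_right _ _).trans (min_le_right _ _)
    calc D * κ ^ 3 * α ≤ D * κ ^ 3 * (|b| ^ 3 / (128 * (D * κ ^ 3))) := by gcongr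
      _ = |b| ^ 3 / 128 := by field_simp
  clear_value α
  intro s₀ hs hs' uL um up huL hx hp hRH
  have hs1 : s₀ ≤ |b| / 1000 := hs'.le.trans (min_le_left _ _)
  have hs2 : D * κ ^ 2 * s₀ ≤ 2 * |b| ^ 4 := by
    have : s₀ ≤ 2 * |b| ^ 4 / (D * κ ^ 2) := hs'.le.trans (min_le_right _ _)
    calc D * κ ^ 2 * s₀ ≤ D * κ ^ 2 * (2 * |b| ^ 4 / (D * κ ^ 2)) := by gcongr
      _ = 2 * |b| ^ 4 := by field_simp
  rcases lt_or_gt_of_ne hb with h | h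
  · have hab : |b| = -b := abs_of_neg h
    rw [Real.sign_of_neg h, ← dissipation_neg, neg_shockCurve1 uL (by linarith)]
    have e : shockSpeedSq m (um 0) (up 0) = shockSpeedSq m ((-um) 0) ((-up) 0) := by
      simp only [shockSpeedSq, PiLp.neg_apply]; ring
    rw [e, neg_mul, one_mul, neg_neg]
    refine dissipation_nonpos_of_pos hm hb' hκ hα hα1 hα2 hα3 hs hs1 hs2 (by simp [huL, hab]) ?_ ?_ ?_
    · rw [hab, PiLp.neg_apply, ← abs_neg]
      convert hx using 2; ring
    · simp only [PiLp.neg_apply]; linarith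
    · rw [← e]; simp only [PiLp.neg_apply]; linarith
  · have hab : |b| = b := abs_of_pos h
    rw [Real.sign_of_pos h, one_mul]
    exact dissipation_nonpos_of_pos hm hb' hκ hα hα1 hα2 hα3 hs hs1 hs2 (by rw [huL, hab])
      (by rwa [hab]) hp hRH

/-! ### Rankine–Hugoniot and Lax conditions -/

/-- The jump of states `um`, `up` travels with speed `σ`. -/
def RankineHugoniot (m : ℝ) (um up : State) (σ : ℝ) : Prop :=
  σ • (up - um) = flux m up - flux m um

lemma RankineHugoniot.fst {m : ℝ} {um up : State} {σ : ℝ} (h : RankineHugoniot m um up σ) :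
    σ * (up 0 - um 0) = -(up 1 - um 1) := by
  have := congrArg (fun v : State => v 0) h
  simp [flux] at this
  linarith

lemma RankineHugoniot.snd {m : ℝ} {um up : State} {σ : ℝ} (h : RankineHugoniot m um up σ) :
    σ * (up 1 - um 1) = stress m (up 0) - stress m (um 0) := by
  have := congrArg (fun v : State => v 1) h
  simpa [flux] using this

/-- The first component shows that w must jump if anything does; eliminating the velocity jump and
dividing by that of w gives the speed. -/
lemma RankineHugoniot.sq_eq {m : ℝ} {um up : State} {σ : ℝ} (h : RankineHugoniot m um up σ)
    (hne : um ≠ up) : up 0 ≠ um 0 ∧ σ ^ 2 = shockSpeedSq m (um 0) (up 0) := by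
  have h1 := h.fst
  have h2 := h.snd
  have h0 : up 0 ≠ um 0 := by
    intro h0
    rw [h0] at h1
    apply hne
    ext i
    fin_cases i
    · exact h0.symm
    · simp at h1 ⊢; linarith
  refine ⟨h0, mul_right_cancel₀ (sub_ne_zero.2 h0) ?_⟩
  unfold shockSpeedSq
  unfold stress at h2
  linear_combination σ * h1 - h2

/-- Characterization of the Lax 1-shocks. -/
lemma LaxCondition.of_neg {m : ℝ} (hm : 0 < m) {um up : State} {σ : ℝ}
    (h : RankineHugoniot m um up σ) (hne : um ≠ up) (hL : LaxCondition m um up σ) (hσ : σ < 0) :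
    σ = -√(shockSpeedSq m (um 0) (up 0)) ∧ 3 * um 0 ^ 2 ≤ up 0 ^ 2 + up 0 * um 0 + um 0 ^ 2 ∧
      up 1 - um 1 = √(shockSpeedSq m (um 0) (up 0)) * (up 0 - um 0) ∧ speed1 m up < σ ∧
      σ ≤ speed1 m um := by
  obtain ⟨h0, hsq⟩ := h.sq_eq hne
  have hsqrt : √(shockSpeedSq m (um 0) (up 0)) = -σ := by
    rw [← hsq, Real.sqrt_sq_eq_abs, abs_of_neg hσ]
  rcases hL with ⟨hL1, hL2⟩ | ⟨hL1, hL2⟩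
  · have e1 : 3 * um 0 ^ 2 + m ≤ σ ^ 2 := by
      have : √(3 * um 0 ^ 2 + m) ≤ -σ := by unfold speed1 at hL1; linarith
      rw [← neg_sq σ]
      exact (Real.sqrt_le_left (by linarith)).1 this
    have hcond : 3 * um 0 ^ 2 ≤ up 0 ^ 2 + up 0 * um 0 + um 0 ^ 2 := by
      rw [hsq] at e1; unfold shockSpeedSq at e1; linarith
    refine ⟨by linarith, hcond, by rw [hsqrt]; linarith [h.fst], lt_of_le_of_ne hL2 ?_, hL1⟩
    -- Equality in the Lax condition at the right state would force w₋ = -2w₊, and then the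
    -- condition at the left state reads 12 w₊² ≤ 3 w₊², so both vanish. The strict inequality later
    -- rules out σ ≤ Λ(u₊).
    intro heq
    have e2 : σ ^ 2 = 3 * up 0 ^ 2 + m := by
      rw [← heq, speed1, neg_sq, Real.sq_sqrt (by positivity)]
    rw [hsq] at e2
    unfold shockSpeedSq at e2
    have e3 : (up 0 - um 0) * (2 * up 0 + um 0) = 0 := by linarith
    rcases mul_eq_zero.1 e3 with e3 | e3
    · exact h0 (by linarith)
    · have e4 : um 0 = -2 * up 0 := by linarith
      rw [e4] at hcond
      have e5 : up 0 = 0 := by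
        have : up 0 ^ 2 = 0 := le_antisymm (by nlinarith) (sq_nonneg _)
        exact pow_eq_zero_iff (two_ne_zero) |>.1 this
      exact h0 (by rw [e4, e5]; ring)
  -- A 2-shock has speed at least λ₂(u₊) ≥ 0, contradicting σ < 0.
  · have : 0 ≤ speed2 m up := Real.sqrt_nonneg _
    linarith

/-- Under the Rankine–Hugoniot condition the dissipation of a jump is that of its left state
minus the weighted entropy production. -/
lemma dissipation_eq_of_rankineHugoniot {m a : ℝ} {uL uR um up : State} {σ : ℝ}
    (h : RankineHugoniot m um up σ) :
    dissipation m a uL uR um up σ = dissipation m a uL uR um um σ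
      - a * (-σ * (up 0 - um 0) ^ 2 * (up 0 ^ 2 - um 0 ^ 2) / 4) := by
  have h1 := h.fst
  have h2 := h.snd
  simp only [dissipation, relEntropy_eq, relEntropyFlux_eq]
  unfold stress at *
  linear_combination (-a * ((up 1 + um 1) / 2 - uR 1)) * h2
    + a * ((-(up 0) ^ 3 - m * up 0 - (um 0) ^ 3 - m * um 0) / 2 - (-(uR 0) ^ 3 - m * uR 0)) * h1

lemma dissipation_self_eq (m a : ℝ) (uL uR u : State) (σ : ℝ) :
    dissipation m a uL uR u u σ = σ * (relEntropy m u uL - a * relEntropy m u uR)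
      - (relEntropyFlux m u uL - a * relEntropyFlux m u uR) := by
  unfold dissipation; ring

lemma continuous_relEntropy (m : ℝ) (b : State) : Continuous fun u => relEntropy m u b := by
  simp only [relEntropy_eq]; fun_prop

lemma continuous_relEntropyFlux (m : ℝ) (b : State) :
    Continuous fun u => relEntropyFlux m u b := by
  simp only [relEntropyFlux_eq, stress]; fun_prop

lemma continuous_speed1 (m : ℝ) : Continuous (speed1 m) := by
  unfold speed1; fun_prop

/-! ### Construction of an admissible velocity field -/

/-- A velocity field on the state space for which every shift that follows it makes the weighted
relative entropy with respect to the shock `(uL, uR)` nonincreasing. -/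
def IsAdmissibleVelocity (m : ℝ) (V : Set State) (a : ℝ) (uL uR : State) (Λ : State → ℝ) : Prop :=
  ∀ um ∈ V, ∀ up ∈ V, ∀ σ : ℝ, min (Λ um) (Λ up) ≤ σ → σ ≤ max (Λ um) (Λ up) →
    (um ≠ up → RankineHugoniot m um up σ ∧ LaxCondition m um up σ) →
      dissipation m a uL uR um up σ ≤ 0

lemma relEntropy_eq_zero {m : ℝ} (hm : 0 < m) {u b : State} (h : relEntropy m u b ≤ 0) : u = b := by
  have h1 := le_relEntropy (m := m) u b
  have h2 : 0 < min 1 m / 2 := by positivity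
  have h3 : ‖u - b‖ ^ 2 ≤ 0 := by
    by_contra! h3
    have := mul_pos h2 h3
    linarith
  have h4 : ‖u - b‖ = 0 := pow_eq_zero_iff two_ne_zero |>.1 (le_antisymm h3 (sq_nonneg _))
  exact sub_eq_zero.1 (norm_eq_zero.1 h4)

/-- With c(u) = η(u|u_L) - a η(u|u_R), the dissipation of a trivial jump is σ c(u) - F(u), so
lowering σ helps wherever c > 0. Subtracting a large multiple of max(c, 0) from λ₁ settles the
states outside {c ≤ a η(·|u_R)}. Inside that set `hK` applies, both to shocks and to trivial jumps
at speed λ₁. -/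
lemma exists_isAdmissibleVelocity {m : ℝ} (hm : 0 < m) {V : Set State} (hV : IsCompact V)
    {a : ℝ} (ha : 0 < a) {uL uR : State} (hne : uL ≠ uR)
    (hK : ∀ um ∈ V, ∀ up ∈ V, relEntropy m um uL ≤ 2 * a * relEntropy m um uR →
      3 * um 0 ^ 2 ≤ up 0 ^ 2 + up 0 * um 0 + um 0 ^ 2 →
      up 1 - um 1 = √(shockSpeedSq m (um 0) (up 0)) * (up 0 - um 0) →
      dissipation m a uL uR um up (-√(shockSpeedSq m (um 0) (up 0))) ≤ 0) :
    ∃ Λ : State → ℝ, Continuous Λ ∧ IsAdmissibleVelocity m V a uL uR Λ := by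
  set coef : State → ℝ := fun u => relEntropy m u uL - a * relEntropy m u uR with hcoef
  have hcc : Continuous coef :=
    (continuous_relEntropy m uL).sub (continuous_const.mul (continuous_relEntropy m uR))
  set F : State → ℝ := fun u => relEntropyFlux m u uL - a * relEntropyFlux m u uR with hF
  have hFc : Continuous F :=
    (continuous_relEntropyFlux m uL).sub (continuous_const.mul (continuous_relEntropyFlux m uR))
  have hdis : ∀ u σ, dissipation m a uL uR u u σ = σ * coef u - F u := fun u σ =>
    dissipation_self_eq m a uL uR u σ
  have hself : ∀ u ∈ V, relEntropy m u uL ≤ 2 * a * relEntropy m u uR →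
      speed1 m u * coef u - F u ≤ 0 := by
    intro u hu h
    have := hK u hu u hu h (by linarith) (by ring)
    have e : -√(shockSpeedSq m (u 0) (u 0)) = speed1 m u := by
      unfold speed1 shockSpeedSq; congr 2; ring
    rwa [e, hdis] at this
  -- This is the set η(u|u_L) ≥ 2a η(u|u_R). The factor 2 keeps c away from zero on it: if c
  -- vanished there, both relative entropies would vanish, against u_L ≠ u_R. Hence the quotient
  -- below is bounded.
  have hKc : IsCompact (V ∩ {u | a * relEntropy m u uR ≤ coef u}) :=
    hV.inter_right (isClosed_le (continuous_const.mul (continuous_relEntropy m uR)) hcc)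
  have hpos : ∀ u ∈ V ∩ {u | a * relEntropy m u uR ≤ coef u}, 0 < coef u := by
    rintro u ⟨-, hu⟩
    rw [mem_ofPred_eq] at hu
    have h1 : 0 ≤ a * relEntropy m u uR := mul_nonneg ha.le (relEntropy_nonneg hm u uR)
    by_contra! hc
    have h2 : relEntropy m u uR ≤ 0 := by
      by_contra! h3
      have := mul_pos ha h3
      linarith
    have h3 : relEntropy m u uL ≤ 0 := by
      have : coef u = relEntropy m u uL - a * relEntropy m u uR := rfl
      have : a * relEntropy m u uR ≤ 0 := by linarith
      linarith
    exact hne ((relEntropy_eq_zero hm h3).symm.trans (relEntropy_eq_zero hm h2))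
  obtain ⟨N, hN⟩ := hKc.exists_bound_of_continuousOn
    (f := fun u => (speed1 m u * coef u - F u) / coef u ^ 2)
    (((((continuous_speed1 m).mul hcc).sub hFc).continuousOn).div (hcc.pow 2).continuousOn
      fun u hu => (pow_pos (hpos u hu) 2).ne')
  refine ⟨fun u => speed1 m u - |N| * max (coef u) 0,
    (continuous_speed1 m).sub (continuous_const.mul (hcc.max continuous_const)), ?_⟩
  set Λ : State → ℝ := fun u => speed1 m u - |N| * max (coef u) 0 with hΛ
  have hΛle : ∀ u, Λ u ≤ speed1 m u := fun u => by
    have : 0 ≤ |N| * max (coef u) 0 := by positivity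
    simp only [hΛ]; linarith
  have hout : ∀ u ∈ V, 0 ≤ coef u → ∀ σ ≤ Λ u, σ * coef u - F u ≤ 0 := by
    intro u hu hc σ hσ
    have h1 : σ * coef u ≤ Λ u * coef u := by gcongr
    suffices h : Λ u * coef u - F u ≤ 0 by linarith
    by_cases hu' : a * relEntropy m u uR ≤ coef u
    · have h2 := (le_abs_self _).trans ((hN u ⟨hu, hu'⟩).trans (le_abs_self N))
      rw [div_le_iff₀ (pow_pos (hpos u ⟨hu, hu'⟩) 2)] at h2
      have h3 : Λ u * coef u = speed1 m u * coef u - |N| * coef u ^ 2 := by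
        simp only [hΛ, max_eq_left hc]; ring
      linarith
    · have h2 := hself u hu (by
        have : coef u = relEntropy m u uL - a * relEntropy m u uR := rfl
        linarith)
      have h3 : Λ u * coef u ≤ speed1 m u * coef u := by gcongr; exact hΛle u
      linarith
  have hneg : ∀ u, speed1 m u < 0 := fun u => by
    unfold speed1; rw [neg_lt_zero, Real.sqrt_pos]; positivity
  intro um hum up hup σ hσ1 hσ2 hj
  by_cases heq : um = up
  · subst heq
    have hσ : σ = Λ um := le_antisymm (by simpa using hσ2) (by simpa using hσ1)
    rw [hdis]
    -- The maximum in the field makes Λ equal to λ₁ where c ≤ 0, so that `hself` covers this case.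
    rcases le_total 0 (coef um) with hc | hc
    · exact hout um hum hc σ hσ.le
    · have e : Λ um = speed1 m um := by simp [hΛ, max_eq_right hc]
      rw [hσ, e]
      refine hself um hum ?_
      have h1 : 0 ≤ a * relEntropy m um uR := mul_nonneg ha.le (relEntropy_nonneg hm um uR)
      have : coef um = relEntropy m um uL - a * relEntropy m um uR := rfl
      linarith
  · obtain ⟨hRH, hL⟩ := hj heq
    have hσneg : σ < 0 := hσ2.trans_lt (max_lt ((hΛle um).trans_lt (hneg um))
      ((hΛle up).trans_lt (hneg up)))
    obtain ⟨e1, e2, e3, e4, e5⟩ := hL.of_neg hm hRH heq hσneg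
    -- The speed is below one of the two values of Λ, and not below Λ(u₊), because Λ(u₊) ≤ λ₁(u₊) <
    -- σ.
    have hσm : σ ≤ Λ um := by
      rcases le_max_iff.1 hσ2 with h | h
      · exact h
      · linarith [hΛle up]
    rcases le_total 0 (coef um) with hc | hc
    · rw [dissipation_eq_of_rankineHugoniot hRH, hdis]
      -- The trivial jump at u₋ already has the right sign; the rest is the entropy production,
      -- nonnegative because the Lax condition forces |w₊| ≥ |w₋|.
      have h1 := hout um hum hc σ hσm
      have h2 : 0 ≤ up 0 ^ 2 - um 0 ^ 2 := by
        by_contra! h3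
        have h4 : |up 0| < |um 0| := sq_lt_sq.1 (by linarith)
        have h5 : up 0 * um 0 ≤ |um 0| * |um 0| := by
          calc up 0 * um 0 ≤ |up 0 * um 0| := le_abs_self _
            _ = |up 0| * |um 0| := abs_mul _ _
            _ ≤ _ := by gcongr
        rw [abs_mul_abs_self] at h5
        linarith
      have h3 : 0 ≤ -σ := by linarith
      have h4 : 0 ≤ a * (-σ * (up 0 - um 0) ^ 2 * (up 0 ^ 2 - um 0 ^ 2) / 4) := by positivity
      linarith
    · rw [e1]
      refine hK um hum up hup ?_ e2 e3
      have h1 : 0 ≤ a * relEntropy m um uR := mul_nonneg ha.le (relEntropy_nonneg hm um uR)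
      have : coef um = relEntropy m um uL - a * relEntropy m um uR := rfl
      linarith

/-- Small 1-shocks admit an admissible velocity, with a weight that does not depend on the
strength of the shock. -/
theorem exists_admissible_one {m : ℝ} (hm : 0 < m) {V : Set State} (hV : IsCompact V)
    {uL : State} (huL : uL ∈ V) (hw : uL 0 ≠ 0) :
    ∃ ε > 0, ∃ a : ℝ, 0 < a ∧ a < 1 ∧ ∀ s₀ : ℝ, 0 < s₀ → s₀ < ε →
      ∀ uR ∈ V, uR = shockCurve1 m uL (Real.sign (uL 0) * s₀) →
        ∃ Λ : State → ℝ, Continuous Λ ∧ IsAdmissibleVelocity m V a uL uR Λ := by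
  obtain ⟨M, hM⟩ := hV.isBounded.exists_norm_le
  set c := min 1 m / 2 with hc
  have hc0 : 0 < c := by positivity
  set C := 1 + 2 * M ^ 2 + m with hC
  have hC0 : 0 < C := by positivity
  -- If η(u|u_L) ≤ 2α² η(u|u_R), the quadratic bounds with constants c and C give (c/2)|u - u_L|² ≤
  -- 4α² C |u_R - u_L|², and |u_R - u_L|² ≤ (1 + 3M² + m) s₀². This κ is the resulting constant; the
  -- choice δ = c/(8C) allows the |u - u_L|² on the right to be absorbed.
  set κ := √(8 * C / c * (1 + 3 * M ^ 2 + m)) with hκ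
  have hκ0 : 0 < κ := Real.sqrt_pos.2 (by positivity)
  obtain ⟨α, hα, hα1, hα2, ε, hε, H⟩ := exists_weight_dissipation_nonpos (δ := c / (8 * C))
    hm hw hκ0 (by positivity)
  have hαα : α ^ 2 ≤ α / 2 := by nlinarith
  refine ⟨ε, hε, α ^ 2, by positivity, by linarith, ?_⟩
  intro s₀ hs hs' uR huR hR
  have hsign : Real.sign (uL 0) ^ 2 = 1 := by
    rcases Real.sign_apply_eq_of_ne_zero _ hw with h | h <;> rw [h] <;> norm_num
  have hsn : Real.sign (uL 0) * s₀ ≠ 0 := by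
    intro h
    rcases mul_eq_zero.1 h with h | h
    · rw [h] at hsign; norm_num at hsign
    · exact hs.ne' h
  have hR' := hR
  rw [shockCurve1_eq uL hsn] at hR'
  have hR0 : uR 0 = uL 0 + Real.sign (uL 0) * s₀ := by rw [hR']; simp
  have hR1 : uR 1 = uL 1 + √(shockSpeedSq m (uL 0) (uR 0)) * (Real.sign (uL 0) * s₀) := by
    rw [hR0, hR']; simp
  have hdist : ‖uR - uL‖ ^ 2 ≤ (1 + 3 * M ^ 2 + m) * s₀ ^ 2 := by
    rw [State.norm_sq_eq]
    simp only [PiLp.sub_apply]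
    have e1 : uR 0 - uL 0 = Real.sign (uL 0) * s₀ := by rw [hR0]; ring
    have e2 : uR 1 - uL 1 = √(shockSpeedSq m (uL 0) (uR 0)) * (Real.sign (uL 0) * s₀) := by
      rw [hR1]; ring
    have e3 : shockSpeedSq m (uL 0) (uR 0) ≤ 3 * M ^ 2 + m := by
      have h0 : uL 0 ^ 2 ≤ M ^ 2 := by
        rw [← sq_abs]; gcongr; exact (State.abs_apply_le _ _).trans (hM uL huL)
      have h1 : uR 0 ^ 2 ≤ M ^ 2 := by
        rw [← sq_abs]; gcongr; exact (State.abs_apply_le _ _).trans (hM uR huR)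
      unfold shockSpeedSq
      nlinarith [sq_nonneg (uR 0 - uL 0)]
    rw [e1, e2]
    have e4 : (Real.sign (uL 0) * s₀) ^ 2 = s₀ ^ 2 := by rw [mul_pow, hsign, one_mul]
    rw [mul_pow (√_), e4, Real.sq_sqrt (shockSpeedSq_pos hm _ _).le]
    nlinarith [sq_nonneg s₀]
  have hne : uL ≠ uR := by
    intro h
    rw [← h] at hR0
    exact hsn (by linarith)
  refine exists_isAdmissibleVelocity hm hV (by positivity) hne ?_
  intro um hum up hup hη hcond hRH
  rw [hR]
  refine H s₀ hs hs' uL um up rfl ?_ hcond hRH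
  have h1 : c * ‖um - uL‖ ^ 2 ≤ relEntropy m um uL := le_relEntropy um uL
  have h2 : relEntropy m um uR ≤ C * ‖um - uR‖ ^ 2 := relEntropy_le hm (hM um hum) (hM uR huR)
  have h3 : ‖um - uR‖ ^ 2 ≤ 2 * (‖um - uL‖ ^ 2 + ‖uR - uL‖ ^ 2) := by
    have : ‖um - uR‖ ≤ ‖um - uL‖ + ‖uR - uL‖ := by
      rw [← norm_neg (uR - uL), neg_sub]; exact norm_sub_le_norm_sub_add_norm_sub _ _ _
    calc ‖um - uR‖ ^ 2 ≤ (‖um - uL‖ + ‖uR - uL‖) ^ 2 := by gcongr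
      _ ≤ _ := add_sq_le
  have h4 : 4 * α ^ 2 * C ≤ c / 4 := by
    have : α * (8 * C) ≤ c := by rwa [le_div_iff₀ (by positivity)] at hα2
    nlinarith
  have h5 : c * ‖um - uL‖ ^ 2 ≤ 2 * α ^ 2 * (C * (2 * (‖um - uL‖ ^ 2 + ‖uR - uL‖ ^ 2))) :=
    h1.trans (hη.trans (by gcongr; exact h2.trans (by gcongr)))
  have h6 : c / 2 * ‖um - uL‖ ^ 2 ≤ 4 * α ^ 2 * C * ((1 + 3 * M ^ 2 + m) * s₀ ^ 2) := by
    have e1 : 4 * α ^ 2 * C * ‖um - uL‖ ^ 2 ≤ c / 4 * ‖um - uL‖ ^ 2 := by gcongr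
    have e2 : 4 * α ^ 2 * C * ‖uR - uL‖ ^ 2
      ≤ 4 * α ^ 2 * C * ((1 + 3 * M ^ 2 + m) * s₀ ^ 2) := by gcongr
    have e3 : 0 ≤ c * ‖um - uL‖ ^ 2 := by positivity
    linarith
  have h7 : ‖um - uL‖ ^ 2 ≤ (κ * α * s₀) ^ 2 := by
    rw [mul_pow, mul_pow, hκ, Real.sq_sqrt (by positivity)]
    calc ‖um - uL‖ ^ 2 = 2 / c * (c / 2 * ‖um - uL‖ ^ 2) := by field_simp
      _ ≤ 2 / c * (4 * α ^ 2 * C * ((1 + 3 * M ^ 2 + m) * s₀ ^ 2)) := by gcongr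
      _ = _ := by ring
  calc |um 0 - uL 0| ≤ ‖um - uL‖ := State.abs_apply_le (um - uL) 0
    _ ≤ κ * α * s₀ := by
      exact (sq_le_sq₀ (norm_nonneg _) (by positivity)).1 h7

/-! ### Reflection between the two characteristic fields -/

/-- The reflection `(w, v) ↦ (w, -v)`, which together with `x ↦ -x` exchanges the two fields. -/
def reflect (u : State) : State := !₂[u 0, -(u 1)]

@[simp] lemma reflect_fst (u : State) : reflect u 0 = u 0 := by simp [reflect]

@[simp] lemma reflect_snd (u : State) : reflect u 1 = -(u 1) := by simp [reflect]

lemma continuous_reflect : Continuous reflect := by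
  unfold reflect
  refine (PiLp.continuous_toLp 2 _).comp (continuous_pi fun i => ?_)
  fin_cases i <;> simp <;> fun_prop

lemma reflect_shockCurve2 (m : ℝ) (u : State) (s : ℝ) :
    reflect (shockCurve2 m u s) = shockCurve1 m (reflect u) s := by
  ext i
  fin_cases i
  · simp [shockCurve1, shockCurve2]
  · simp [shockCurve1, shockCurve2]; ring

lemma RankineHugoniot.reflect {m : ℝ} {um up : State} {σ : ℝ} (h : RankineHugoniot m um up σ) :
    RankineHugoniot m (reflect up) (reflect um) (-σ) := by
  have h1 := h.fst
  have h2 := h.snd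
  unfold RankineHugoniot
  ext i
  fin_cases i
  · simp [flux]; linarith
  · simp [flux]; linarith

lemma LaxCondition.reflect {m : ℝ} {um up : State} {σ : ℝ} (h : LaxCondition m um up σ) :
    LaxCondition m (reflect up) (reflect um) (-σ) := by
  unfold LaxCondition speed1 speed2 at *
  simp only [reflect_fst]
  rcases h with ⟨h1, h2⟩ | ⟨h1, h2⟩
  · right; constructor <;> linarith
  · left; constructor <;> linarith

/-- The reflection exchanges the two sides, so the weight moves from one term to the other;
factoring out a leaves the weight 1/a. This is why 2-shocks need a > 1. -/
lemma dissipation_reflect {m a : ℝ} (ha : a ≠ 0) (uL uR um up : State) (σ : ℝ) :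
    dissipation m a (reflect uR) (reflect uL) (reflect up) (reflect um) (-σ)
      = a * dissipation m (1 / a) uL uR um up σ := by
  simp only [dissipation, relEntropy_eq, relEntropyFlux_eq, reflect_fst, reflect_snd]
  field_simp
  ring

/-- Small 2-shocks admit an admissible velocity, with a weight that does not depend on the
strength of the shock. -/
theorem exists_admissible_two {m : ℝ} (hm : 0 < m) {V : Set State} (hV : IsCompact V)
    {uR : State} (huR : uR ∈ V) (hw : uR 0 ≠ 0) :
    ∃ ε > 0, ∃ a : ℝ, 1 < a ∧ ∀ s₀ : ℝ, 0 < s₀ → s₀ < ε →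
      ∀ uL ∈ V, uL = shockCurve2 m uR (Real.sign (uR 0) * s₀) →
        ∃ Λ : State → ℝ, Continuous Λ ∧ IsAdmissibleVelocity m V a uL uR Λ := by
  obtain ⟨ε, hε, a, ha, ha1, H⟩ := exists_admissible_one hm (hV.image continuous_reflect)
    (mem_image_of_mem reflect huR) (by rwa [reflect_fst])
  refine ⟨ε, hε, 1 / a, by rwa [one_lt_div ha], ?_⟩
  intro s₀ hs hs' uL huL hL
  obtain ⟨Λ, hΛ, hadm⟩ := H s₀ hs hs' (reflect uL) (mem_image_of_mem reflect huL)
    (by rw [hL, reflect_shockCurve2, reflect_fst])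
  refine ⟨fun u => -Λ (reflect u), (hΛ.comp continuous_reflect).neg, ?_⟩
  intro um hum up hup σ h1 h2 hj
  have h := hadm (reflect up) (mem_image_of_mem reflect hup) (reflect um)
    (mem_image_of_mem reflect hum) (-σ)
    (by rw [min_comm, ← neg_neg (min _ _), ← max_neg_neg]; linarith)
    (by rw [max_comm, ← neg_neg (max _ _), ← min_neg_neg]; linarith) ?_
  · rw [dissipation_reflect ha.ne'] at h
    exact nonpos_of_mul_nonpos_right h ha
  · intro hne
    obtain ⟨h3, h4⟩ := hj fun h => hne (by rw [h])
    exact ⟨h3.reflect, h4.reflect⟩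

/-! ### From smooth to Lipschitz test functions -/

/-- `g_t + q_x ≤ 0` in the sense of distributions on `(0, ∞) × ℝ`. -/
def IsSubPair (g q : ℝ × ℝ → ℝ) : Prop :=
  ∀ ψ : ℝ × ℝ → ℝ, IsTestFunction ψ → (∀ z, 0 ≤ ψ z) →
    0 ≤ ∫ z in spaceTime, (fderiv ℝ ψ z (1, 0) * g z + fderiv ℝ ψ z (0, 1) * q z)

lemma isOpen_spaceTime : IsOpen spaceTime := isOpen_Ioi.prod isOpen_univ

/-- A nonnegative Lipschitz function with compact support in `(0, ∞) × ℝ`. -/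
structure IsLipschitzTest (K : ℝ≥0) (ψ : ℝ × ℝ → ℝ) : Prop where
  lipschitz : LipschitzWith K ψ
  compact : HasCompactSupport ψ
  subset : tsupport ψ ⊆ spaceTime
  nonneg : ∀ z, 0 ≤ ψ z

lemma fderiv_eq_zero_of_notMem_tsupport {ψ : ℝ × ℝ → ℝ} {z : ℝ × ℝ} (hz : z ∉ tsupport ψ) :
    fderiv ℝ ψ z = 0 := by
  by_contra h
  exact hz (support_fderiv_subset ℝ h)

lemma integrable_fderiv_smul {F : Type*} [NormedAddCommGroup F] [NormedSpace ℝ F] {K : ℝ≥0}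
    {ψ : ℝ × ℝ → ℝ} (hψ : LipschitzWith K ψ) (hψc : HasCompactSupport ψ) {g : ℝ × ℝ → F} {B : ℝ}
    {S : Set (ℝ × ℝ)} (hg : AEStronglyMeasurable g (volume.restrict S))
    (hgB : ∀ᵐ z ∂(volume.restrict S), ‖g z‖ ≤ B) (e : ℝ × ℝ) :
    IntegrableOn (fun z => fderiv ℝ ψ z e • g z) S := by
  have hm : Measurable (fun z => fderiv ℝ ψ z e) := measurable_fderiv_apply_const ℝ ψ e
  have h1 : IntegrableOn (fun z => fderiv ℝ ψ z e) S := by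
    have hi : IntegrableOn (fun z => fderiv ℝ ψ z e) (tsupport ψ) := by
      refine Measure.integrableOn_of_bounded (M := K * ‖e‖) hψc.isCompact.measure_ne_top
        hm.aestronglyMeasurable (.of_forall fun z => ?_)
      exact (ContinuousLinearMap.le_opNorm _ _).trans (by
        gcongr; exact norm_fderiv_le_of_lipschitz ℝ hψ)
    exact ((integrableOn_iff_integrable_of_support_subset fun z hz => by
      by_contra h; exact hz (by simp [fderiv_eq_zero_of_notMem_tsupport h])).1 hi).restrict
  refine (h1.norm.mul_const B).mono' (hm.aestronglyMeasurable.smul hg) ?_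
  filter_upwards [hgB] with z hz
  rw [norm_smul]
  gcongr

/-- Mollify ψ. The mollified functions are smooth, nonnegative and supported in one compact
neighbourhood inside the open half-plane. Their gradients are mollifications of the gradient of ψ,
hence bounded by K and convergent almost everywhere, so dominated convergence applies. -/
theorem IsSubPair.lipschitz {g q : ℝ × ℝ → ℝ} (h : IsSubPair g q) {B : ℝ}
    (hg : AEStronglyMeasurable g (volume.restrict spaceTime))
    (hq : AEStronglyMeasurable q (volume.restrict spaceTime))
    (hgB : ∀ᵐ z ∂(volume.restrict spaceTime), |g z| ≤ B)
    (hqB : ∀ᵐ z ∂(volume.restrict spaceTime), |q z| ≤ B)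
    {K : ℝ≥0} {ψ : ℝ × ℝ → ℝ} (hψ : IsLipschitzTest K ψ) :
    0 ≤ ∫ z in spaceTime, (fderiv ℝ ψ z (1, 0) * g z + fderiv ℝ ψ z (0, 1) * q z) := by
  obtain ⟨r, hr, hrs⟩ := hψ.compact.isCompact.exists_cthickening_subset_open isOpen_spaceTime
    hψ.subset
  -- The fixed ratio of outer to inner radius is what Lebesgue differentiation requires of these
  -- kernels.
  set φ : ℕ → ContDiffBump (0 : ℝ × ℝ) := fun k =>
    ⟨r / (2 * (k + 1)), r / (k + 1), by positivity, by gcongr; linarith⟩ with hφ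
  have hout : ∀ k, (φ k).rOut ≤ r := fun k => by
    simp only [hφ]; exact div_le_self hr.le (by linarith [(Nat.cast_nonneg k : (0 : ℝ) ≤ k)])
  have hrt : Tendsto (fun k => (φ k).rOut) atTop (𝓝 0) := by
    simp only [hφ]
    have := (tendsto_one_div_add_atTop_nhds_zero_nat (𝕜 := ℝ)).const_mul r
    simpa [div_eq_mul_inv] using this
  have hr2 : ∀ᶠ k in atTop, (φ k).rOut ≤ 2 * (φ k).rIn := .of_forall fun k => by
    simp only [hφ]; rw [← div_div]; field_simp; rfl
  have hψc : Continuous ψ := hψ.lipschitz.continuous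
  set ψk : ℕ → ℝ × ℝ → ℝ := fun k =>
    MeasureTheory.convolution ((φ k).normed volume) ψ (ContinuousLinearMap.lsmul ℝ ℝ) volume with hψk
  set Dk : ℕ → ℝ × ℝ → (ℝ × ℝ →L[ℝ] ℝ) := fun k =>
    MeasureTheory.convolution ((φ k).normed volume) (fderiv ℝ ψ)
      (ContinuousLinearMap.lsmul ℝ ℝ) volume with hDk
  have hfm : Measurable (fderiv ℝ ψ) := measurable_fderiv ℝ ψ
  have hfK : ∀ z, ‖fderiv ℝ ψ z‖ ≤ K := fun z => norm_fderiv_le_of_lipschitz ℝ hψ.lipschitz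
  have hloc : LocallyIntegrable (fderiv ℝ ψ) (volume : Measure (ℝ × ℝ)) :=
    (memLp_top_of_bound hfm.aestronglyMeasurable _ (.of_forall hfK)).locallyIntegrable le_top
  -- The derivative is put on ψ rather than on the kernel, by Rademacher's theorem; this gives the
  -- bound K uniformly in k.
  have hder : ∀ k z, HasFDerivAt (ψk k) (Dk k z) z := by
    intro k z
    refine (hasFDerivAt_integral_of_dominated_loc_of_lip (μ := volume)
      (F := fun z t => (φ k).normed volume t • ψ (z - t)) (s := univ)
      (F' := fun t => (φ k).normed volume t • fderiv ℝ ψ (z - t))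
      (bound := fun t => (φ k).normed volume t * K)
      univ_mem ?_ ?_ ?_ ?_ ?_ ?_).2
    · refine .of_forall fun z' => Continuous.aestronglyMeasurable ?_
      exact (φ k).continuous_normed.smul (hψc.comp (continuous_const.sub continuous_id))
    · refine Continuous.integrable_of_hasCompactSupport ?_ ?_
      · exact (φ k).continuous_normed.smul (hψc.comp (continuous_const.sub continuous_id))
      · exact (φ k).hasCompactSupport_normed.smul_right
    · exact ((φ k).continuous_normed.measurable.smul
        (hfm.comp (measurable_const.sub measurable_id))).aestronglyMeasurable
    · refine .of_forall fun t => LipschitzOnWith.of_dist_le_mul fun x _ y _ => ?_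
      have h0 := (φ k).nonneg_normed (μ := volume) t
      rw [dist_eq_norm, ← smul_sub, norm_smul, Real.norm_of_nonneg h0, Real.coe_nnabs,
        abs_of_nonneg (by positivity), mul_assoc]
      gcongr
      have := hψ.lipschitz.dist_le_mul (x - t) (y - t)
      rwa [dist_sub_right, dist_eq_norm] at this
    · exact (φ k).integrable_normed.mul_const _
    · have h1 : ∀ᵐ t ∂(volume : Measure (ℝ × ℝ)), DifferentiableAt ℝ ψ (z - t) :=
        (Measure.measurePreserving_sub_left volume z).quasiMeasurePreserving.ae
          hψ.lipschitz.ae_differentiableAt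
      filter_upwards [h1] with t ht
      have h2 : HasFDerivAt (fun x => ψ (x - t)) (fderiv ℝ ψ (z - t)) z := by
        have := ht.hasFDerivAt.comp z ((hasFDerivAt_id z).sub_const t)
        simpa [Function.comp_def] using this
      exact h2.fun_const_smul _
  have hKb : ∀ k z, ‖Dk k z‖ ≤ K := by
    intro k z
    calc ‖Dk k z‖ ≤ ∫ t, (φ k).normed volume t * K := by
          refine norm_integral_le_of_norm_le ((φ k).integrable_normed.mul_const _)
            (.of_forall fun t => ?_)
          simp only [ContinuousLinearMap.lsmul_apply, norm_smul,
            Real.norm_of_nonneg ((φ k).nonneg_normed (μ := volume) t)]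
          gcongr
          · exact (φ k).nonneg_normed t
          · exact hfK _
      _ = K := by rw [integral_mul_const, (φ k).integral_normed, one_mul]
  have hsupp : ∀ k, tsupport (ψk k) ⊆ Metric.cthickening r (tsupport ψ) := by
    intro k
    refine closure_minimal ?_ Metric.isClosed_cthickening
    refine (support_convolution_subset _).trans ?_
    rw [(φ k).support_normed_eq]
    rintro _ ⟨a, ha, b, hb, rfl⟩
    refine Metric.mem_cthickening_of_dist_le _ b _ _ (subset_tsupport _ hb) ?_
    rw [dist_eq_norm, add_sub_cancel_right]
    rw [mem_ball_zero_iff] at ha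
    exact ha.le.trans (hout k)
  have hcomp : IsCompact (Metric.cthickening r (tsupport ψ)) :=
    hψ.compact.isCompact.cthickening
  have htest : ∀ k, IsTestFunction (ψk k) := fun k =>
    ⟨(φ k).hasCompactSupport_normed.contDiff_convolution_left _ (φ k).contDiff_normed
        hψc.locallyIntegrable,
      hcomp.of_isClosed_subset (isClosed_tsupport _) (hsupp k), (hsupp k).trans hrs⟩
  have hnn : ∀ k z, 0 ≤ ψk k z := fun k z =>
    integral_nonneg fun t => mul_nonneg ((φ k).nonneg_normed t) (hψ.nonneg _)
  have hlim : ∀ᵐ z ∂(volume.restrict spaceTime), Tendsto (fun k => Dk k z) atTop (𝓝 (fderiv ℝ ψ z)) :=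
    ae_restrict_of_ae (ContDiffBump.ae_convolution_tendsto_right_of_locallyIntegrable hrt hr2 hloc)
  have hzero : ∀ k z, z ∉ Metric.cthickening r (tsupport ψ) → Dk k z = 0 := by
    intro k z hz
    rw [← (hder k z).fderiv]
    by_contra h
    exact hz (hsupp k (support_fderiv_subset ℝ h))
  have hT : Tendsto (fun k => ∫ z in spaceTime, (Dk k z (1, 0) * g z + Dk k z (0, 1) * q z)) atTop
      (𝓝 (∫ z in spaceTime, (fderiv ℝ ψ z (1, 0) * g z + fderiv ℝ ψ z (0, 1) * q z))) := by
    refine tendsto_integral_of_dominated_convergence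
      (fun z => (Metric.cthickening r (tsupport ψ)).indicator (fun _ => 2 * K * B) z) ?_ ?_ ?_ ?_
    · intro k
      have h1 : ∀ e, AEStronglyMeasurable (fun z => Dk k z e) (volume.restrict spaceTime) := by
        intro e
        have : (fun z => Dk k z e) = fun z => fderiv ℝ (ψk k) z e := by
          ext z; rw [(hder k z).fderiv]
        rw [this]
        exact (measurable_fderiv_apply_const ℝ _ e).aestronglyMeasurable
      exact ((h1 _).mul hg).add ((h1 _).mul hq)
    · refine Integrable.restrict ?_
      rw [integrable_indicator_iff hcomp.isClosed.measurableSet]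
      exact integrableOn_const hcomp.measure_ne_top
    · intro k
      filter_upwards [hgB, hqB] with z h1 h2
      by_cases hz : z ∈ Metric.cthickening r (tsupport ψ)
      · rw [indicator_of_mem hz]
        have e1 : ‖Dk k z (1, 0)‖ ≤ K := by
          refine ((Dk k z).le_opNorm _).trans ?_
          simpa using hKb k z
        have e2 : ‖Dk k z (0, 1)‖ ≤ K := by
          refine ((Dk k z).le_opNorm _).trans ?_
          simpa using hKb k z
        calc _ ≤ ‖Dk k z (1, 0)‖ * ‖g z‖ + ‖Dk k z (0, 1)‖ * ‖q z‖ := by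
              rw [← norm_mul, ← norm_mul]; exact norm_add_le _ _
          _ ≤ K * B + K * B := by
              gcongr <;> assumption
          _ = 2 * K * B := by ring
      · simp [hzero k z hz, indicator_of_notMem hz]
    · filter_upwards [hlim] with z hz
      have h1 : ∀ e, Tendsto (fun k => Dk k z e) atTop (𝓝 (fderiv ℝ ψ z e)) := fun e =>
        ((ContinuousLinearMap.apply ℝ ℝ e).continuous.tendsto _).comp hz
      exact ((h1 _).mul_const _).add ((h1 _).mul_const _)
  refine ge_of_tendsto' hT fun k => ?_
  have := h (ψk k) (htest k) (hnn k)
  simpa only [(hder k _).fderiv] using this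

/-! ### One-sided traces at almost every time -/

/-- The essential supremum over a fibre exceeds c exactly when the fibre of {f > c} has positive
measure, and fibre measures are measurable. -/
lemma aemeasurable_essSup_prod {α β : Type*} [MeasurableSpace α] [MeasurableSpace β]
    {μ : Measure α} {ν : Measure β} [SFinite μ] [SFinite ν] {f : α × β → ℝ≥0∞}
    (hf : AEMeasurable f (μ.prod ν)) :
    AEMeasurable (fun a => essSup (fun b => f (a, b)) ν) μ := by
  refine ⟨fun a => essSup (fun b => hf.mk f (a, b)) ν, measurable_of_Ioi fun c => ?_, ?_⟩
  · have h : (fun a => essSup (fun b => hf.mk f (a, b)) ν) ⁻¹' Ioi c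
        = (fun a => ν (Prod.mk a ⁻¹' {z | c < hf.mk f z})) ⁻¹' {0}ᶜ := by
      ext a
      simp only [mem_preimage, mem_Ioi, mem_compl_iff, mem_singleton_iff]
      rw [← not_le, not_iff_not]
      constructor
      · intro h
        have h1 := ae_le_essSup (μ := ν) (f := fun b => hf.mk f (a, b))
        have h2 : ∀ᵐ b ∂ν, ¬ c < hf.mk f (a, b) := by
          filter_upwards [h1] with b hb
          exact not_lt.2 (hb.trans h)
        simpa [ae_iff] using h2
      · intro h
        refine essSup_le_of_ae_le _ ?_
        have h2 : ∀ᵐ b ∂ν, ¬ c < hf.mk f (a, b) := by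
          rw [ae_iff]; simpa using h
        filter_upwards [h2] with b hb using not_lt.1 hb
    rw [h]
    exact measurable_measure_prodMk_left (measurableSet_lt measurable_const hf.measurable_mk)
      (measurableSet_singleton 0).compl
  · filter_upwards [Measure.ae_ae_of_ae_prod hf.ae_eq_mk] with a ha
    exact essSup_congr_ae ha

lemma volume_restrict_spaceTime :
    (volume.restrict spaceTime : Measure (ℝ × ℝ)) = (volume.restrict (Ioi 0)).prod volume := by
  rw [spaceTime, Measure.volume_eq_prod, ← Measure.prod_restrict, Measure.restrict_univ]

/-- In each time slice the map is a dilation followed by a translation, so almost everywhere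
statements can be read in coordinates that move with the curve. -/
lemma quasiMeasurePreserving_shear {h : ℝ → ℝ} (hh : Measurable h) {e : ℝ} (he : e ≠ 0) :
    Measure.QuasiMeasurePreserving (fun z : ℝ × ℝ => (z.1, h z.1 + e * z.2))
      (volume.restrict spaceTime) (volume.restrict spaceTime) := by
  have hm : Measurable (fun z : ℝ × ℝ => (z.1, h z.1 + e * z.2)) := by fun_prop
  refine ⟨hm, Measure.AbsolutelyContinuous.mk fun s hs h0 => ?_⟩
  rw [Measure.map_apply hm hs]
  rw [volume_restrict_spaceTime] at h0 ⊢
  rw [Measure.measure_prod_null hs] at h0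
  rw [Measure.measure_prod_null (hm hs)]
  filter_upwards [h0] with t ht
  have h1 : Prod.mk t ⁻¹' ((fun z : ℝ × ℝ => (z.1, h z.1 + e * z.2)) ⁻¹' s)
      = (e * ·) ⁻¹' ((h t + ·) ⁻¹' (Prod.mk t ⁻¹' s)) := rfl
  rw [h1, Real.volume_preimage_mul_left he, measure_preimage_add, ht]
  simp

/-- The integral of the infimum over n is at most every integral, hence zero; so the infimum
vanishes at almost every t. No subsequence is needed. -/
lemma ae_exists_ae_norm_le {E : Type*} [NormedAddCommGroup E] {f : ℝ × ℝ → E} {I : ℕ → Set ℝ}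
    (hf : AEStronglyMeasurable f (volume.restrict spaceTime))
    (hlim : ∀ T : ℝ, 0 < T → Tendsto (fun n : ℕ => ∫⁻ t in Ioo 0 T,
      essSup (fun y => ‖f (t, y)‖ₑ) (volume.restrict (I n))) atTop (𝓝 0)) :
    ∀ᵐ t ∂(volume.restrict (Ioi 0)), ∀ ε > 0, ∃ n, ∀ᵐ y ∂(volume.restrict (I n)),
      ‖f (t, y)‖ ≤ ε := by
  set E : ℕ → ℝ → ℝ≥0∞ := fun n t => essSup (fun y => ‖f (t, y)‖ₑ) (volume.restrict (I n)) with hE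
  have hEm : ∀ n, AEMeasurable (E n) (volume.restrict (Ioi 0)) := by
    intro n
    refine aemeasurable_essSup_prod (f := fun z => ‖f z‖ₑ) ?_
    have : AEMeasurable (fun z => ‖f z‖ₑ) (volume.restrict spaceTime) := hf.enorm
    rw [volume_restrict_spaceTime] at this
    exact this.mono_ac (Measure.AbsolutelyContinuous.rfl.prod
      Measure.absolutelyContinuous_restrict)
  have key : ∀ N : ℕ, ∀ᵐ t ∂(volume.restrict (Ioo 0 ((N : ℝ) + 1))), ⨅ n, E n t = 0 := by
    intro N
    have hres : (volume.restrict (Ioo 0 ((N : ℝ) + 1)) : Measure ℝ) ≪ volume.restrict (Ioi 0) :=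
      Measure.absolutelyContinuous_of_le (Measure.restrict_mono Ioo_subset_Ioi_self le_rfl)
    have h0 : ∫⁻ t in Ioo 0 ((N : ℝ) + 1), ⨅ n, E n t = 0 := by
      refine le_antisymm (ge_of_tendsto' (hlim (N + 1) (by positivity)) fun n => ?_) zero_le
      exact lintegral_mono fun t => iInf_le _ n
    exact (lintegral_eq_zero_iff' (AEMeasurable.iInf fun n => (hEm n).mono_ac hres)).1 h0
  have key2 : ∀ᵐ t ∂(volume.restrict (Ioi 0)), ⨅ n, E n t = 0 := by
    have hU : Ioi (0 : ℝ) = ⋃ N : ℕ, Ioo 0 ((N : ℝ) + 1) := by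
      ext t
      simp only [mem_Ioi, mem_iUnion, mem_Ioo, exists_and_left]
      refine ⟨fun h => ⟨h, ?_⟩, fun h => h.1⟩
      obtain ⟨N, hN⟩ := exists_nat_gt t
      exact ⟨N, by linarith⟩
    rw [hU, ae_restrict_iUnion_iff]
    exact key
  filter_upwards [key2] with t ht ε hε
  have : ⨅ n, E n t < ENNReal.ofReal ε := by rw [ht]; exact ENNReal.ofReal_pos.2 hε
  obtain ⟨n, hn⟩ := iInf_lt_iff.1 this
  refine ⟨n, ?_⟩
  filter_upwards [ae_le_essSup (μ := volume.restrict (I n)) (f := fun y => ‖f (t, y)‖ₑ)] with y hy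
  have := hy.trans hn.le
  rwa [← ofReal_norm, ENNReal.ofReal_le_ofReal_iff hε.le] at this

/-- `u` tends to `ue` in the essential sense along the curve `h`, from the right if `e = 1` and
from the left if `e = -1`, at almost every time. -/
def HasTrace {E : Type*} [NormedAddCommGroup E] (e : ℝ) (u : ℝ × ℝ → E) (h : ℝ → ℝ)
    (ue : ℝ → E) : Prop :=
  ∀ᵐ t ∂(volume.restrict (Ioi 0)), ∀ ε > 0, ∃ r > 0, ∀ᵐ y ∂(volume.restrict (Ioo 0 r)),
    ‖u (t, h t + e * y) - ue t‖ ≤ ε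

lemma AreStrongTraces.hasTrace {u : ℝ × ℝ → State} {h : ℝ → ℝ} {um up : ℝ → State}
    (hu : AEStronglyMeasurable u (volume.restrict spaceTime)) (hh : Measurable h)
    (H : AreStrongTraces u h um up) : HasTrace 1 u h up ∧ HasTrace (-1) u h um := by
  obtain ⟨hm, hp, hlim⟩ := H
  have hmeas : ∀ w : ℝ → State, MemLp w ∞ (volume.restrict (Ioi 0)) →
      AEStronglyMeasurable (fun z : ℝ × ℝ => u (z.1, h z.1 + z.2) - w z.1)
        (volume.restrict spaceTime) := by
    intro w hw
    have h1 := hu.comp_quasiMeasurePreserving (quasiMeasurePreserving_shear hh one_ne_zero)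
    simp only [one_mul] at h1
    refine h1.sub ?_
    rw [volume_restrict_spaceTime]
    exact hw.1.comp_fst
  constructor
  · have := ae_exists_ae_norm_le (I := fun n => Ioo 0 (1 / ((n : ℝ) + 1)))
      (hmeas up hp) (fun T hT => (hlim T hT).1)
    filter_upwards [this] with t ht ε hε
    obtain ⟨n, hn⟩ := ht ε hε
    exact ⟨1 / ((n : ℝ) + 1), by positivity, by simpa using hn⟩
  · have := ae_exists_ae_norm_le (I := fun n => Ioo (-(1 / ((n : ℝ) + 1))) 0)
      (hmeas um hm) (fun T hT => (hlim T hT).2)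
    filter_upwards [this] with t ht ε hε
    obtain ⟨n, hn⟩ := ht ε hε
    refine ⟨1 / ((n : ℝ) + 1), by positivity, ?_⟩
    rw [ae_restrict_iff' measurableSet_Ioo] at hn ⊢
    have h1 := (Measure.measurePreserving_neg (volume : Measure ℝ)).quasiMeasurePreserving.ae hn
    filter_upwards [h1] with y hy hy'
    have := hy ⟨neg_lt_neg hy'.2, neg_lt_zero.2 hy'.1⟩
    simpa using this

lemma HasTrace.mem_of_isClosed {e : ℝ} (he : e ≠ 0) {u : ℝ × ℝ → State} {h : ℝ → ℝ}
    {ue : ℝ → State} (H : HasTrace e u h ue) (hh : Measurable h) {V : Set State} (hV : IsClosed V)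
    (huV : ∀ᵐ z ∂(volume.restrict spaceTime), u z ∈ V) :
    ∀ᵐ t ∂(volume.restrict (Ioi 0)), ue t ∈ V := by
  have h1 := (quasiMeasurePreserving_shear hh he).ae huV
  rw [volume_restrict_spaceTime] at h1
  filter_upwards [Measure.ae_ae_of_ae_prod h1, H] with t ht1 ht2
  refine hV.closure_subset (Metric.mem_closure_iff.2 fun ε hε => ?_)
  obtain ⟨r, hr, hy⟩ := ht2 (ε / 2) (half_pos hε)
  have hne : (ae (volume.restrict (Ioo 0 r))).NeBot := by
    rw [ae_neBot, Ne, Measure.restrict_eq_zero, Real.volume_Ioo]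
    simpa using hr
  obtain ⟨y, hy1, hy2⟩ := (hy.and (ae_restrict_of_ae ht1)).exists
  refine ⟨_, hy2, ?_⟩
  rw [dist_comm, dist_eq_norm]
  exact hy1.trans_lt (by linarith)

/-- Traces are preserved by continuous functions. -/
lemma HasTrace.comp {E F : Type*} [NormedAddCommGroup E] [NormedAddCommGroup F] {e : ℝ}
    {u : ℝ × ℝ → E} {h : ℝ → ℝ} {ue : ℝ → E} (H : HasTrace e u h ue) {G : E → F}
    (hG : Continuous G) : HasTrace e (fun z => G (u z)) h (fun t => G (ue t)) := by
  filter_upwards [H] with t ht ε hε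
  obtain ⟨δ, hδ, hGδ⟩ := Metric.continuousAt_iff.1 (hG.continuousAt (x := ue t)) ε hε
  obtain ⟨r, hr, hy⟩ := ht (δ / 2) (half_pos hδ)
  refine ⟨r, hr, ?_⟩
  filter_upwards [hy] with y hy
  rw [← dist_eq_norm] at hy ⊢
  exact (hGδ (hy.trans_lt (by linarith))).le

/-- Traces are limits along dilations, for almost every point. -/
lemma HasTrace.ae_tendsto {E : Type*} [NormedAddCommGroup E] {e : ℝ} {u : ℝ × ℝ → E} {h : ℝ → ℝ}
    {ue : ℝ → E} (H : HasTrace e u h ue) :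
    ∀ᵐ t ∂(volume.restrict (Ioi 0)), ∀ᵐ y ∂(volume.restrict (Ioo 0 1)),
      Tendsto (fun n : ℕ => u (t, h t + e * (y / ((n : ℝ) + 1)))) atTop (𝓝 (ue t)) := by
  filter_upwards [H] with t ht
  have h1 : ∀ k : ℕ, ∃ r > 0, ∀ᵐ y, y ∈ Ioo 0 r →
      ‖u (t, h t + e * y) - ue t‖ ≤ 1 / ((k : ℝ) + 1) := fun k => by
    obtain ⟨r, hr, hy⟩ := ht (1 / ((k : ℝ) + 1)) (by positivity)
    exact ⟨r, hr, (ae_restrict_iff' measurableSet_Ioo).1 hy⟩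
  choose r hr hy using h1
  have hq : ∀ n : ℕ, Measure.QuasiMeasurePreserving (fun y : ℝ => y / ((n : ℝ) + 1)) := by
    intro n
    refine ⟨by fun_prop, Measure.AbsolutelyContinuous.mk fun s hs h0 => ?_⟩
    rw [Measure.map_apply (by fun_prop) hs]
    have hn : ((n : ℝ) + 1)⁻¹ ≠ 0 := by positivity
    simp only [div_eq_mul_inv]
    rw [Real.volume_preimage_mul_right hn, h0, mul_zero]
  have h2 : ∀ᵐ y : ℝ, ∀ n k : ℕ, y / ((n : ℝ) + 1) ∈ Ioo 0 (r k) →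
      ‖u (t, h t + e * (y / ((n : ℝ) + 1))) - ue t‖ ≤ 1 / ((k : ℝ) + 1) := by
    rw [ae_all_iff]; intro n
    rw [ae_all_iff]; intro k
    exact (hq n).ae (hy k)
  rw [ae_restrict_iff' measurableSet_Ioo]
  filter_upwards [h2] with y hy2 hy01
  rw [Metric.tendsto_atTop]
  intro ε hε
  obtain ⟨k, hk⟩ := exists_nat_one_div_lt hε
  obtain ⟨N, hN⟩ := exists_nat_one_div_lt (hr k)
  refine ⟨N, fun n hn => ?_⟩
  rw [dist_eq_norm]
  refine (hy2 n k ⟨div_pos hy01.1 (by positivity), ?_⟩).trans_lt hk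
  calc y / ((n : ℝ) + 1) ≤ 1 / ((n : ℝ) + 1) := by gcongr; exact hy01.2.le
    _ ≤ 1 / ((N : ℝ) + 1) := by gcongr
    _ < r k := hN

/-! ### Ramps and the inequality on one side of a curve -/

/-- The piecewise linear function that rises from `0` to `1` on `[0, 1 / N]`. -/
def ramp (N y : ℝ) : ℝ := max 0 (min 1 (N * y))

lemma ramp_nonneg (N y : ℝ) : 0 ≤ ramp N y := le_max_left _ _

lemma ramp_le_one (N y : ℝ) : ramp N y ≤ 1 := max_le zero_le_one (min_le_left _ _)

lemma abs_ramp_le (N y : ℝ) : |ramp N y| ≤ 1 := by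
  rw [abs_of_nonneg (ramp_nonneg N y)]; exact ramp_le_one N y

lemma ramp_of_nonpos {N y : ℝ} (hN : 0 ≤ N) (hy : y ≤ 0) : ramp N y = 0 :=
  max_eq_left ((min_le_right _ _).trans (mul_nonpos_of_nonneg_of_nonpos hN hy))

lemma ramp_of_one_le {N y : ℝ} (hy : 1 ≤ N * y) : ramp N y = 1 := by
  rw [ramp, min_eq_left hy, max_eq_right zero_le_one]

lemma ramp_of_mem {N y : ℝ} (hy : 0 ≤ N * y) (hy' : N * y ≤ 1) : ramp N y = N * y := by
  rw [ramp, min_eq_right hy', max_eq_right hy]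

lemma lipschitzWith_ramp {N : ℝ} (hN : 0 ≤ N) : LipschitzWith N.toNNReal (ramp N) := by
  have h : LipschitzWith N.toNNReal fun y : ℝ => N * y :=
    LipschitzWith.of_dist_le_mul fun x y => by
      rw [Real.coe_toNNReal _ hN, Real.dist_eq, Real.dist_eq, ← mul_sub, abs_mul, abs_of_nonneg hN]
  exact (h.const_min 1).const_max 0

lemma monotone_ramp {N : ℝ} (hN : 0 ≤ N) : Monotone (ramp N) := fun _ _ h =>
  max_le_max le_rfl (min_le_min le_rfl (mul_le_mul_of_nonneg_left h hN))

/-- The derivative of `ramp N` away from its kinks. -/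
lemma hasDerivAt_ramp {N y : ℝ} (hN : 0 < N) (h0 : y ≠ 0) (h1 : y ≠ 1 / N) :
    HasDerivAt (ramp N) ((Ioo 0 (1 / N)).indicator (fun _ => N) y) y := by
  rcases lt_or_gt_of_ne h0 with h | h
  · rw [indicator_of_notMem fun hy => h.not_gt hy.1]
    refine (hasDerivAt_const y (0 : ℝ)).congr_of_eventuallyEq ?_
    filter_upwards [Iio_mem_nhds h] with z hz using ramp_of_nonpos hN.le hz.le
  · rcases lt_or_gt_of_ne h1 with h' | h'
    · rw [indicator_of_mem (show y ∈ Ioo 0 (1 / N) from ⟨h, h'⟩)]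
      have : HasDerivAt (fun z => N * z) N y := by simpa using (hasDerivAt_id y).const_mul N
      refine this.congr_of_eventuallyEq ?_
      filter_upwards [Ioo_mem_nhds h h'] with z hz
      refine ramp_of_mem (mul_nonneg hN.le hz.1.le) ?_
      have := hz.2.le
      rwa [le_div_iff₀ hN, mul_comm] at this
    · rw [indicator_of_notMem fun hy => h'.not_gt hy.2]
      refine (hasDerivAt_const y (1 : ℝ)).congr_of_eventuallyEq ?_
      filter_upwards [Ioi_mem_nhds h'] with z hz
      refine ramp_of_one_le ?_
      have := (mem_Ioi.1 hz).le
      rwa [div_le_iff₀ hN, mul_comm] at this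

lemma lipschitzWith_mul_of_bounded {α : Type*} [PseudoMetricSpace α] {f g : α → ℝ} {K L : ℝ≥0}
    {A B : ℝ≥0} (hf : LipschitzWith K f) (hg : LipschitzWith L g) (hfA : ∀ x, |f x| ≤ A)
    (hgB : ∀ x, |g x| ≤ B) : LipschitzWith (A * L + B * K) fun x => f x * g x := by
  refine LipschitzWith.of_dist_le_mul fun x y => ?_
  have h1 := hf.dist_le_mul x y
  have h2 := hg.dist_le_mul x y
  rw [Real.dist_eq] at h1 h2 ⊢
  have e : f x * g x - f y * g y = f x * (g x - g y) + g y * (f x - f y) := by ring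
  calc |f x * g x - f y * g y| ≤ |f x| * |g x - g y| + |g y| * |f x - f y| := by
        rw [e, ← abs_mul, ← abs_mul]; exact abs_add_le _ _
    _ ≤ A * (L * dist x y) + B * (K * dist x y) := by
        gcongr
        · exact hfA x
        · exact hgB y
    _ = _ := by push_cast; ring

/-- Change of variables in a strip on one side of `c`. -/
lemma integral_strip {e N : ℝ} (he : |e| = 1) (hN : 0 < N) (c : ℝ) (f : ℝ → ℝ) :
    ∫ x, (Ioo 0 (1 / N)).indicator (fun _ => N) (e * (x - c)) * f x
      = ∫ y in Ioo 0 1, f (c + e * (y / N)) := by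
  have he2 : e * e = 1 := by
    rw [← abs_mul_abs_self, he, one_mul]
  have he0 : e ≠ 0 := by rintro rfl; simp at he
  set F : ℝ → ℝ := fun x => (Ioo 0 (1 / N)).indicator (fun _ => N) (e * (x - c)) * f x with hF
  have h1 : ∫ y, F (c + (e / N) * y) = N⁻¹⁻¹ * ∫ x, F x := by
    rw [Measure.integral_comp_mul_left (fun z => F (c + z)) (e / N), integral_add_left_eq_self F c]
    rw [smul_eq_mul, inv_div, abs_div, he, div_one, abs_of_pos hN, inv_inv]
  rw [← integral_indicator measurableSet_Ioo]
  have h2 : ∀ y, F (c + (e / N) * y)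
      = N * (Ioo 0 1).indicator (fun y => f (c + e * (y / N))) y := by
    intro y
    have e1 : e * (c + e / N * y - c) = y / N := by
      rw [add_sub_cancel_left, ← mul_assoc, ← mul_div_assoc, he2, one_div, inv_mul_eq_div]
    have e2 : c + e / N * y = c + e * (y / N) := by ring
    simp only [hF]
    rw [e1, e2]
    by_cases hy : y ∈ Ioo (0 : ℝ) 1
    · rw [indicator_of_mem hy, indicator_of_mem]
      exact ⟨div_pos hy.1 hN, by gcongr; exact hy.2⟩
    · rw [indicator_of_notMem hy, indicator_of_notMem, zero_mul, mul_zero]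
      rintro ⟨h3, h4⟩
      refine hy ⟨?_, ?_⟩
      · have := mul_pos h3 hN; rwa [div_mul_cancel₀ _ hN.ne'] at this
      · rwa [div_lt_div_iff_of_pos_right hN] at h4
  simp only [h2] at h1
  rw [integral_const_mul, inv_inv] at h1
  exact (mul_left_cancel₀ hN.ne' h1).symm

lemma ae_ne_graph {h : ℝ → ℝ} (hh : Measurable h) {e : ℝ} (he : e ≠ 0) (c : ℝ) :
    ∀ᵐ z : ℝ × ℝ, e * (z.2 - h z.1) ≠ c := by
  rw [Measure.volume_eq_prod]
  have hs : MeasurableSet {z : ℝ × ℝ | e * (z.2 - h z.1) = c} :=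
    measurableSet_eq_fun (by fun_prop) measurable_const
  rw [ae_iff]
  simp only [ne_eq, not_not]
  rw [Measure.measure_prod_null hs]
  refine .of_forall fun t => ?_
  have : Prod.mk t ⁻¹' {z : ℝ × ℝ | e * (z.2 - h z.1) = c} ⊆ {h t + c / e} := by
    intro x hx
    rw [mem_singleton_iff]
    have hx' : e * (x - h t) = c := hx
    rw [← hx']; field_simp; ring
  exact measure_mono_null this (measure_singleton _)

/-- A one-sided Gauss–Green formula. The test function is ψ times a ramp of width 1/N in the signed
distance e(x - h(t)). As N grows, the ramp tends to the indicator of the side, while its gradient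
lives on a thin strip; rescaled to unit width, the strip sees the traces and contributes ψ(q - h' g)
along the curve. -/
theorem IsSubPair.trace {g q : ℝ × ℝ → ℝ} (H : IsSubPair g q) {B : ℝ}
    (hg : AEStronglyMeasurable g (volume.restrict spaceTime))
    (hq : AEStronglyMeasurable q (volume.restrict spaceTime))
    (hgB : ∀ᵐ z ∂(volume.restrict spaceTime), |g z| ≤ B)
    (hqB : ∀ᵐ z ∂(volume.restrict spaceTime), |q z| ≤ B)
    {h : ℝ → ℝ} {L : ℝ≥0} (hL : LipschitzWith L h) {e : ℝ} (he : |e| = 1) {ge qe : ℝ → ℝ}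
    (hge : HasTrace e g h ge) (hqe : HasTrace e q h qe)
    {K : ℝ≥0} {ψ : ℝ × ℝ → ℝ} (hψ : IsLipschitzTest K ψ) :
    0 ≤ (∫ z in spaceTime, {z : ℝ × ℝ | 0 < e * (z.2 - h z.1)}.indicator
        (fun z => fderiv ℝ ψ z (1, 0) * g z + fderiv ℝ ψ z (0, 1) * q z) z)
      + e * ∫ t in Ioi 0, ψ (t, h t) * (qe t - deriv h t * ge t) := by
  have he0 : e ≠ 0 := by rintro rfl; simp at he
  have hhm : Measurable h := hL.continuous.measurable
  have hψc : Continuous ψ := hψ.lipschitz.continuous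
  obtain ⟨A, hA⟩ := hψ.compact.exists_bound_of_continuous hψc
  have hA0 : 0 ≤ A := (norm_nonneg _).trans (hA 0)
  set X : ℝ × ℝ → ℝ := fun z => fderiv ℝ ψ z (1, 0) * g z + fderiv ℝ ψ z (0, 1) * q z with hX
  have hXi : IntegrableOn X spaceTime :=
    (integrable_fderiv_smul hψ.lipschitz hψ.compact hg hgB _).add
      (integrable_fderiv_smul hψ.lipschitz hψ.compact hq hqB _)
  set N : ℕ → ℝ := fun n => (n : ℝ) + 1 with hN
  have hN0 : ∀ n, 0 < N n := fun n => by simp only [hN]; positivity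
  set y : ℝ × ℝ → ℝ := fun z => e * (z.2 - h z.1) with hy
  have hyc : Continuous y := continuous_const.mul
    (continuous_snd.sub (hL.continuous.comp continuous_fst))
  have hyl : LipschitzWith (1 + L) y := by
    refine LipschitzWith.of_dist_le_mul fun z z' => ?_
    have h1 := hL.dist_le_mul z.1 z'.1
    have h2 : |z.2 - z'.2| ≤ dist z z' := by
      rw [Prod.dist_eq, ← Real.dist_eq]; exact le_max_right _ _
    have h3 : dist z.1 z'.1 ≤ dist z z' := by rw [Prod.dist_eq]; exact le_max_left _ _
    rw [Real.dist_eq] at h1 ⊢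
    have e1 : y z - y z' = e * ((z.2 - z'.2) - (h z.1 - h z'.1)) := by simp only [hy]; ring
    rw [e1, abs_mul, he, one_mul]
    calc _ ≤ |z.2 - z'.2| + |h z.1 - h z'.1| := abs_sub _ _
      _ ≤ dist z z' + L * dist z z' := add_le_add h2 (h1.trans (by gcongr))
      _ = _ := by push_cast; ring
  set c : ℕ → ℝ × ℝ → ℝ := fun n z => (Ioo 0 (1 / N n)).indicator (fun _ => N n) (y z) with hc
  have hcm : ∀ n, Measurable (c n) := fun n =>
    (measurable_const.indicator measurableSet_Ioo).comp hyc.measurable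
  set f : ℝ × ℝ → ℝ := fun z => ψ z * (e * (q z - deriv h z.1 * g z)) with hf
  have hfm : AEStronglyMeasurable f (volume.restrict spaceTime) := by
    refine hψc.aestronglyMeasurable.mul (aestronglyMeasurable_const.mul (hq.sub (.mul ?_ hg)))
    exact ((measurable_deriv h).comp measurable_fst).aestronglyMeasurable
  obtain ⟨T, hT⟩ := hψ.compact.isCompact.isBounded.subset_closedBall 0
  have hTz : ∀ z : ℝ × ℝ, T < z.1 → ψ z = 0 := by
    intro z hz
    by_contra hne
    have h1 := hT (subset_tsupport _ hne)
    rw [mem_closedBall_zero_iff] at h1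
    have h2 : |z.1| ≤ T := (norm_fst_le z).trans h1
    linarith [le_abs_self z.1]
  -- This dominates the strip terms at all scales; the support of ψ limits it to bounded times.
  set b : ℝ → ℝ := fun t => (Iic T).indicator (fun _ => A * (B + L * B)) t with hb
  have hfb : ∀ᵐ z ∂(volume.restrict spaceTime), |f z| ≤ b z.1 := by
    filter_upwards [hgB, hqB] with z h1 h2
    have hB : 0 ≤ B := (abs_nonneg _).trans h1
    by_cases hz : z.1 ≤ T
    · simp only [hb]
      rw [indicator_of_mem (show z.1 ∈ Iic T from hz)]
      simp only [hf]
      rw [abs_mul, abs_mul, he, one_mul]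
      have h3 : |deriv h z.1| ≤ L := norm_deriv_le_of_lipschitz hL
      have h4 : |q z - deriv h z.1 * g z| ≤ B + L * B := by
        refine (abs_sub _ _).trans (add_le_add h2 ?_)
        rw [abs_mul]
        gcongr
      gcongr
      exact hA z
    · simp [hf, hTz z (not_le.1 hz), hb, hz]
  have hfi : IntegrableOn f spaceTime := by
    refine (hψc.integrable_of_hasCompactSupport hψ.compact).restrict.mul_bdd (c := B + L * B) ?_ ?_
    · exact aestronglyMeasurable_const.mul
        (hq.sub (((measurable_deriv h).comp measurable_fst).aestronglyMeasurable.mul hg))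
    · filter_upwards [hgB, hqB] with z h1 h2
      have h3 : |deriv h z.1| ≤ L := norm_deriv_le_of_lipschitz hL
      rw [Real.norm_eq_abs, abs_mul, he, one_mul]
      refine (abs_sub _ _).trans (add_le_add h2 ?_)
      rw [abs_mul]
      gcongr
  have hcb : ∀ n z, ‖c n z‖ ≤ N n := fun n z => by
    simp only [hc]
    refine (norm_indicator_le_norm_self _ _).trans ?_
    rw [Real.norm_of_nonneg (hN0 n).le]
  have hcf : ∀ n, IntegrableOn (fun z => c n z * f z) spaceTime := fun n =>
    hfi.bdd_mul (hcm n).aestronglyMeasurable (.of_forall (hcb n))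
  have hrc : ∀ n, Continuous fun z => ramp (N n) (y z) := fun n =>
    (lipschitzWith_ramp (hN0 n).le).continuous.comp hyc
  have hrX : ∀ n, IntegrableOn (fun z => ramp (N n) (y z) * X z) spaceTime := fun n =>
    hXi.bdd_mul (c := 1) (hrc n).aestronglyMeasurable (.of_forall fun z => abs_ramp_le _ _)
  have hpos : ∀ n, 0 ≤ (∫ z in spaceTime, ramp (N n) (y z) * X z)
      + ∫ z in spaceTime, c n z * f z := by
    intro n
    have htest : IsLipschitzTest (A.toNNReal * (((N n).toNNReal) * (1 + L)) + 1 * K)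
        fun z => ψ z * ramp (N n) (y z) := by
      refine ⟨lipschitzWith_mul_of_bounded hψ.lipschitz
        ((lipschitzWith_ramp (hN0 n).le).comp hyl) (fun z => ?_) fun z => ?_,
        hψ.compact.mul_right, (tsupport_mul_subset_left).trans hψ.subset,
        fun z => mul_nonneg (hψ.nonneg z) (ramp_nonneg _ _)⟩
      · rw [Real.coe_toNNReal _ hA0]; exact hA z
      · exact abs_ramp_le _ _
    have h1 := H.lipschitz hg hq hgB hqB htest
    rw [← integral_add (hrX n) (hcf n)]
    refine h1.trans_eq (integral_congr_ae ?_)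
    refine ae_restrict_of_ae ?_
    have hd2 : ∀ᵐ z : ℝ × ℝ, DifferentiableAt ℝ h z.1 := by
      rw [Measure.volume_eq_prod]
      exact Measure.quasiMeasurePreserving_fst.ae hL.ae_differentiableAt
    -- The kinks of the ramp lie on two translated graphs of h, which are null sets.
    filter_upwards [hψ.lipschitz.ae_differentiableAt, hd2, ae_ne_graph hhm he0 0,
      ae_ne_graph hhm he0 (1 / N n)] with z h2 h3 h4 h5
    have d1 : HasFDerivAt (fun z : ℝ × ℝ => h z.1)
        (deriv h z.1 • ContinuousLinearMap.fst ℝ ℝ ℝ) z :=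
      h3.hasDerivAt.comp_hasFDerivAt z hasFDerivAt_fst
    have d2 : HasFDerivAt y (e • (ContinuousLinearMap.snd ℝ ℝ ℝ
        - deriv h z.1 • ContinuousLinearMap.fst ℝ ℝ ℝ)) z :=
      (hasFDerivAt_snd.sub d1).const_mul e
    have d3 := h2.hasFDerivAt.mul ((hasDerivAt_ramp (hN0 n) h4 h5).comp_hasFDerivAt z d2)
    have d4 := d3.fderiv
    simp only [Function.comp_def] at d4
    have e1 : (fun z => ψ z * ramp (N n) (y z)) = (ψ * fun x => ramp (N n) (y x)) := rfl
    rw [e1, d4]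
    simp [hX, hf, hc, hy]
    ring
  have hlim1 : Tendsto (fun n => ∫ z in spaceTime, ramp (N n) (y z) * X z) atTop
      (𝓝 (∫ z in spaceTime, {z : ℝ × ℝ | 0 < e * (z.2 - h z.1)}.indicator X z)) := by
    refine tendsto_integral_of_dominated_convergence (fun z => ‖X z‖) (fun n => (hrX n).1)
      hXi.norm (fun n => .of_forall fun z => ?_) (.of_forall fun z => ?_)
    · rw [norm_mul]
      exact mul_le_of_le_one_left (norm_nonneg _) (abs_ramp_le _ _)
    · by_cases hz : 0 < y z
      · rw [indicator_of_mem (show z ∈ {z : ℝ × ℝ | 0 < e * (z.2 - h z.1)} from hz)]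
        refine tendsto_const_nhds.congr' ?_
        obtain ⟨n0, hn0⟩ := exists_nat_gt (1 / y z)
        filter_upwards [eventually_ge_atTop n0] with n hn
        rw [ramp_of_one_le, one_mul]
        have h1 : (n0 : ℝ) ≤ n := by exact_mod_cast hn
        have h2 : 1 < n0 * y z := by rwa [div_lt_iff₀ hz] at hn0
        simp only [hN]
        nlinarith
      · rw [indicator_of_notMem (show z ∉ {z : ℝ × ℝ | 0 < e * (z.2 - h z.1)} from hz)]
        simp only [ramp_of_nonpos (hN0 _).le (not_lt.1 hz), zero_mul]
        exact tendsto_const_nhds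
  have hstrip : ∀ n, (∫ z in spaceTime, c n z * f z)
      = ∫ t in Ioi 0, ∫ x in Ioo 0 1, f (t, h t + e * (x / N n)) := by
    intro n
    have h1 := hcf n
    rw [IntegrableOn, volume_restrict_spaceTime] at h1
    rw [volume_restrict_spaceTime, integral_prod _ h1]
    refine integral_congr_ae (.of_forall fun t => ?_)
    exact integral_strip he (hN0 n) (h t) fun x => f (t, x)
  have hslice : ∀ᵐ t ∂(volume.restrict (Ioi 0)), ∀ n, ∀ᵐ x ∂(volume.restrict (Ioo 0 1)),
      |f (t, h t + e * (x / N n))| ≤ b t := by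
    rw [ae_all_iff]
    intro n
    have h1 := (quasiMeasurePreserving_shear hhm (e := e / N n)
      (div_ne_zero he0 (hN0 n).ne')).ae hfb
    rw [volume_restrict_spaceTime] at h1
    filter_upwards [Measure.ae_ae_of_ae_prod h1] with t ht
    refine ae_restrict_of_ae ?_
    filter_upwards [ht] with x hx
    rwa [div_mul_eq_mul_div, ← mul_div_assoc'] at hx
  have hsm : ∀ᵐ t ∂(volume.restrict (Ioi 0)), ∀ n,
      AEStronglyMeasurable (fun x => f (t, h t + e * (x / N n))) (volume.restrict (Ioo 0 1)) := by
    rw [ae_all_iff]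
    intro n
    have h1 := hfm.comp_quasiMeasurePreserving (quasiMeasurePreserving_shear hhm (e := e / N n)
      (div_ne_zero he0 (hN0 n).ne'))
    rw [volume_restrict_spaceTime] at h1
    filter_upwards [h1.prodMk_left] with t ht
    refine AEStronglyMeasurable.restrict (ht.congr (.of_forall fun x => ?_))
    simp only [Function.comp_def]
    rw [div_mul_eq_mul_div, ← mul_div_assoc']
  have hlim2 : Tendsto (fun n => ∫ z in spaceTime, c n z * f z) atTop
      (𝓝 (∫ t in Ioi 0, ψ (t, h t) * (e * (qe t - deriv h t * ge t)))) := by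
    simp only [hstrip]
    refine tendsto_integral_of_dominated_convergence b ?_ ?_ ?_ ?_
    · intro n
      have h1 := hcf n
      rw [IntegrableOn, volume_restrict_spaceTime] at h1
      refine h1.integral_prod_left.1.congr (.of_forall fun t => ?_)
      exact integral_strip he (hN0 n) (h t) fun x => f (t, x)
    · have h1 : IntegrableOn (fun _ : ℝ => A * (B + L * B)) (Iic T ∩ Ioi 0) := by
        refine integrableOn_const (ne_of_lt ?_)
        rw [inter_comm, Ioi_inter_Iic]; exact measure_Ioc_lt_top
      rw [← integrableOn_indicator_iff measurableSet_Iic] at h1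
      exact h1
    · intro n
      filter_upwards [hslice] with t ht
      have h1 := norm_setIntegral_le_of_norm_le_const_ae' (μ := volume) (s := Ioo (0 : ℝ) 1)
        (f := fun x => f (t, h t + e * (x / N n))) (C := b t) (by simp)
        ((ae_restrict_iff' measurableSet_Ioo).1 (ht n))
      simpa using h1
    · filter_upwards [hslice, hsm, hge.ae_tendsto, hqe.ae_tendsto] with t ht1 ht2 ht3 ht4
      have h1 : Tendsto (fun n => ∫ x in Ioo 0 1, f (t, h t + e * (x / N n))) atTop
          (𝓝 (∫ x in Ioo (0 : ℝ) 1, ψ (t, h t) * (e * (qe t - deriv h t * ge t)))) := by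
        refine tendsto_integral_of_dominated_convergence (fun _ => b t) ht2
          (integrable_const _) ht1 ?_
        filter_upwards [ht3, ht4] with x hx3 hx4
        have h2 : Tendsto (fun n => (t, h t + e * (x / N n))) atTop (𝓝 (t, h t)) := by
          refine tendsto_const_nhds.prodMk_nhds ?_
          have h3 : Tendsto (fun n => x / N n) atTop (𝓝 0) := by
            have := (tendsto_one_div_add_atTop_nhds_zero_nat (𝕜 := ℝ)).const_mul x
            simpa [hN, div_eq_mul_inv] using this
          simpa using (h3.const_mul e).const_add (h t)
        exact ((hψc.tendsto _).comp h2).mul ((hx4.sub (hx3.const_mul _)).const_mul e)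
      simpa using h1
  have h3 := ge_of_tendsto' (hlim1.add hlim2) hpos
  have h4 : ∫ t in Ioi 0, ψ (t, h t) * (e * (qe t - deriv h t * ge t))
      = e * ∫ t in Ioi 0, ψ (t, h t) * (qe t - deriv h t * ge t) := by
    rw [← integral_const_mul]
    congr 1; ext t; ring
  rwa [h4] at h3

/-! ### Relative entropy inequalities and jump conditions of solutions -/

lemma IsTestFunction.exists_lipschitzWith {ψ : ℝ × ℝ → ℝ} (hψ : IsTestFunction ψ) :
    ∃ K, LipschitzWith K ψ :=
  hψ.1.lipschitzWith_of_hasCompactSupport hψ.2.1 (by simp)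

lemma IsTestFunction.integral_fderiv_eq_zero {ψ : ℝ × ℝ → ℝ} (hψ : IsTestFunction ψ)
    (e : ℝ × ℝ) : ∫ z in spaceTime, fderiv ℝ ψ z e = 0 := by
  obtain ⟨K, hK⟩ := hψ.exists_lipschitzWith
  rw [setIntegral_eq_integral_of_forall_compl_eq_zero fun z hz => by
    simp [fderiv_eq_zero_of_notMem_tsupport fun h => hz (hψ.2.2 h)]]
  have hi : Integrable (fun z => fderiv ℝ ψ z e) := by
    have := integrable_fderiv_smul hK hψ.2.1 (g := fun _ => (1 : ℝ)) (B := 1) (S := univ)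
      aestronglyMeasurable_const (.of_forall fun _ => by simp) e
    simpa [IntegrableOn] using this
  have := integral_bilinear_hasLineDerivAt_right_eq_neg_left_of_integrable (μ := volume)
    (f := fun _ : ℝ × ℝ => (1 : ℝ)) (f' := fun _ => (0 : ℝ)) (g := ψ)
    (g' := fun z => fderiv ℝ ψ z e) (v := e) (B := ContinuousLinearMap.mul ℝ ℝ)
    (by simp) (by simpa using hi)
    (by simpa using hψ.1.continuous.integrable_of_hasCompactSupport hψ.2.1)
    (fun x _ => by simpa using (hasFDerivAt_const (1 : ℝ) x).hasLineDerivAt e)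
    (fun x _ => ((hψ.1.differentiable (by simp)).differentiableAt.hasFDerivAt).hasLineDerivAt e)
  simpa using this

lemma continuous_flux (m : ℝ) : Continuous (flux m) := by
  unfold flux stress
  refine (PiLp.continuous_toLp 2 _).comp (continuous_pi fun i => ?_)
  fin_cases i <;> simp <;> fun_prop

lemma continuous_entropy (m : ℝ) : Continuous (entropy m) := by
  unfold entropy; fun_prop

lemma continuous_entropyFlux (m : ℝ) : Continuous (entropyFlux m) := by
  unfold entropyFlux stress; fun_prop

lemma exists_bound_comp {F : Type*} [NormedAddCommGroup F] {V : Set State} (hV : IsCompact V)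
    {G : State → F} (hG : Continuous G) : ∃ B, ∀ v ∈ V, ‖G v‖ ≤ B :=
  hV.exists_bound_of_continuousOn hG.continuousOn

section Solutions

variable {m : ℝ} {V : Set State} {u : ℝ × ℝ → State}

lemma IsSWeak.integrable_comp (H : IsSWeak m V u) (hV : IsCompact V) {F : Type*}
    [NormedAddCommGroup F] [NormedSpace ℝ F] {G : State → F} (hG : Continuous G) {ψ : ℝ × ℝ → ℝ}
    (hψ : IsTestFunction ψ) (e : ℝ × ℝ) :
    IntegrableOn (fun z => fderiv ℝ ψ z e • G (u z)) spaceTime := by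
  obtain ⟨K, hK⟩ := hψ.exists_lipschitzWith
  obtain ⟨B, hB⟩ := exists_bound_comp hV hG
  refine integrable_fderiv_smul hK hψ.2.1 (hG.comp_aestronglyMeasurable H.aestronglyMeasurable)
    (B := B) ?_ e
  filter_upwards [H.mem_stateSpace] with z hz using hB _ hz

lemma IsSWeak.integral_linear (H : IsSWeak m V u) (hV : IsCompact V) (ℓ : State →L[ℝ] ℝ)
    {ψ : ℝ × ℝ → ℝ} (hψ : IsTestFunction ψ) :
    ∫ z in spaceTime, (fderiv ℝ ψ z (1, 0) * ℓ (u z) + fderiv ℝ ψ z (0, 1) * ℓ (flux m (u z)))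
      = 0 := by
  have h1 := ℓ.integral_comp_comm ((H.integrable_comp hV continuous_id hψ (1, 0)).add
    (H.integrable_comp hV (continuous_flux m) hψ (0, 1)))
  have h2 := H.weakSolution ψ hψ
  simp only [Pi.add_apply, id_eq, map_add, map_smul, smul_eq_mul] at h1
  rw [h1, h2, map_zero]

lemma IsSWeak.isSubPair_linear (H : IsSWeak m V u) (hV : IsCompact V) (ℓ : State →L[ℝ] ℝ) :
    IsSubPair (fun z => ℓ (u z)) (fun z => ℓ (flux m (u z))) := fun _ hψ _ =>
  (H.integral_linear hV ℓ hψ).ge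

/-- The relative entropy differs from η by an affine function of u, and the fluxes correspond. The
linear part is conserved by the weak equation, and constants integrate to zero against derivatives
of test functions. -/
lemma IsSWeak.isSubPair_relEntropy (H : IsSWeak m V u) (hV : IsCompact V) (b : State) :
    IsSubPair (fun z => relEntropy m (u z) b) (fun z => relEntropyFlux m (u z) b) := by
  intro ψ hψ h0
  set ℓ := fderiv ℝ (entropy m) b with hℓ
  have h1 := H.entropic ψ hψ h0
  have h2 := H.integral_linear hV ℓ hψ
  have i1 := (H.integrable_comp hV (continuous_entropy m) hψ (1, 0)).add
    (H.integrable_comp hV (continuous_entropyFlux m) hψ (0, 1))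
  have i2 := (H.integrable_comp hV ℓ.continuous hψ (1, 0)).add
    (H.integrable_comp hV (ℓ.continuous.comp (continuous_flux m)) hψ (0, 1))
  have i3 : ∀ c : ℝ, ∀ e, IntegrableOn (fun z => fderiv ℝ ψ z e * c) spaceTime := fun c e =>
    H.integrable_comp hV (continuous_const (y := c)) hψ e
  have e1 : ∀ z, fderiv ℝ ψ z (1, 0) * relEntropy m (u z) b
      + fderiv ℝ ψ z (0, 1) * relEntropyFlux m (u z) b
      = ((fderiv ℝ ψ z (1, 0) * entropy m (u z) + fderiv ℝ ψ z (0, 1) * entropyFlux m (u z))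
        - (fderiv ℝ ψ z (1, 0) * ℓ (u z) + fderiv ℝ ψ z (0, 1) * ℓ (flux m (u z))))
        + (fderiv ℝ ψ z (1, 0) * (ℓ b - entropy m b)
          + fderiv ℝ ψ z (0, 1) * (ℓ (flux m b) - entropyFlux m b)) := by
    intro z
    simp only [relEntropy, relEntropyFlux, map_sub, ← hℓ]
    ring
  simp only [e1]
  have e2 := integral_add (i1.sub i2) ((i3 (ℓ b - entropy m b) (1, 0)).add
    (i3 (ℓ (flux m b) - entropyFlux m b) (0, 1)))
  have e3 := integral_sub i1 i2
  have e4 := integral_add (i3 (ℓ b - entropy m b) (1, 0))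
    (i3 (ℓ (flux m b) - entropyFlux m b) (0, 1))
  simp only [integral_mul_const, hψ.integral_fderiv_eq_zero, zero_mul, add_zero] at e4
  simp only [Pi.add_apply, Pi.sub_apply, smul_eq_mul, Function.comp_def] at e2 e3
  rw [e2, e3, h2, e4]
  linarith

/-- A cutoff that equals `1` for `|x| ≤ R - Λ t` and `0` for `|x| ≥ R + 1 - Λ t`. -/
def coneCutoff (Λ R : ℝ) (z : ℝ × ℝ) : ℝ := 1 - ramp 1 (|z.2| + Λ * z.1 - R)

lemma coneCutoff_nonneg (Λ R : ℝ) (z : ℝ × ℝ) : 0 ≤ coneCutoff Λ R z :=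
  sub_nonneg.2 (ramp_le_one _ _)

lemma coneCutoff_le_one (Λ R : ℝ) (z : ℝ × ℝ) : coneCutoff Λ R z ≤ 1 :=
  sub_le_self _ (ramp_nonneg _ _)

lemma abs_coneCutoff_le (Λ R : ℝ) (z : ℝ × ℝ) : |coneCutoff Λ R z| ≤ 1 := by
  rw [abs_of_nonneg (coneCutoff_nonneg Λ R z)]; exact coneCutoff_le_one Λ R z

lemma coneCutoff_eq_one {Λ R : ℝ} {z : ℝ × ℝ} (h : |z.2| + Λ * z.1 ≤ R) :
    coneCutoff Λ R z = 1 := by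
  rw [coneCutoff, ramp_of_nonpos zero_le_one (by linarith), sub_zero]

lemma coneCutoff_eq_zero {Λ R : ℝ} {z : ℝ × ℝ} (h : R + 1 ≤ |z.2| + Λ * z.1) :
    coneCutoff Λ R z = 0 := by
  rw [coneCutoff, ramp_of_one_le (by linarith), sub_self]

lemma lipschitzWith_coneCutoff {Λ : ℝ} (hΛ : 0 ≤ Λ) (R : ℝ) :
    LipschitzWith (1 + Λ.toNNReal) (coneCutoff Λ R) := by
  refine LipschitzWith.of_dist_le_mul fun z z' => ?_
  have h1 := (lipschitzWith_ramp (zero_le_one (α := ℝ))).dist_le_mul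
    (|z.2| + Λ * z.1 - R) (|z'.2| + Λ * z'.1 - R)
  have h2 : |z.2 - z'.2| ≤ dist z z' := by
    rw [Prod.dist_eq, ← Real.dist_eq]; exact le_max_right _ _
  have h3 : |z.1 - z'.1| ≤ dist z z' := by
    rw [Prod.dist_eq, ← Real.dist_eq]; exact le_max_left _ _
  have h4 : |(|z.2| - |z'.2|)| ≤ |z.2 - z'.2| := abs_abs_sub_abs_le_abs_sub _ _
  rw [Real.dist_eq, Real.dist_eq, Real.toNNReal_one, NNReal.coe_one, one_mul] at h1
  rw [Real.dist_eq, coneCutoff, coneCutoff, sub_sub_sub_cancel_left, abs_sub_comm]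
  refine h1.trans ?_
  have e : |z.2| + Λ * z.1 - R - (|z'.2| + Λ * z'.1 - R)
      = (|z.2| - |z'.2|) + Λ * (z.1 - z'.1) := by ring
  rw [e]
  push_cast
  rw [Real.coe_toNNReal _ hΛ]
  calc _ ≤ |(|z.2| - |z'.2|)| + |Λ * (z.1 - z'.1)| := abs_add_le _ _
    _ ≤ dist z z' + Λ * dist z z' := by
      rw [abs_mul, abs_of_nonneg hΛ]
      gcongr
      exact h4.trans h2
    _ = _ := by ring

lemma exists_isLipschitzTest_cone {α : ℝ → ℝ} {K : ℝ≥0} (hα : LipschitzWith K α)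
    (hαc : HasCompactSupport α) (hα0 : tsupport α ⊆ Ioi 0) (hαn : ∀ t, 0 ≤ α t) {Λ : ℝ}
    (hΛ : 0 ≤ Λ) (R : ℝ) :
    ∃ K', IsLipschitzTest K' fun z => α z.1 * coneCutoff Λ R z := by
  obtain ⟨A, hA⟩ := hαc.exists_bound_of_continuous hα.continuous
  have hA0 : 0 ≤ A := (norm_nonneg _).trans (hA 0)
  have hsub : tsupport (fun z : ℝ × ℝ => α z.1 * coneCutoff Λ R z)
      ⊆ tsupport α ×ˢ Metric.closedBall 0 (|R| + 1) := by
    refine closure_minimal ?_ ((isClosed_tsupport _).prod Metric.isClosed_closedBall)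
    intro z hz
    have h1 : α z.1 ≠ 0 := left_ne_zero_of_mul hz
    have h2 : coneCutoff Λ R z ≠ 0 := right_ne_zero_of_mul hz
    have h3 : 0 < z.1 := hα0 (subset_tsupport _ h1)
    refine ⟨subset_tsupport _ h1, ?_⟩
    rw [mem_closedBall_zero_iff]
    by_contra! h4
    refine h2 (coneCutoff_eq_zero ?_)
    have := mul_nonneg hΛ h3.le
    have := le_abs_self R
    rw [Real.norm_eq_abs] at h4
    linarith
  refine ⟨_, lipschitzWith_mul_of_bounded (A := A.toNNReal) (B := 1)
    (hα.comp LipschitzWith.prod_fst) (lipschitzWith_coneCutoff hΛ R) (fun z => ?_)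
    (fun z => abs_coneCutoff_le _ _ _), ?_, ?_,
    fun z => mul_nonneg (hαn _) (coneCutoff_nonneg _ _ _)⟩
  · rw [Real.coe_toNNReal _ hA0]; exact hA _
  · exact (hαc.isCompact.prod (isCompact_closedBall _ _)).of_isClosed_subset
      (isClosed_tsupport _) hsub
  · exact hsub.trans (prod_mono hα0 (subset_univ _))

lemma integrable_test_along_curve {K : ℝ≥0} {ψ : ℝ × ℝ → ℝ} (hψ : IsLipschitzTest K ψ) {h : ℝ → ℝ}
    (hh : Continuous h) {w : ℝ → ℝ} {B : ℝ} {S : Set ℝ}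
    (hw : AEStronglyMeasurable w (volume.restrict S))
    (hwB : ∀ᵐ t ∂(volume.restrict S), |w t| ≤ B) :
    IntegrableOn (fun t => ψ (t, h t) * w t) S := by
  have hc : Continuous fun t => ψ (t, h t) :=
    hψ.lipschitz.continuous.comp (continuous_id.prodMk hh)
  have hcs : HasCompactSupport fun t => ψ (t, h t) := by
    refine HasCompactSupport.intro (hψ.compact.isCompact.image continuous_fst) fun t ht => ?_
    by_contra hne
    exact ht ⟨(t, h t), subset_tsupport _ hne, rfl⟩
  exact (hc.integrable_of_hasCompactSupport hcs).restrict.mul_bdd (c := B) hw hwB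

lemma integral_indicator_sides {h : ℝ → ℝ} (hh : Measurable h) {X : ℝ × ℝ → ℝ}
    (hX : IntegrableOn X spaceTime) :
    (∫ z in spaceTime, {z : ℝ × ℝ | 0 < 1 * (z.2 - h z.1)}.indicator X z)
      + ∫ z in spaceTime, {z : ℝ × ℝ | 0 < -1 * (z.2 - h z.1)}.indicator X z
      = ∫ z in spaceTime, X z := by
  have hm : ∀ e : ℝ, MeasurableSet {z : ℝ × ℝ | 0 < e * (z.2 - h z.1)} := fun e =>
    measurableSet_lt measurable_const (by fun_prop)
  rw [← integral_add (hX.indicator (hm 1)) (hX.indicator (hm (-1)))]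
  refine integral_congr_ae (ae_restrict_of_ae ?_)
  filter_upwards [ae_ne_graph hh one_ne_zero 0] with z hz
  rcases lt_or_gt_of_ne hz with h1 | h1
  · rw [indicator_of_notMem (show z ∉ {z : ℝ × ℝ | 0 < 1 * (z.2 - h z.1)} from h1.not_gt),
      indicator_of_mem (show z ∈ {z : ℝ × ℝ | 0 < -1 * (z.2 - h z.1)} by
        rw [mem_ofPred_eq]; linarith), zero_add]
  · rw [indicator_of_mem (show z ∈ {z : ℝ × ℝ | 0 < 1 * (z.2 - h z.1)} from h1),
      indicator_of_notMem (show z ∉ {z : ℝ × ℝ | 0 < -1 * (z.2 - h z.1)} by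
        rw [mem_ofPred_eq]; linarith), add_zero]

/-- Adding the inequalities on the two sides reassembles the bulk integral, which the opposite pair
makes nonpositive. Only the jump term along the curve remains. -/
lemma IsSubPair.integral_jump_nonneg {g q : ℝ × ℝ → ℝ} (H : IsSubPair g q)
    (H' : IsSubPair (fun z => -g z) fun z => -q z) {B : ℝ}
    (hg : AEStronglyMeasurable g (volume.restrict spaceTime))
    (hq : AEStronglyMeasurable q (volume.restrict spaceTime))
    (hgB : ∀ᵐ z ∂(volume.restrict spaceTime), |g z| ≤ B)
    (hqB : ∀ᵐ z ∂(volume.restrict spaceTime), |q z| ≤ B)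
    {h : ℝ → ℝ} {L : ℝ≥0} (hL : LipschitzWith L h) {gm gp qm qp : ℝ → ℝ}
    (hgm : HasTrace (-1) g h gm) (hgp : HasTrace 1 g h gp)
    (hqm : HasTrace (-1) q h qm) (hqp : HasTrace 1 q h qp) {K : ℝ≥0}
    {ψ : ℝ × ℝ → ℝ} (hψ : IsLipschitzTest K ψ)
    (hm : IntegrableOn (fun t => ψ (t, h t) * (qm t - deriv h t * gm t)) (Ioi 0))
    (hp : IntegrableOn (fun t => ψ (t, h t) * (qp t - deriv h t * gp t)) (Ioi 0)) :
    0 ≤ ∫ t in Ioi 0, ψ (t, h t) * (qp t - qm t - deriv h t * (gp t - gm t)) := by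
  set X : ℝ × ℝ → ℝ := fun z => fderiv ℝ ψ z (1, 0) * g z + fderiv ℝ ψ z (0, 1) * q z with hX
  have hXi : IntegrableOn X spaceTime :=
    (integrable_fderiv_smul hψ.lipschitz hψ.compact hg hgB _).add
      (integrable_fderiv_smul hψ.lipschitz hψ.compact hq hqB _)
  have hX0 : ∫ z in spaceTime, X z ≤ 0 := by
    have h1 := H'.lipschitz (B := B) hg.neg hq.neg (by simpa using hgB) (by simpa using hqB) hψ
    have e : ∀ z, fderiv ℝ ψ z (1, 0) * -g z + fderiv ℝ ψ z (0, 1) * -q z = -X z := fun z => by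
      simp only [hX]; ring
    simp only [e, integral_neg] at h1
    linarith
  have hr := H.trace hg hq hgB hqB hL (e := 1) (by simp) hgp hqp hψ
  have hl := H.trace hg hq hgB hqB hL (e := -1) (by simp) hgm hqm hψ
  have hs := integral_indicator_sides hL.continuous.measurable hXi
  have e : ∀ t, ψ (t, h t) * (qp t - qm t - deriv h t * (gp t - gm t))
      = ψ (t, h t) * (qp t - deriv h t * gp t) - ψ (t, h t) * (qm t - deriv h t * gm t) :=
    fun t => by ring
  simp only [e]
  rw [integral_sub hp hm]
  linarith

lemma HasTrace.abs_flux_le {e : ℝ} (he : e ≠ 0) {h : ℝ → ℝ} {L : ℝ≥0} (hL : LipschitzWith L h)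
    {ue : ℝ → State} (hue : HasTrace e u h ue) (hV : IsClosed V)
    (huV : ∀ᵐ z ∂(volume.restrict spaceTime), u z ∈ V) {G Q : State → ℝ} {B : ℝ}
    (hG : ∀ v ∈ V, |G v| ≤ B) (hQ : ∀ v ∈ V, |Q v| ≤ B) :
    ∀ᵐ t ∂(volume.restrict (Ioi 0)), |Q (ue t) - deriv h t * G (ue t)| ≤ B + L * B := by
  filter_upwards [hue.mem_of_isClosed he hL.continuous.measurable hV huV] with t ht
  refine (abs_sub _ _).trans (add_le_add (hQ _ ht) ?_)
  rw [abs_mul]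
  gcongr
  · exact norm_deriv_le_of_lipschitz hL
  · exact hG _ ht

lemma HasTrace.integrable_flux {e : ℝ} (he : e ≠ 0) {h : ℝ → ℝ} {L : ℝ≥0}
    (hL : LipschitzWith L h) {ue : ℝ → State} (hue : HasTrace e u h ue) (hV : IsClosed V)
    (huV : ∀ᵐ z ∂(volume.restrict spaceTime), u z ∈ V)
    (hm : AEStronglyMeasurable ue (volume.restrict (Ioi 0))) {G Q : State → ℝ} {B : ℝ}
    (hG : ∀ v ∈ V, |G v| ≤ B) (hQ : ∀ v ∈ V, |Q v| ≤ B) (hGc : Continuous G) (hQc : Continuous Q)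
    {K : ℝ≥0} {ψ : ℝ × ℝ → ℝ} (hψ : IsLipschitzTest K ψ) :
    IntegrableOn (fun t => ψ (t, h t) * (Q (ue t) - deriv h t * G (ue t))) (Ioi 0) :=
  integrable_test_along_curve hψ hL.continuous
    ((hQc.comp_aestronglyMeasurable hm).sub ((measurable_deriv h).aestronglyMeasurable.mul
      (hGc.comp_aestronglyMeasurable hm))) (hue.abs_flux_le he hL hV huV hG hQ)

lemma IsSWeak.integral_jump_nonneg (H : IsSWeak m V u) (hV : IsCompact V) {h : ℝ → ℝ} {L : ℝ≥0}
    (hL : LipschitzWith L h) {um up : ℝ → State}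
    (hum : HasTrace (-1) u h um) (hup : HasTrace 1 u h up)
    (humm : AEStronglyMeasurable um (volume.restrict (Ioi 0)))
    (hupm : AEStronglyMeasurable up (volume.restrict (Ioi 0))) (ℓ : State →L[ℝ] ℝ) {K : ℝ≥0}
    {ψ : ℝ × ℝ → ℝ} (hψ : IsLipschitzTest K ψ) :
    0 ≤ ∫ t in Ioi 0, ψ (t, h t) *
      (ℓ (flux m (up t)) - ℓ (flux m (um t)) - deriv h t * (ℓ (up t) - ℓ (um t))) := by
  have c1 : Continuous fun v : State => ℓ v := ℓ.continuous
  have c2 : Continuous fun v : State => ℓ (flux m v) := ℓ.continuous.comp (continuous_flux m)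
  obtain ⟨B₁, hB₁⟩ := exists_bound_comp hV c1
  obtain ⟨B₂, hB₂⟩ := exists_bound_comp hV c2
  have hG : ∀ v ∈ V, |ℓ v| ≤ max B₁ B₂ := fun v hv => (hB₁ v hv).trans (le_max_left _ _)
  have hQ : ∀ v ∈ V, |ℓ (flux m v)| ≤ max B₁ B₂ := fun v hv => (hB₂ v hv).trans (le_max_right _ _)
  have t1 : HasTrace (-1) (fun z => ℓ (u z)) h fun t => ℓ (um t) :=
    hum.comp (G := fun v => ℓ v) c1
  have t2 : HasTrace 1 (fun z => ℓ (u z)) h fun t => ℓ (up t) :=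
    hup.comp (G := fun v => ℓ v) c1
  have t3 : HasTrace (-1) (fun z => ℓ (flux m (u z))) h fun t => ℓ (flux m (um t)) :=
    hum.comp (G := fun v => ℓ (flux m v)) c2
  have t4 : HasTrace 1 (fun z => ℓ (flux m (u z))) h fun t => ℓ (flux m (up t)) :=
    hup.comp (G := fun v => ℓ (flux m v)) c2
  have m1 : AEStronglyMeasurable (fun z => ℓ (u z)) (volume.restrict spaceTime) :=
    c1.comp_aestronglyMeasurable H.aestronglyMeasurable
  have m2 : AEStronglyMeasurable (fun z => ℓ (flux m (u z))) (volume.restrict spaceTime) :=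
    c2.comp_aestronglyMeasurable H.aestronglyMeasurable
  have b1 : ∀ᵐ z ∂(volume.restrict spaceTime), |ℓ (u z)| ≤ max B₁ B₂ :=
    H.mem_stateSpace.mono fun z hz => hG (u z) hz
  have b2 : ∀ᵐ z ∂(volume.restrict spaceTime), |ℓ (flux m (u z))| ≤ max B₁ B₂ :=
    H.mem_stateSpace.mono fun z hz => hQ (u z) hz
  have i1 := hum.integrable_flux (by norm_num) hL hV.isClosed H.mem_stateSpace humm hG hQ c1 c2 hψ
  have i2 := hup.integrable_flux one_ne_zero hL hV.isClosed H.mem_stateSpace hupm hG hQ c1 c2 hψ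
  have n1 : IsSubPair (fun z => -ℓ (u z)) fun z => -ℓ (flux m (u z)) :=
    H.isSubPair_linear hV (-ℓ)
  exact (H.isSubPair_linear hV ℓ).integral_jump_nonneg n1 m1 m2 b1 b2 hL t1 t2 t3 t4 hψ i1 i2

/-- The Rankine–Hugoniot condition along Lipschitz curves. -/
theorem IsSWeak.rankineHugoniot (H : IsSWeak m V u) (hV : IsCompact V) {h : ℝ → ℝ} {L : ℝ≥0}
    (hL : LipschitzWith L h) {um up : ℝ → State}
    (hum : HasTrace (-1) u h um) (hup : HasTrace 1 u h up)
    (humm : AEStronglyMeasurable um (volume.restrict (Ioi 0)))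
    (hupm : AEStronglyMeasurable up (volume.restrict (Ioi 0))) :
    ∀ᵐ t ∂(volume.restrict (Ioi 0)), RankineHugoniot m (um t) (up t) (deriv h t) := by
  have key : ∀ ℓ : State →L[ℝ] ℝ, ∀ᵐ t ∂(volume.restrict (Ioi 0)),
      ℓ (flux m (up t)) - ℓ (flux m (um t)) - deriv h t * (ℓ (up t) - ℓ (um t)) = 0 := by
    intro ℓ
    set J : ℝ → ℝ := fun t =>
      ℓ (flux m (up t)) - ℓ (flux m (um t)) - deriv h t * (ℓ (up t) - ℓ (um t)) with hJ
    have hJm : AEStronglyMeasurable J (volume.restrict (Ioi 0)) := by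
      have c1 := ℓ.continuous
      have c2 := ℓ.continuous.comp (continuous_flux m)
      exact ((c2.comp_aestronglyMeasurable hupm).sub (c2.comp_aestronglyMeasurable humm)).sub
        ((measurable_deriv h).aestronglyMeasurable.mul
          ((c1.comp_aestronglyMeasurable hupm).sub (c1.comp_aestronglyMeasurable humm)))
    obtain ⟨B₁, hB₁⟩ := exists_bound_comp hV ℓ.continuous
    obtain ⟨B₂, hB₂⟩ := exists_bound_comp hV (ℓ.continuous.comp (continuous_flux m))
    have hJB : ∀ᵐ t ∂(volume.restrict (Ioi 0)), |J t| ≤ B₂ + B₂ + L * (B₁ + B₁) := by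
      filter_upwards [hum.mem_of_isClosed (by norm_num) hL.continuous.measurable hV.isClosed
        H.mem_stateSpace, hup.mem_of_isClosed one_ne_zero hL.continuous.measurable hV.isClosed
        H.mem_stateSpace] with t ht1 ht2
      refine (abs_sub _ _).trans (add_le_add ((abs_sub _ _).trans (add_le_add (hB₂ _ ht2)
        (hB₂ _ ht1))) ?_)
      rw [abs_mul]
      gcongr
      · exact norm_deriv_le_of_lipschitz hL
      · exact (abs_sub _ _).trans (add_le_add (hB₁ _ ht2) (hB₁ _ ht1))
    have hloc : LocallyIntegrableOn J (Ioi 0) :=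
      locallyIntegrableOn_of_locallyIntegrable_restrict
        ((memLp_top_of_bound hJm _ hJB).locallyIntegrable le_top)
    -- A smooth α has no sign, so it is split into positive and negative parts. These are only
    -- Lipschitz, which the extended class of test functions permits.
    rw [ae_restrict_iff' measurableSet_Ioi]
    refine isOpen_Ioi.ae_eq_zero_of_integral_contDiff_smul_eq_zero hloc fun α hα hαc hα0 => ?_
    obtain ⟨K, hK⟩ := hα.lipschitzWith_of_hasCompactSupport hαc (by simp)
    obtain ⟨R, hR⟩ := (hαc.isCompact.image hL.continuous).isBounded.exists_norm_le
    have hαcont : Continuous α := hK.continuous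
    have hone : ∀ ℓ' : State →L[ℝ] ℝ, ∀ β : ℝ → ℝ, LipschitzWith K β → (∀ t, 0 ≤ β t) →
        (∀ t, α t = 0 → β t = 0) → 0 ≤ ∫ t in Ioi 0, β t *
        (ℓ' (flux m (up t)) - ℓ' (flux m (um t)) - deriv h t * (ℓ' (up t) - ℓ' (um t))) := by
      intro ℓ' β hβ hβ0 hβα
      have hsub : tsupport β ⊆ tsupport α :=
        closure_mono fun t ht h => ht (hβα t h)
      -- With slope 0 and R bounding |h| over the support of α, the cutoff equals 1 on the relevant
      -- part of the curve; it serves only to make β compactly supported in x.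
      obtain ⟨K', hK'⟩ := exists_isLipschitzTest_cone hβ
        (hαc.isCompact.of_isClosed_subset (isClosed_tsupport _) hsub) (hsub.trans hα0) hβ0
        le_rfl R
      refine (H.integral_jump_nonneg hV hL hum hup humm hupm ℓ' hK').trans_eq ?_
      refine integral_congr_ae (.of_forall fun t => ?_)
      by_cases ht : β t = 0
      · simp [ht]
      · have : |h t| ≤ R := hR _ ⟨t, hsub (subset_tsupport _ ht), rfl⟩
        simp only
        rw [coneCutoff_eq_one (by simpa using this), mul_one]
    have hzero : ∀ β : ℝ → ℝ, LipschitzWith K β → (∀ t, 0 ≤ β t) →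
        (∀ t, α t = 0 → β t = 0) → ∫ t in Ioi 0, β t * J t = 0 := by
      intro β h1 h2 h3
      refine le_antisymm ?_ (hone ℓ β h1 h2 h3)
      have := hone (-ℓ) β h1 h2 h3
      have e : ∀ t, β t * ((-ℓ) (flux m (up t)) - (-ℓ) (flux m (um t))
          - deriv h t * ((-ℓ) (up t) - (-ℓ) (um t))) = -(β t * J t) := fun t => by
        simp only [hJ, neg_apply]; ring
      simp only [e, integral_neg] at this
      linarith
    have hz1 := hzero (fun t => max (α t) 0) (hK.max_const 0) (fun t => le_max_right _ _)
      (fun t ht => by simp [ht])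
    have hz2 := hzero (fun t => max (-α t) 0) (hK.neg.max_const 0) (fun t => le_max_right _ _)
      (fun t ht => by simp [ht])
    have hint : ∀ β : ℝ → ℝ, Continuous β → (∀ t, α t = 0 → β t = 0) →
        IntegrableOn (fun t => β t * J t) (Ioi 0) := fun β hβ h3 =>
      (hβ.integrable_of_hasCompactSupport (hαc.isCompact.of_isClosed_subset
        (isClosed_tsupport _) (closure_mono fun t ht h => ht (h3 t h)))).restrict.mul_bdd hJm hJB
    have hsub := integral_sub
      (hint (fun t => max (α t) 0) (hαcont.max continuous_const) (fun t ht => by simp [ht]))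
      (hint (fun t => max (-α t) 0) (hαcont.neg.max continuous_const)
        (fun t ht => by simp [ht]))
    rw [hz1, hz2, sub_zero] at hsub
    have hα' : ∫ t, α t • J t = ∫ t in Ioi 0, α t * J t :=
      (setIntegral_eq_integral_of_forall_compl_eq_zero fun t ht => by
        rw [image_eq_zero_of_notMem_tsupport fun h => ht (hα0 h), zero_smul]).symm
    refine hα'.trans (Eq.trans (integral_congr_ae (.of_forall fun t => ?_)) hsub)
    simp only
    rw [← sub_mul]
    congr 1
    rcases le_total 0 (α t) with h | h
    · rw [max_eq_left h, max_eq_right (by linarith), sub_zero]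
    · rw [max_eq_right h, max_eq_left (by linarith)]; ring
  filter_upwards [key (EuclideanSpace.proj 0), key (EuclideanSpace.proj 1)] with t h0 h1
  simp only [PiLp.proj_apply] at h0 h1
  unfold RankineHugoniot
  ext i
  fin_cases i
  · simp only [Fin.zero_eta, PiLp.smul_apply, PiLp.sub_apply, smul_eq_mul]; linarith
  · simp only [Fin.mk_one, PiLp.smul_apply, PiLp.sub_apply, smul_eq_mul]; linarith

end Solutions

/-! ### Filippov curves for discontinuous speeds -/

/-- A delayed Euler scheme for `x' = A(t, x)`, `x(0) = 0`. -/
lemma exists_euler_scheme {A : ℝ → ℝ → ℝ} (hA : Measurable fun z : ℝ × ℝ => A z.1 z.2) {L : ℝ}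
    (hL : ∀ s x, |A s x| ≤ L) {N : ℝ} (hN : 0 < N) :
    ∃ x : ℝ → ℝ, Measurable x ∧ ∀ s, 0 ≤ s → |x s - ∫ τ in (0 : ℝ)..s, A τ (x τ)| ≤ L / N := by
  -- On each step of length 1/N the position is frozen and only time is integrated, so measurability
  -- and a bound on A suffice.
  let H : ℕ → ℝ := fun k =>
    Nat.rec 0 (fun j y => y + ∫ τ in ((j : ℝ) / N)..(((j + 1 : ℕ) : ℝ) / N), A τ y) k
  have hH : ∀ k : ℕ, H (k + 1) = H k + ∫ τ in ((k : ℝ) / N)..(((k + 1 : ℕ) : ℝ) / N), A τ (H k) :=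
    fun k => rfl
  set x : ℝ → ℝ := fun s => H ⌊N * s⌋₊ with hx
  have hxm : Measurable x :=
    (measurable_from_nat (f := H)).comp (Nat.measurable_floor.comp (measurable_const_mul N))
  have hcm : Measurable fun τ => A τ (x τ) := hA.comp (measurable_id.prodMk hxm)
  have hint : ∀ a b : ℝ, IntervalIntegrable (fun τ => A τ (x τ)) volume a b := fun a b =>
    (intervalIntegrable_const (c := L)).mono_fun hcm.aestronglyMeasurable
      (.of_forall fun τ => (hL _ _).trans (le_abs_self L))
  have hnode : ∀ k : ℕ, ∫ τ in (0 : ℝ)..((k : ℝ) / N), A τ (x τ) = H k := by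
    intro k
    induction k with
    | zero => simp [H]
    | succ k ih =>
      rw [hH, ← intervalIntegral.integral_add_adjacent_intervals (hint 0 (k / N)) (hint _ _), ih]
      congr 1
      have hle : (k : ℝ) / N ≤ ((k + 1 : ℕ) : ℝ) / N := by gcongr; simp
      refine intervalIntegral.integral_congr_Ioo_of_le hle fun τ hτ => ?_
      have : ⌊N * τ⌋₊ = k := by
        rw [Nat.floor_eq_iff (by
          have : 0 ≤ τ := le_trans (by positivity) hτ.1.le
          positivity)]
        have h1 := (div_lt_iff₀ hN).1 hτ.1
        have h2 := (lt_div_iff₀ hN).1 hτ.2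
        push_cast at h2
        constructor <;> linarith
      simp only [hx, this]
  refine ⟨x, hxm, fun s hs => ?_⟩
  have h1 := hnode ⌊N * s⌋₊
  rw [show x s = H ⌊N * s⌋₊ from rfl, ← h1, intervalIntegral.integral_interval_sub_left
    (hint _ _) (hint _ _)]
  have hL0 : 0 ≤ L := (abs_nonneg _).trans (hL 0 0)
  have h2 : (⌊N * s⌋₊ : ℝ) ≤ N * s := Nat.floor_le (by positivity)
  have h3 := Nat.lt_floor_add_one (N * s)
  refine (intervalIntegral.norm_integral_le_of_norm_le_const (C := L)
    (f := fun τ => A τ (x τ)) fun τ _ => hL _ _).trans ?_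
  rw [div_eq_mul_inv L N]
  gcongr
  have e : (⌊N * s⌋₊ : ℝ) / N - s = (⌊N * s⌋₊ - N * s) / N := by field_simp
  rw [e, abs_div, abs_of_pos hN, div_le_iff₀ hN, inv_mul_cancel₀ hN.ne', abs_le]
  constructor <;> linarith

/-- Equi-Lipschitz functions vanishing at `0` have a pointwise convergent subsequence. -/
lemma exists_tendsto_subseq_of_lipschitz {L : ℝ≥0} {f : ℕ → ℝ → ℝ}
    (hf : ∀ n, LipschitzWith L (f n)) (h0 : ∀ n, f n 0 = 0) :
    ∃ φ : ℕ → ℕ, StrictMono φ ∧ ∃ h : ℝ → ℝ, LipschitzWith L h ∧ h 0 = 0 ∧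
      ∀ t, Tendsto (fun j => f (φ j) t) atTop (𝓝 (h t)) := by
  have hb : ∀ n (t : ℝ), |f n t| ≤ L * |t| := fun n t => by
    have := (hf n).dist_le_mul t 0
    rwa [h0, dist_zero_right, dist_zero_right] at this
  -- Tychonoff over the rationals extracts the subsequence; the common Lipschitz constant carries
  -- convergence to all times.
  obtain ⟨a, -, φ, hφ, hlim⟩ := (isCompact_univ_pi fun q : ℚ =>
    isCompact_Icc (a := -(L * |(q : ℝ)|)) (b := L * |(q : ℝ)|)).tendsto_subseq
    (x := fun n (q : ℚ) => f n q) fun n q _ => abs_le.1 (hb n q)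
  rw [tendsto_pi_nhds] at hlim
  have hc : ∀ t, ∃ y, Tendsto (fun j => f (φ j) t) atTop (𝓝 y) := by
    intro t
    refine cauchySeq_tendsto_of_complete (Metric.cauchySeq_iff.2 fun ε hε => ?_)
    obtain ⟨q, hq⟩ : ∃ q : ℚ, L * |t - q| < ε / 3 := by
      obtain ⟨q, hq1, hq2⟩ := exists_rat_btwn (show t < t + ε / 3 / (L + 1) by
        have : 0 < ε / 3 / ((L : ℝ) + 1) := by positivity
        linarith)
      refine ⟨q, ?_⟩
      have h1 : |t - q| < ε / 3 / (L + 1) := by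
        rw [abs_sub_comm, abs_of_pos] <;> linarith
      calc (L : ℝ) * |t - q| ≤ (L + 1) * |t - q| := by gcongr; linarith
        _ < (L + 1) * (ε / 3 / (L + 1)) := by gcongr
        _ = ε / 3 := by field_simp
    obtain ⟨N, hN⟩ := Metric.cauchySeq_iff.1 (hlim q).cauchySeq (ε / 3) (by positivity)
    refine ⟨N, fun i hi j hj => ?_⟩
    have h1 := (hf (φ i)).dist_le_mul t q
    have h2 := (hf (φ j)).dist_le_mul q t
    have h3 := hN i hi j hj
    rw [dist_comm (q : ℝ) t] at h2
    rw [Real.dist_eq t] at h1 h2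
    simp only [Function.comp_apply] at h3
    calc dist (f (φ i) t) (f (φ j) t)
        ≤ dist (f (φ i) t) (f (φ i) q) + dist (f (φ i) q) (f (φ j) q)
          + dist (f (φ j) q) (f (φ j) t) := dist_triangle4 _ _ _ _
      _ < ε := by linarith
  choose h hh using hc
  refine ⟨φ, hφ, h, LipschitzWith.of_dist_le_mul fun s t => ?_, ?_, hh⟩
  · exact le_of_tendsto' ((hh s).dist (hh t)) fun j => (hf (φ j)).dist_le_mul s t
  · exact tendsto_nhds_unique (hh 0) (by simp [h0])

lemma ae_deriv_le_of_integral_le {h M : ℝ → ℝ} {L : ℝ≥0} (hL : LipschitzWith L h)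
    (hM : LocallyIntegrable M)
    (hle : ∀ a b, 0 ≤ a → a ≤ b → h b - h a ≤ ∫ s in a..b, M s) :
    ∀ᵐ t ∂(volume.restrict (Ioi 0)), deriv h t ≤ M t := by
  rw [ae_restrict_iff' measurableSet_Ioi]
  filter_upwards [LocallyIntegrable.ae_hasDerivAt_integral hM, hL.ae_differentiableAt_real] with t h1 h2 ht
  have d1 := ((h1 0).hasDerivWithinAt (s := Ioi t))
  have d2 := (h2.hasDerivAt.hasDerivWithinAt (s := Ioi t))
  rw [hasDerivWithinAt_iff_tendsto_slope' (by simp)] at d1 d2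
  refine le_of_tendsto_of_tendsto d2 d1 ?_
  filter_upwards [self_mem_nhdsWithin] with b hb
  have hb' : t < b := hb
  have hi : ∀ a b : ℝ, IntervalIntegrable M volume a b := fun a b =>
    (hM.integrableOn_isCompact isCompact_uIcc).intervalIntegrable
  rw [slope_def_field, slope_def_field,
    intervalIntegral.integral_interval_sub_left (hi _ _) (hi _ _)]
  have : 0 < b - t := sub_pos.2 hb'
  gcongr
  exact hle t b (le_of_lt ht) hb'.le

/-- Asymptotic upper bounds for the velocities pass to the limit curve. -/
lemma ae_deriv_le_of_eventually_le {c : ℕ → ℝ → ℝ} {h M : ℝ → ℝ} {B : ℝ} {L : ℝ≥0}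
    (hc : ∀ j, Measurable (c j)) (hcB : ∀ j s, |c j s| ≤ B)
    (hM : AEStronglyMeasurable M (volume.restrict (Ioi 0)))
    (hMB : ∀ᵐ s ∂(volume.restrict (Ioi 0)), |M s| ≤ B) (hL : LipschitzWith L h)
    (hlim : ∀ t, Tendsto (fun j => ∫ s in (0 : ℝ)..t, c j s) atTop (𝓝 (h t)))
    (hup : ∀ᵐ s ∂(volume.restrict (Ioi 0)), ∀ ε > 0, ∀ᶠ j in atTop, c j s ≤ M s + ε) :
    ∀ᵐ t ∂(volume.restrict (Ioi 0)), deriv h t ≤ M t := by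
  set M' := (Ioi (0 : ℝ)).indicator M with hM'
  have hB0 : 0 ≤ B := (abs_nonneg _).trans (hcB 0 0)
  have hM'm : AEStronglyMeasurable M' volume :=
    (aestronglyMeasurable_indicator_iff measurableSet_Ioi).2 hM
  have hM'B : ∀ᵐ s, |M' s| ≤ B := by
    filter_upwards [(ae_restrict_iff' measurableSet_Ioi).1 hMB] with s hs
    by_cases h0 : s ∈ Ioi (0 : ℝ)
    · rw [hM', indicator_of_mem h0]; exact hs h0
    · rw [hM', indicator_of_notMem h0]; simpa
  have hM'i : LocallyIntegrable M' :=
    (memLp_top_of_bound hM'm B hM'B).locallyIntegrable le_top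
  have hup' : ∀ᵐ s, s ∈ Ioi (0 : ℝ) → ∀ ε > 0, ∀ᶠ j in atTop, c j s ≤ M' s + ε := by
    filter_upwards [(ae_restrict_iff' measurableSet_Ioi).1 hup] with s hs h0
    rw [hM', indicator_of_mem h0]; exact hs h0
  have hci : ∀ j (a b : ℝ), IntervalIntegrable (c j) volume a b := fun j a b =>
    (intervalIntegrable_const (c := B)).mono_fun (hc j).aestronglyMeasurable
      (.of_forall fun τ => (hcB _ _).trans (le_abs_self B))
  have key : ∀ a b, 0 ≤ a → a ≤ b → h b - h a ≤ ∫ s in a..b, M' s := by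
    intro a b ha hab
    -- The velocities need not converge; only their excess over M matters, and it tends to zero
    -- under a bound.
    set d : ℕ → ℝ → ℝ := fun j s => max (c j s - M' s) 0 with hd
    have hMi : IntervalIntegrable M' volume a b :=
      (hM'i.integrableOn_isCompact isCompact_uIcc).intervalIntegrable
    have hdm : ∀ j, AEStronglyMeasurable (d j) volume := fun j =>
      ((hc j).aestronglyMeasurable.sub hM'm).sup aestronglyMeasurable_const
    have hdB : ∀ j, ∀ᵐ s, ‖d j s‖ ≤ B + B := fun j => hM'B.mono fun s hs => by
      have h1 : |c j s - M' s| ≤ B + B := (abs_sub _ _).trans (add_le_add (hcB j s) hs)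
      rw [Real.norm_eq_abs, abs_of_nonneg (le_max_right _ _)]
      exact max_le ((le_abs_self _).trans h1) (by positivity)
    have hdi : ∀ j, IntervalIntegrable (d j) volume a b := fun j =>
      (intervalIntegrable_const (c := B + B)).mono_fun (hdm j).restrict
        (ae_restrict_of_ae ((hdB j).mono fun s hs => hs.trans (le_abs_self _)))
    have hdlim : Tendsto (fun j => ∫ s in a..b, d j s) atTop (𝓝 (∫ s in a..b, (0 : ℝ))) := by
      refine intervalIntegral.tendsto_integral_filter_of_dominated_convergence (fun _ => B + B)
        (.of_forall fun j => (hdm j).restrict) (.of_forall fun j => ?_) (by simp) ?_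
      · exact (hdB j).mono fun s hs _ => hs
      · refine hup'.mono fun s hs hsab => ?_
        rw [uIoc_of_le hab] at hsab
        rw [Metric.tendsto_nhds]
        intro ε hε
        filter_upwards [hs (ha.trans_lt hsab.1) (ε / 2) (half_pos hε)] with j hj
        rw [Real.dist_eq, sub_zero, abs_of_nonneg (le_max_right _ _)]
        exact max_lt (by linarith) hε
    rw [intervalIntegral.integral_zero] at hdlim
    have hle : ∀ j, (∫ s in (0 : ℝ)..b, c j s) - ∫ s in (0 : ℝ)..a, c j s
        ≤ (∫ s in a..b, M' s) + ∫ s in a..b, d j s := fun j => by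
      rw [intervalIntegral.integral_interval_sub_left (hci _ _ _) (hci _ _ _),
        ← intervalIntegral.integral_add hMi (hdi j)]
      refine intervalIntegral.integral_mono_on hab (hci _ _ _) (hMi.add (hdi j)) fun s _ => ?_
      have := le_max_left (c j s - M' s) 0
      simp only [hd]; linarith
    have := le_of_tendsto_of_tendsto' ((hlim b).sub (hlim a)) (hdlim.const_add _) hle
    simpa using this
  filter_upwards [ae_deriv_le_of_integral_le hL hM'i key, ae_restrict_mem measurableSet_Ioi]
    with t ht h0
  rwa [hM', indicator_of_mem h0] at ht

lemma HasTrace.ae_ball {e : ℝ} (he : |e| = 1) {F : ℝ × ℝ → ℝ} {h Fe : ℝ → ℝ}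
    (H : HasTrace e F h Fe) :
    ∀ᵐ t ∂(volume.restrict (Ioi 0)), ∀ ε > 0, ∃ r > 0, ∀ᵐ x, 0 < e * (x - h t) →
      |x - h t| < r → |F (t, x) - Fe t| ≤ ε := by
  have he0 : e ≠ 0 := by rintro rfl; simp at he
  have he2 : e * e = 1 := by rw [← abs_mul_abs_self, he, one_mul]
  filter_upwards [H] with t ht ε hε
  obtain ⟨r, hr, hy⟩ := ht ε hε
  refine ⟨r, hr, ?_⟩
  rw [ae_restrict_iff' measurableSet_Ioo] at hy
  have hq : Measure.QuasiMeasurePreserving (fun x : ℝ => e * (x - h t)) := by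
    refine ⟨by fun_prop, Measure.AbsolutelyContinuous.mk fun s hs h0 => ?_⟩
    rw [Measure.map_apply (by fun_prop) hs]
    rw [show (fun x : ℝ => e * (x - h t)) ⁻¹' s = (fun x => x - h t) ⁻¹' ((fun y => e * y) ⁻¹' s)
      from rfl, (measurePreserving_sub_right volume (h t)).measure_preimage
      (measurable_const_mul e hs).nullMeasurableSet, Real.volume_preimage_mul_left he0, h0,
      mul_zero]
  filter_upwards [hq.ae hy] with x hx h1 h2
  have h3 : e * (x - h t) < r := by
    rw [← abs_of_pos h1, abs_mul, he, one_mul]; exact h2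
  have h4 := hx ⟨h1, h3⟩
  rwa [← mul_assoc, he2, one_mul, add_sub_cancel, Real.norm_eq_abs] at h4

/-- Averages of `F` over short intervals near `h t` are nearly at most the larger trace. -/
lemma HasTrace.ae_eventually_average_le {F : ℝ × ℝ → ℝ} (hF : Measurable F) {B : ℝ}
    (hFB : ∀ z, |F z| ≤ B) {h Fm Fp : ℝ → ℝ}
    (hm : HasTrace (-1) F h Fm) (hp : HasTrace 1 F h Fp) {N : ℕ → ℝ}
    (hN : Tendsto N atTop atTop) {x : ℕ → ℝ → ℝ}
    (hx : ∀ t, 0 ≤ t → Tendsto (fun j => x j t) atTop (𝓝 (h t))) :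
    ∀ᵐ t ∂(volume.restrict (Ioi 0)), ∀ ε > 0, ∀ᶠ j in atTop,
      ∫ y in (0 : ℝ)..1, F (t, x j t + y / N j) ≤ max (Fm t) (Fp t) + ε := by
  filter_upwards [hm.ae_ball (by simp), hp.ae_ball (by simp), ae_restrict_mem measurableSet_Ioi]
    with t h1 h2 ht ε hε
  obtain ⟨r1, hr1, hy1⟩ := h1 ε hε
  obtain ⟨r2, hr2, hy2⟩ := h2 ε hε
  have hr : 0 < min r1 r2 := lt_min hr1 hr2
  have hne : ∀ᵐ x : ℝ, x ≠ h t := Measure.ae_ne volume _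
  have hall : ∀ᵐ x, |x - h t| < min r1 r2 → F (t, x) ≤ max (Fm t) (Fp t) + ε := by
    filter_upwards [hy1, hy2, hne] with x g1 g2 g3 g4
    rcases lt_or_gt_of_ne g3 with g | g
    · have := (abs_le.1 (g1 (by linarith) (g4.trans_le (min_le_left _ _)))).2
      linarith [le_max_left (Fm t) (Fp t)]
    · have := (abs_le.1 (g2 (by linarith) (g4.trans_le (min_le_right _ _)))).2
      linarith [le_max_right (Fm t) (Fp t)]
  -- Eventually the whole averaging window lies in the ball around h(t) on which F is, up to ε,
  -- below one of the two traces.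
  have e1 : ∀ᶠ j in atTop, |x j t - h t| < min r1 r2 / 2 :=
    (Metric.tendsto_nhds.1 (hx t (le_of_lt ht)) _ (half_pos hr))
  have e2 : ∀ᶠ j in atTop, 2 / min r1 r2 < N j := hN.eventually_gt_atTop _
  filter_upwards [e1, e2] with j g1 g2
  have hNj : 0 < N j := lt_trans (by positivity) g2
  have hq : Measure.QuasiMeasurePreserving (fun y : ℝ => x j t + y / N j) := by
    refine ⟨by fun_prop, Measure.AbsolutelyContinuous.mk fun s hs h0 => ?_⟩
    rw [Measure.map_apply (by fun_prop) hs]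
    simp only [div_eq_mul_inv]
    rw [show (fun y : ℝ => x j t + y * (N j)⁻¹) ⁻¹' s
      = (fun y => y * (N j)⁻¹) ⁻¹' ((fun z => x j t + z) ⁻¹' s) from rfl,
      Real.volume_preimage_mul_right (by positivity), measure_preimage_add, h0, mul_zero]
  have hb : ∀ᵐ y : ℝ, y ∈ Icc (0 : ℝ) 1 → F (t, x j t + y / N j) ≤ max (Fm t) (Fp t) + ε := by
    filter_upwards [hq.ae hall] with y hy hy01
    refine hy ?_
    have : y / N j ≤ min r1 r2 / 2 := by
      rw [div_le_iff₀ hNj]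
      have := (div_lt_iff₀ hr).1 g2
      linarith [hy01.2]
    have h0 : 0 ≤ y / N j := div_nonneg hy01.1 hNj.le
    calc |x j t + y / N j - h t| = |(x j t - h t) + y / N j| := by ring_nf
      _ ≤ |x j t - h t| + |y / N j| := abs_add_le _ _
      _ < min r1 r2 := by rw [abs_of_nonneg h0]; linarith
  have hint : IntervalIntegrable (fun y => F (t, x j t + y / N j)) volume 0 1 :=
    (intervalIntegrable_const (c := B)).mono_fun
      (hF.comp (by fun_prop)).aestronglyMeasurable
      (.of_forall fun τ => (hFB _).trans (le_abs_self B))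
  calc ∫ y in (0 : ℝ)..1, F (t, x j t + y / N j)
      ≤ ∫ y in (0 : ℝ)..1, (max (Fm t) (Fp t) + ε) :=
        intervalIntegral.integral_mono_ae_restrict zero_le_one hint (by simp)
          ((ae_restrict_iff' measurableSet_Icc).2 hb)
    _ = _ := by simp

lemma HasTrace.neg {e : ℝ} {F : ℝ × ℝ → ℝ} {h Fe : ℝ → ℝ} (H : HasTrace e F h Fe) :
    HasTrace e (fun z => -F z) h fun t => -Fe t :=
  H.comp (G := fun y : ℝ => -y) continuous_neg

lemma HasTrace.congr_ae {e : ℝ} (he : e ≠ 0) {E : Type*} [NormedAddCommGroup E]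
    {F G : ℝ × ℝ → E} {h : ℝ → ℝ} {Fe : ℝ → E} (H : HasTrace e F h Fe) (hh : Measurable h)
    (hFG : F =ᵐ[volume.restrict spaceTime] G) : HasTrace e G h Fe := by
  have h1 := (quasiMeasurePreserving_shear hh he).ae hFG
  rw [volume_restrict_spaceTime] at h1
  filter_upwards [Measure.ae_ae_of_ae_prod h1, H] with t ht1 ht2 ε hε
  obtain ⟨r, hr, hy⟩ := ht2 ε hε
  refine ⟨r, hr, ?_⟩
  filter_upwards [hy, ae_restrict_of_ae ht1] with y hy1 hy2
  rwa [← hy2]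

/-- Filippov solutions: a bounded measurable speed has an integral curve whose velocity lies
between the traces of the speed. -/
lemma exists_filippov_curve {F : ℝ × ℝ → ℝ} (hF : Measurable F) {L : ℝ≥0}
    (hFL : ∀ z, |F z| ≤ L) :
    ∃ h : ℝ → ℝ, LipschitzWith L h ∧ h 0 = 0 ∧ ∀ Fm Fp : ℝ → ℝ,
      HasTrace (-1) F h Fm → HasTrace 1 F h Fp →
      AEStronglyMeasurable Fm (volume.restrict (Ioi 0)) →
      AEStronglyMeasurable Fp (volume.restrict (Ioi 0)) →
      (∀ᵐ t ∂(volume.restrict (Ioi 0)), |Fm t| ≤ L) →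
      (∀ᵐ t ∂(volume.restrict (Ioi 0)), |Fp t| ≤ L) →
      ∀ᵐ t ∂(volume.restrict (Ioi 0)),
        min (Fm t) (Fp t) ≤ deriv h t ∧ deriv h t ≤ max (Fm t) (Fp t) := by
  -- Averages over shrinking intervals are used because values of F on a single curve carry no
  -- information about almost everywhere properties.
  set A : ℕ → ℝ → ℝ → ℝ := fun n s x => ∫ y in (0 : ℝ)..1, F (s, x + y / ((n : ℝ) + 1)) with hA
  have hAm : ∀ n, Measurable fun z : ℝ × ℝ => A n z.1 z.2 := fun n => by
    simp only [hA, intervalIntegral.integral_of_le zero_le_one]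
    have : StronglyMeasurable fun w : (ℝ × ℝ) × ℝ => F (w.1.1, w.1.2 + w.2 / ((n : ℝ) + 1)) :=
      (hF.comp (by fun_prop)).stronglyMeasurable
    exact this.integral_prod_right'.measurable
  have hAL : ∀ n s x, |A n s x| ≤ L := fun n s x => by
    have := intervalIntegral.norm_integral_le_of_norm_le_const (a := 0) (b := 1) (C := L)
      (f := fun y => F (s, x + y / ((n : ℝ) + 1))) fun y _ => hFL _
    simpa using this
  choose x hxm hx using fun n : ℕ => exists_euler_scheme (hAm n) (hAL n) (N := (n : ℝ) + 1)
    (by positivity)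
  set c : ℕ → ℝ → ℝ := fun n s => A n s (x n s) with hc
  have hcm : ∀ n, Measurable (c n) := fun n => (hAm n).comp (measurable_id.prodMk (hxm n))
  have hcL : ∀ n s, |c n s| ≤ L := fun n s => hAL _ _ _
  have hci : ∀ n (a b : ℝ), IntervalIntegrable (c n) volume a b := fun n a b =>
    (intervalIntegrable_const (c := (L : ℝ))).mono_fun (hcm n).aestronglyMeasurable
      (.of_forall fun τ => (hcL _ _).trans (le_abs_self _))
  obtain ⟨φ, hφ, h, hL, h0, hlim⟩ := exists_tendsto_subseq_of_lipschitz (L := L)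
    (f := fun n t => ∫ s in (0 : ℝ)..t, c n s) (fun n => LipschitzWith.of_dist_le_mul fun s t => by
      rw [Real.dist_eq, intervalIntegral.integral_interval_sub_left (hci _ _ _) (hci _ _ _)]
      exact intervalIntegral.norm_integral_le_of_norm_le_const (f := c n) fun y _ => hcL _ _)
    fun n => by simp
  have hN : Tendsto (fun j => ((φ j : ℕ) : ℝ) + 1) atTop atTop :=
    tendsto_atTop_add_const_right _ _ (tendsto_natCast_atTop_atTop.comp hφ.tendsto_atTop)
  have hxlim : ∀ t, 0 ≤ t → Tendsto (fun j => x (φ j) t) atTop (𝓝 (h t)) := fun t ht => by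
    have h1 : Tendsto (fun j => (L : ℝ) / (((φ j : ℕ) : ℝ) + 1)) atTop (𝓝 0) :=
      hN.const_div_atTop _
    have h2 : Tendsto (fun j => x (φ j) t - ∫ s in (0 : ℝ)..t, c (φ j) s) atTop (𝓝 0) :=
      squeeze_zero_norm (fun j => hx (φ j) t ht) h1
    simpa using h2.add (hlim t)
  refine ⟨h, hL, h0, fun Fm Fp hm hp hmm hpm hmL hpL => ?_⟩
  have bm : ∀ᵐ t ∂(volume.restrict (Ioi 0)), |max (Fm t) (Fp t)| ≤ L := by
    filter_upwards [hmL, hpL] with t h1 h2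
    exact abs_max_le_max_abs_abs.trans (max_le h1 h2)
  have bm' : ∀ᵐ t ∂(volume.restrict (Ioi 0)), |max (-Fm t) (-Fp t)| ≤ L := by
    filter_upwards [hmL, hpL] with t h1 h2
    exact abs_max_le_max_abs_abs.trans (max_le (by rwa [abs_neg]) (by rwa [abs_neg]))
  have up := ae_deriv_le_of_eventually_le (fun j => hcm (φ j)) (fun j => hcL (φ j))
    (hmm.sup hpm) bm hL hlim (hm.ae_eventually_average_le hF hFL hp hN hxlim)
  -- The lower bound is the upper bound for -F and -h.
  have lo := ae_deriv_le_of_eventually_le (c := fun j s => -c (φ j) s) (h := fun t => -h t)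
    (M := fun t => max (-Fm t) (-Fp t)) (L := L)
    (fun j => (hcm (φ j)).neg) (fun j s => by rw [abs_neg]; exact hcL _ _)
    (hmm.neg.sup hpm.neg) bm' hL.neg (fun t => by simpa using (hlim t).neg) (by
      have := hm.neg.ae_eventually_average_le hF.neg (by simpa using hFL) hp.neg hN hxlim
      simpa [hc, hA] using this)
  filter_upwards [up, lo] with t h1 h2
  refine ⟨?_, h1⟩
  rw [deriv.fun_neg, max_neg_neg] at h2
  linarith

/-- Existence of the shift driven by a continuous velocity `Λ`. -/
theorem exists_shift {V : Set State} (hV : IsCompact V) {u : ℝ × ℝ → State}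
    (hu : AEStronglyMeasurable u (volume.restrict spaceTime))
    (huV : ∀ᵐ z ∂(volume.restrict spaceTime), u z ∈ V) {Λ : State → ℝ} (hΛ : Continuous Λ) :
    ∃ (h : ℝ → ℝ) (L : ℝ≥0), LipschitzWith L h ∧ h 0 = 0 ∧ ∀ um up : ℝ → State,
      HasTrace (-1) u h um → HasTrace 1 u h up →
      AEStronglyMeasurable um (volume.restrict (Ioi 0)) →
      AEStronglyMeasurable up (volume.restrict (Ioi 0)) →
      ∀ᵐ t ∂(volume.restrict (Ioi 0)),
        min (Λ (um t)) (Λ (up t)) ≤ deriv h t ∧ deriv h t ≤ max (Λ (um t)) (Λ (up t)) := by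
  obtain ⟨B, hB⟩ := exists_bound_comp hV hΛ
  set L : ℝ≥0 := B.toNNReal with hL
  have hBL : ∀ v ∈ V, |Λ v| ≤ L := fun v hv => (hB v hv).trans (Real.le_coe_toNNReal B)
  have hm := hΛ.comp_aestronglyMeasurable hu
  -- Clamping a measurable representative gives a speed that is bounded at every point, without
  -- changing it almost everywhere.
  set F : ℝ × ℝ → ℝ := fun z => max (-L) (min L (hm.mk _ z)) with hF
  have hFm : Measurable F :=
    measurable_const.max (measurable_const.min hm.stronglyMeasurable_mk.measurable)
  have hFL : ∀ z, |F z| ≤ L := fun z => abs_le.2 ⟨le_max_left _ _,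
    max_le ((neg_nonpos.2 L.coe_nonneg).trans L.coe_nonneg) (min_le_left _ _)⟩
  have hFΛ : (fun z => Λ (u z)) =ᵐ[volume.restrict spaceTime] F := by
    filter_upwards [hm.ae_eq_mk, huV] with z h1 h2
    have := abs_le.1 (hBL _ h2)
    simp only [hF, ← h1]
    rw [min_eq_right this.2, max_eq_right this.1]
  obtain ⟨h, hh, h0, H⟩ := exists_filippov_curve hFm hFL
  have hhm : Measurable h := hh.continuous.measurable
  refine ⟨h, L, hh, h0, fun um up h1 h2 m1 m2 => ?_⟩
  exact H (fun t => Λ (um t)) (fun t => Λ (up t))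
    ((h1.comp (G := Λ) hΛ).congr_ae (by norm_num) hhm hFΛ)
    ((h2.comp (G := Λ) hΛ).congr_ae one_ne_zero hhm hFΛ)
    (hΛ.comp_aestronglyMeasurable m1) (hΛ.comp_aestronglyMeasurable m2)
    ((h1.mem_of_isClosed (by norm_num) hhm hV.isClosed huV).mono fun t ht => hBL _ ht)
    ((h2.mem_of_isClosed one_ne_zero hhm hV.isClosed huV).mono fun t ht => hBL _ ht)

/-! ### Finite propagation speed and localized mass -/

/-- Along a line of speed at most Λ, the quantity |x| + Λ t does not decrease. -/
lemma coneCutoff_antitone_line {Λ R ξ : ℝ} (hξ : |ξ| ≤ Λ) (z : ℝ × ℝ) :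
    Antitone fun s : ℝ => coneCutoff Λ R (z + s • ((1, ξ) : ℝ × ℝ)) := by
  intro s t hst
  refine sub_le_sub_left (monotone_ramp zero_le_one ?_) _
  have h1 : |z.2 + s * ξ| ≤ |z.2 + t * ξ| + (t - s) * Λ := by
    calc |z.2 + s * ξ| = |(z.2 + t * ξ) - (t - s) * ξ| := by ring_nf
      _ ≤ |z.2 + t * ξ| + |(t - s) * ξ| := abs_sub _ _
      _ ≤ _ := by
        rw [abs_mul, abs_of_nonneg (sub_nonneg.2 hst)]
        have := mul_le_mul_of_nonneg_left hξ (sub_nonneg.2 hst)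
        linarith
  simp only [Prod.fst_add, Prod.snd_add, Prod.smul_fst, Prod.smul_snd, smul_eq_mul, mul_one]
  linarith

/-- The cone cutoff is a supersolution for every transport speed at most `Λ`. -/
lemma fderiv_coneCutoff_le {Λ R : ℝ} (hΛ : 0 ≤ Λ) {z : ℝ × ℝ}
    (hd : DifferentiableAt ℝ (coneCutoff Λ R) z) {W Q : ℝ} (hQ : |Q| ≤ Λ * W) (hW : 0 ≤ W) :
    fderiv ℝ (coneCutoff Λ R) z (1, 0) * W + fderiv ℝ (coneCutoff Λ R) z (0, 1) * Q ≤ 0 := by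
  set D := fderiv ℝ (coneCutoff Λ R) z with hD
  have hdir : ∀ ξ : ℝ, |ξ| ≤ Λ → D (1, 0) + ξ * D (0, 1) ≤ 0 := by
    intro ξ hξ
    have h1 : HasDerivAt (fun s : ℝ => coneCutoff Λ R (z + s • ((1, ξ) : ℝ × ℝ)))
        (D (1, ξ)) 0 := hd.hasFDerivAt.hasLineDerivAt _
    have h2 := h1.nonpos_of_antitone (coneCutoff_antitone_line hξ z)
    have e : ((1, ξ) : ℝ × ℝ) = (1, 0) + ξ • (0, 1) := by simp
    rwa [e, map_add, map_smul, smul_eq_mul] at h2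
  -- The two extreme speeds ±Λ bound Λ|∂ₓ| by -∂ₜ, which is all that the bound on Q requires.
  have h1 := hdir Λ (abs_of_nonneg hΛ).le
  have h2 := hdir (-Λ) (by rw [abs_neg, abs_of_nonneg hΛ])
  have h3 : Λ * |D (0, 1)| ≤ -D (1, 0) := by
    have e : Λ * |D (0, 1)| = |Λ * D (0, 1)| := by rw [abs_mul, abs_of_nonneg hΛ]
    rw [e]
    exact abs_le.2 ⟨by linarith, by linarith⟩
  have h4 : D (0, 1) * Q ≤ |D (0, 1)| * (Λ * W) :=
    (le_abs_self _).trans (by rw [abs_mul]; gcongr)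
  have h5 := mul_le_mul_of_nonneg_right h3 hW
  linarith

/-- The localized mass of `W` at time `t`. -/
noncomputable def coneMass (Λ R : ℝ) (W : ℝ × ℝ → ℝ) (t : ℝ) : ℝ :=
  ∫ x, coneCutoff Λ R (t, x) * W (t, x)

section Weighted

variable {W Q : ℝ × ℝ → ℝ} {Λ B : ℝ}

/-- Test with α(t) times the cone cutoff. Because |Q| ≤ Λ W, the gradient of the cutoff contributes
with a nonpositive sign and can be dropped. -/
lemma integral_deriv_mul_cone_nonneg (hΛ : 0 ≤ Λ)
    (hWm : AEStronglyMeasurable W (volume.restrict spaceTime))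
    (hQm : AEStronglyMeasurable Q (volume.restrict spaceTime))
    (hW0 : ∀ᵐ z ∂(volume.restrict spaceTime), 0 ≤ W z)
    (hWB : ∀ᵐ z ∂(volume.restrict spaceTime), |W z| ≤ B)
    (hQ : ∀ᵐ z ∂(volume.restrict spaceTime), |Q z| ≤ Λ * W z)
    (H : ∀ K ψ, IsLipschitzTest K ψ →
      0 ≤ ∫ z in spaceTime, (fderiv ℝ ψ z (1, 0) * W z + fderiv ℝ ψ z (0, 1) * Q z))
    {α : ℝ → ℝ} {K : ℝ≥0} (hα : LipschitzWith K α) (hαc : HasCompactSupport α)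
    (hα0 : tsupport α ⊆ Ioi 0) (hαn : ∀ t, 0 ≤ α t) (R : ℝ) :
    IntegrableOn (fun z : ℝ × ℝ => deriv α z.1 * (coneCutoff Λ R z * W z)) spaceTime ∧
    0 ≤ ∫ z in spaceTime, deriv α z.1 * (coneCutoff Λ R z * W z) := by
  obtain ⟨K', hψ⟩ := exists_isLipschitzTest_cone hα hαc hα0 hαn hΛ R
  have hcc := (lipschitzWith_coneCutoff hΛ R)
  have hQB : ∀ᵐ z ∂(volume.restrict spaceTime), |Q z| ≤ Λ * B := by
    filter_upwards [hWB, hQ] with z h1 h2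
    exact h2.trans (mul_le_mul_of_nonneg_left ((le_abs_self _).trans h1) hΛ)
  have hi := (integrable_fderiv_smul hψ.lipschitz hψ.compact hWm hWB (1, 0)).add
    (integrable_fderiv_smul hψ.lipschitz hψ.compact hQm hQB (0, 1))
  have hdm : Measurable fun z : ℝ × ℝ => deriv α z.1 := (measurable_deriv α).comp measurable_fst
  have hint : IntegrableOn (fun z : ℝ × ℝ => deriv α z.1 * (coneCutoff Λ R z * W z))
      spaceTime := by
    have hcomp : IsCompact (tsupport α ×ˢ Metric.closedBall (0 : ℝ) (|R| + 1)) :=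
      hαc.isCompact.prod (isCompact_closedBall _ _)
    have h1 : IntegrableOn (fun z : ℝ × ℝ => deriv α z.1 * coneCutoff Λ R z)
        (tsupport α ×ˢ Metric.closedBall (0 : ℝ) (|R| + 1)) := by
      refine Measure.integrableOn_of_bounded (M := K * 1) hcomp.measure_ne_top
        (hdm.aestronglyMeasurable.mul hcc.continuous.aestronglyMeasurable)
        (.of_forall fun z => ?_)
      rw [norm_mul]
      gcongr
      · exact norm_deriv_le_of_lipschitz hα
      · exact abs_coneCutoff_le _ _ _
    have h2 : Integrable (fun z : ℝ × ℝ => deriv α z.1 * coneCutoff Λ R z) := by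
      refine (integrableOn_iff_integrable_of_support_subset fun z hz => ?_).1 h1
      have g1 : deriv α z.1 ≠ 0 := left_ne_zero_of_mul hz
      have g2 : coneCutoff Λ R z ≠ 0 := right_ne_zero_of_mul hz
      have g3 : z.1 ∈ tsupport α := support_deriv_subset g1
      refine ⟨g3, ?_⟩
      rw [mem_closedBall_zero_iff]
      by_contra! h4
      refine g2 (coneCutoff_eq_zero ?_)
      have := mul_nonneg hΛ (le_of_lt (hα0 g3))
      have := le_abs_self R
      rw [Real.norm_eq_abs] at h4
      linarith
    have h3 := h2.restrict.mul_bdd hWm hWB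
    simp only [mul_assoc] at h3
    exact h3
  refine ⟨hint, (H K' _ hψ).trans (integral_mono_ae hi hint ?_)⟩
  have hαd : ∀ᵐ z ∂(volume.restrict spaceTime), DifferentiableAt ℝ α z.1 := by
    rw [volume_restrict_spaceTime]
    exact Measure.quasiMeasurePreserving_fst.ae
      (ae_restrict_of_ae hα.ae_differentiableAt_real)
  filter_upwards [hαd, ae_restrict_of_ae hcc.ae_differentiableAt, hW0, hQ] with z h1 h2 h3 h4
  have d1 : HasFDerivAt (fun z : ℝ × ℝ => α z.1) (deriv α z.1 • ContinuousLinearMap.fst ℝ ℝ ℝ) z :=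
    h1.hasDerivAt.comp_hasFDerivAt z hasFDerivAt_fst
  have d2 := (d1.mul h2.hasFDerivAt).fderiv
  have e1 : (fun z : ℝ × ℝ => α z.1 * coneCutoff Λ R z)
      = (fun z : ℝ × ℝ => α z.1) * coneCutoff Λ R := rfl
  have h5 := mul_nonpos_of_nonneg_of_nonpos (hαn z.1) (fderiv_coneCutoff_le hΛ h2 h4 h3)
  rw [e1, d2]
  simp only [add_apply, smul_apply, ContinuousLinearMap.coe_fst', smul_eq_mul, mul_one,
    mul_zero, add_zero]
  linarith

lemma abs_coneCutoff_mul_le (hΛ : 0 ≤ Λ) (R : ℝ) {t : ℝ} (ht : 0 ≤ t) {x y : ℝ} (hy : |y| ≤ B) :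
    |coneCutoff Λ R (t, x) * y| ≤ (Icc (-(|R| + 1)) (|R| + 1)).indicator (fun _ => B) x := by
  by_cases h : x ∈ Icc (-(|R| + 1)) (|R| + 1)
  · rw [indicator_of_mem h, abs_mul]
    exact (mul_le_of_le_one_left (abs_nonneg _) (abs_coneCutoff_le _ _ _)).trans hy
  · rw [indicator_of_notMem h, coneCutoff_eq_zero, zero_mul, abs_zero]
    have h3 : |R| + 1 < |x| := by
      by_contra! h4
      exact h (abs_le.1 h4)
    have := mul_nonneg hΛ ht
    have := le_abs_self R
    simp only
    linarith

lemma integrable_indicator_Icc (a b c : ℝ) : Integrable ((Icc a b).indicator fun _ : ℝ => c) :=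
  (integrable_indicator_iff measurableSet_Icc).2 (integrableOn_const (by simp))

lemma integrable_coneCutoff_mul (hΛ : 0 ≤ Λ) (R : ℝ) {t : ℝ} (ht : 0 ≤ t) {f : ℝ → ℝ}
    (hfm : AEStronglyMeasurable f) (hf : ∀ᵐ x, |f x| ≤ B) :
    Integrable fun x => coneCutoff Λ R (t, x) * f x :=
  (integrable_indicator_Icc _ _ B).mono'
    (((lipschitzWith_coneCutoff hΛ R).continuous.comp
      (continuous_const.prodMk continuous_id)).aestronglyMeasurable.mul hfm)
    (hf.mono fun _ hx => abs_coneCutoff_mul_le hΛ R ht hx)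

lemma abs_integral_coneCutoff_mul_le (hΛ : 0 ≤ Λ) (R : ℝ) {t : ℝ} (ht : 0 ≤ t) {f : ℝ → ℝ}
    (hf : ∀ᵐ x, |f x| ≤ B) :
    |∫ x, coneCutoff Λ R (t, x) * f x| ≤ B * (2 * (|R| + 1)) := by
  have hR : 0 ≤ |R| + 1 := by positivity
  refine (norm_integral_le_of_norm_le (f := fun x => coneCutoff Λ R (t, x) * f x)
    (integrable_indicator_Icc _ _ B)
    (hf.mono fun _ hx => abs_coneCutoff_mul_le hΛ R ht hx)).trans_eq ?_
  rw [integral_indicator measurableSet_Icc, setIntegral_const, Real.volume_real_Icc_of_le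
    (by linarith), smul_eq_mul]
  ring

lemma aestronglyMeasurable_coneMass (hΛ : 0 ≤ Λ) (R : ℝ)
    (hWm : AEStronglyMeasurable W (volume.restrict spaceTime)) :
    AEStronglyMeasurable (coneMass Λ R W) (volume.restrict (Ioi 0)) := by
  have : AEStronglyMeasurable (fun z => coneCutoff Λ R z * W z) (volume.restrict spaceTime) :=
    (lipschitzWith_coneCutoff hΛ R).continuous.aestronglyMeasurable.mul hWm
  rw [volume_restrict_spaceTime] at this
  exact this.integral_prod_right'

lemma ae_abs_coneMass_le (hΛ : 0 ≤ Λ) (R : ℝ)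
    (hWB : ∀ᵐ z ∂(volume.restrict spaceTime), |W z| ≤ B) :
    ∀ᵐ t ∂(volume.restrict (Ioi 0)), |coneMass Λ R W t| ≤ B * (2 * (|R| + 1)) := by
  rw [volume_restrict_spaceTime] at hWB
  filter_upwards [Measure.ae_ae_of_ae_prod hWB, ae_restrict_mem measurableSet_Ioi] with t h1 h2
  exact abs_integral_coneCutoff_mul_le hΛ R (le_of_lt h2) h1

lemma integral_deriv_mul_coneMass_nonneg (hΛ : 0 ≤ Λ)
    (hWm : AEStronglyMeasurable W (volume.restrict spaceTime))
    (hQm : AEStronglyMeasurable Q (volume.restrict spaceTime))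
    (hW0 : ∀ᵐ z ∂(volume.restrict spaceTime), 0 ≤ W z)
    (hWB : ∀ᵐ z ∂(volume.restrict spaceTime), |W z| ≤ B)
    (hQ : ∀ᵐ z ∂(volume.restrict spaceTime), |Q z| ≤ Λ * W z)
    (H : ∀ K ψ, IsLipschitzTest K ψ →
      0 ≤ ∫ z in spaceTime, (fderiv ℝ ψ z (1, 0) * W z + fderiv ℝ ψ z (0, 1) * Q z))
    {α : ℝ → ℝ} {K : ℝ≥0} (hα : LipschitzWith K α) (hαc : HasCompactSupport α)
    (hα0 : tsupport α ⊆ Ioi 0) (hαn : ∀ t, 0 ≤ α t) (R : ℝ) :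
    0 ≤ ∫ t in Ioi 0, deriv α t * coneMass Λ R W t := by
  obtain ⟨h1, h2⟩ := integral_deriv_mul_cone_nonneg hΛ hWm hQm hW0 hWB hQ H hα hαc hα0 hαn R
  rw [IntegrableOn, volume_restrict_spaceTime] at h1
  rw [volume_restrict_spaceTime, integral_prod _ h1] at h2
  simp only [integral_const_mul] at h2
  exact h2

/-- A trapezoidal α rising on [δ, 2δ] and falling on [T, T + κ] has as derivative the difference of
the two averaging kernels. -/
lemma integral_coneMass_le (hΛ : 0 ≤ Λ)
    (hWm : AEStronglyMeasurable W (volume.restrict spaceTime))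
    (hQm : AEStronglyMeasurable Q (volume.restrict spaceTime))
    (hW0 : ∀ᵐ z ∂(volume.restrict spaceTime), 0 ≤ W z)
    (hWB : ∀ᵐ z ∂(volume.restrict spaceTime), |W z| ≤ B)
    (hQ : ∀ᵐ z ∂(volume.restrict spaceTime), |Q z| ≤ Λ * W z)
    (H : ∀ K ψ, IsLipschitzTest K ψ →
      0 ≤ ∫ z in spaceTime, (fderiv ℝ ψ z (1, 0) * W z + fderiv ℝ ψ z (0, 1) * Q z))
    (R : ℝ) {δ κ T : ℝ} (hδ : 0 < δ) (hκ : 0 < κ) (hT : 2 * δ ≤ T) :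
    1 / κ * ∫ t in Ioo T (T + κ), coneMass Λ R W t
      ≤ 1 / δ * ∫ t in Ioo δ (δ + δ), coneMass Λ R W t := by
  set Y := coneMass Λ R W with hY
  have hYm := aestronglyMeasurable_coneMass hΛ R hWm
  have hYB := ae_abs_coneMass_le hΛ R hWB
  have hδ' : 0 < 1 / δ := by positivity
  have hκ' : 0 < 1 / κ := by positivity
  set α : ℝ → ℝ := fun t => ramp (1 / δ) (t - δ) - ramp (1 / κ) (t - T) with hα
  have hz1 : ∀ t, t ≤ T → ramp (1 / κ) (t - T) = 0 := fun t ht =>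
    ramp_of_nonpos hκ'.le (by linarith)
  have hz2 : ∀ t, 2 * δ ≤ t → ramp (1 / δ) (t - δ) = 1 := fun t ht => ramp_of_one_le (by
    rw [one_div, le_inv_mul_iff₀ hδ]; linarith)
  have hαL : LipschitzWith (Real.toNNReal (1 / δ) + Real.toNNReal (1 / κ)) α := by
    have l1 : ∀ c : ℝ, LipschitzWith 1 fun t : ℝ => t - c := fun c =>
      LipschitzWith.of_dist_le_mul fun s t => by simp
    have := ((lipschitzWith_ramp hδ'.le).comp (l1 δ)).sub ((lipschitzWith_ramp hκ'.le).comp (l1 T))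
    simp only [mul_one] at this
    exact this
  have hsub : tsupport α ⊆ Icc δ (T + κ) := by
    refine closure_minimal (fun t ht => ?_) isClosed_Icc
    by_contra hc
    refine ht ?_
    rw [mem_Icc, not_and_or, not_le, not_le] at hc
    rcases hc with hc | hc
    · simp only [hα]
      rw [hz1 t (by linarith), ramp_of_nonpos hδ'.le (by linarith), sub_zero]
    · simp only [hα]
      rw [hz2 t (by linarith), ramp_of_one_le, sub_self]
      rw [one_div, le_inv_mul_iff₀ hκ]; linarith
  have hαn : ∀ t, 0 ≤ α t := fun t => by
    rcases le_total t T with h | h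
    · simp only [hα]; rw [hz1 t h, sub_zero]; exact ramp_nonneg _ _
    · simp only [hα]; rw [hz2 t (by linarith)]; exact sub_nonneg.2 (ramp_le_one _ _)
  have h0 := integral_deriv_mul_coneMass_nonneg hΛ hWm hQm hW0 hWB hQ H hαL
    (isCompact_Icc.of_isClosed_subset (isClosed_tsupport _) hsub)
    (hsub.trans fun t ht => hδ.trans_le ht.1) hαn R
  have hd : ∀ᵐ t : ℝ, deriv α t * Y t = (Ioo δ (δ + δ)).indicator (fun t => 1 / δ * Y t) t
      - (Ioo T (T + κ)).indicator (fun t => 1 / κ * Y t) t := by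
    filter_upwards [Measure.ae_ne volume δ, Measure.ae_ne volume (δ + δ), Measure.ae_ne volume T,
      Measure.ae_ne volume (T + κ)] with t n1 n2 n3 n4
    have r : ∀ {c k : ℝ}, 0 < k → t ≠ c → t ≠ c + k → HasDerivAt (fun t => ramp (1 / k) (t - c))
        ((Ioo c (c + k)).indicator (fun _ => 1 / k) t) t := by
      intro c k hk m1 m2
      have g := hasDerivAt_ramp (N := 1 / k) (y := t - c) (by positivity) (sub_ne_zero.2 m1)
        (by rw [one_div_one_div]; intro h; exact m2 (by linarith))
      have g' := g.comp_sub_const t c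
      rw [one_div_one_div] at g'
      have e : (Ioo c (c + k)).indicator (fun _ => 1 / k) t
          = (Ioo 0 k).indicator (fun _ => 1 / k) (t - c) := by
        by_cases hm : t ∈ Ioo c (c + k)
        · rw [indicator_of_mem hm, indicator_of_mem (show t - c ∈ Ioo 0 k from
            ⟨by linarith [hm.1], by linarith [hm.2]⟩)]
        · rw [indicator_of_notMem hm, indicator_of_notMem fun h : t - c ∈ Ioo 0 k =>
            hm ⟨by linarith [h.1], by linarith [h.2]⟩]
      rwa [e]
    rw [((r hδ n1 n2).fun_sub (r hκ n3 n4)).deriv, sub_mul]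
    simp only [indicator_mul_left]
  have hbd : ∀ c k : ℝ, 0 ≤ c → IntegrableOn Y (Ioo c k) := fun c k hc => by
    have hs : Ioo c k ⊆ Ioi 0 := fun t ht => hc.trans_lt ht.1
    exact (integrableOn_const (C := B * (2 * (|R| + 1))) (by simp)).mono' (hYm.mono_set hs)
      (ae_restrict_of_ae_restrict_of_subset hs hYB)
  have hint : ∀ c k : ℝ, 0 ≤ c → ∀ d, Integrable ((Ioo c k).indicator fun t => d * Y t) :=
    fun c k hc d => (integrable_indicator_iff measurableSet_Ioo).2 ((hbd c k hc).const_mul d)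
  have hres : ∀ c k : ℝ, 0 ≤ c → ∀ d, ∫ t in Ioi 0, (Ioo c k).indicator (fun t => d * Y t) t
      = d * ∫ t in Ioo c k, Y t := fun c k hc d => by
    have hs : Ioo c k ⊆ Ioi 0 := fun t ht => hc.trans_lt ht.1
    rw [setIntegral_indicator measurableSet_Ioo, inter_eq_right.2 hs,
      integral_const_mul]
  rw [integral_congr_ae (ae_restrict_of_ae hd), integral_sub (hint _ _ hδ.le _).restrict
    (hint _ _ (by linarith) _).restrict, hres _ _ hδ.le, hres _ _ (by linarith)] at h0
  linarith

/-- If the averages of the localized mass over short initial intervals are asymptotically at most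
`Y₀`, then so is the localized mass at almost every time. -/
theorem ae_coneMass_le (hΛ : 0 ≤ Λ) (hB : 0 ≤ B)
    (hWm : AEStronglyMeasurable W (volume.restrict spaceTime))
    (hQm : AEStronglyMeasurable Q (volume.restrict spaceTime))
    (hW0 : ∀ᵐ z ∂(volume.restrict spaceTime), 0 ≤ W z)
    (hWB : ∀ᵐ z ∂(volume.restrict spaceTime), |W z| ≤ B)
    (hQ : ∀ᵐ z ∂(volume.restrict spaceTime), |Q z| ≤ Λ * W z)
    (H : ∀ K ψ, IsLipschitzTest K ψ →
      0 ≤ ∫ z in spaceTime, (fderiv ℝ ψ z (1, 0) * W z + fderiv ℝ ψ z (0, 1) * Q z))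
    (R : ℝ) {Y₀ : ℝ} {E : ℝ → ℝ} (hE : Tendsto E (𝓝[>] 0) (𝓝 0))
    (hEY : ∀ᶠ δ in 𝓝[>] 0, 1 / δ * ∫ t in Ioo δ (δ + δ), coneMass Λ R W t ≤ Y₀ + E δ) :
    ∀ᵐ t ∂(volume.restrict (Ioi 0)), coneMass Λ R W t ≤ Y₀ := by
  set Y := coneMass Λ R W with hY
  have hYm := aestronglyMeasurable_coneMass hΛ R hWm
  have hYB := ae_abs_coneMass_le hΛ R hWB
  set C := B * (2 * (|R| + 1)) with hC
  have hC0 : 0 ≤ C := by positivity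
  set Y' := (Ioi (0 : ℝ)).indicator Y with hY'
  have hY'm : AEStronglyMeasurable Y' volume :=
    (aestronglyMeasurable_indicator_iff measurableSet_Ioi).2 hYm
  have hY'B : ∀ᵐ s, |Y' s| ≤ C := by
    filter_upwards [(ae_restrict_iff' measurableSet_Ioi).1 hYB] with s hs
    by_cases h0 : s ∈ Ioi (0 : ℝ)
    · rw [hY', indicator_of_mem h0]; exact hs h0
    · rw [hY', indicator_of_notMem h0]; simpa
  have hY'i : LocallyIntegrable Y' := (memLp_top_of_bound hY'm C hY'B).locallyIntegrable le_top
  have hii : ∀ a b : ℝ, IntervalIntegrable Y' volume a b := fun a b =>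
    (hY'i.integrableOn_isCompact isCompact_uIcc).intervalIntegrable
  have hLip : LipschitzWith C.toNNReal fun t => ∫ s in (0 : ℝ)..t, Y' s :=
    LipschitzWith.of_dist_le_mul fun s t => by
      rw [Real.dist_eq, intervalIntegral.integral_interval_sub_left (hii _ _) (hii _ _),
        Real.coe_toNNReal _ hC0]
      exact intervalIntegral.norm_integral_le_of_norm_le_const_ae (f := Y')
        (hY'B.mono fun s hs _ => hs)
  have hpos : ∀ a b, 0 < a → a ≤ b → ∫ s in a..b, Y' s ≤ (b - a) * Y₀ := by
    intro a b ha hab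
    rcases hab.eq_or_lt with rfl | hab
    · simp
    have h1 : 1 / (b - a) * ∫ t in Ioo a (a + (b - a)), Y t ≤ Y₀ := by
      have hlim : Tendsto (fun δ => Y₀ + E δ) (𝓝[>] 0) (𝓝 Y₀) := by simpa using hE.const_add Y₀
      refine ge_of_tendsto hlim ?_
      filter_upwards [hEY, Ioo_mem_nhdsGT (half_pos ha)] with δ h2 h3
      exact (integral_coneMass_le hΛ hWm hQm hW0 hWB hQ H R h3.1 (sub_pos.2 hab)
        (by linarith [h3.2])).trans h2
    have h2 : ∫ s in a..b, Y' s = ∫ t in Ioo a (a + (b - a)), Y t := by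
      rw [intervalIntegral.integral_of_le hab.le, integral_Ioc_eq_integral_Ioo,
        add_sub_cancel]
      refine setIntegral_congr_fun measurableSet_Ioo fun t ht => ?_
      rw [hY', indicator_of_mem (show t ∈ Ioi 0 from ha.trans ht.1)]
    rw [h2]
    rwa [one_div, inv_mul_le_iff₀ (sub_pos.2 hab)] at h1
  -- Comparison with averages over [δ, 2δ] needs a > 0; the endpoint a = 0 follows by continuity of
  -- the primitive. Lebesgue differentiation then returns to the mass itself.
  have hkey : ∀ a b, 0 ≤ a → a ≤ b →
      (∫ s in (0 : ℝ)..b, Y' s) - ∫ s in (0 : ℝ)..a, Y' s ≤ ∫ s in a..b, Y₀ := by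
    intro a b ha hab
    rw [intervalIntegral.integral_const, smul_eq_mul]
    rcases ha.eq_or_lt with rfl | ha
    · rcases hab.eq_or_lt with rfl | hb
      · simp
      have hc : Tendsto (fun ε => (∫ s in (0 : ℝ)..b, Y' s) - ∫ s in (0 : ℝ)..ε, Y' s) (𝓝[>] 0)
          (𝓝 ((∫ s in (0 : ℝ)..b, Y' s) - ∫ s in (0 : ℝ)..0, Y' s)) :=
        (hLip.continuous.tendsto 0).mono_left nhdsWithin_le_nhds |>.const_sub _
      have hc' : Tendsto (fun ε : ℝ => (b - ε) * Y₀) (𝓝[>] 0) (𝓝 ((b - 0) * Y₀)) :=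
        ((continuous_const.sub continuous_id).mul continuous_const).tendsto 0 |>.mono_left
          nhdsWithin_le_nhds
      refine le_of_tendsto_of_tendsto hc hc' ?_
      filter_upwards [Ioo_mem_nhdsGT hb] with ε hε
      rw [intervalIntegral.integral_interval_sub_left (hii _ _) (hii _ _)]
      exact hpos ε b hε.1 hε.2.le
    · rw [intervalIntegral.integral_interval_sub_left (hii _ _) (hii _ _)]
      exact hpos a b ha hab
  filter_upwards [ae_deriv_le_of_integral_le hLip (locallyIntegrable_const Y₀) hkey,
    ae_restrict_of_ae (LocallyIntegrable.ae_hasDerivAt_integral hY'i),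
    ae_restrict_mem measurableSet_Ioi] with t h1 h2 h3
  rwa [(h2 0).deriv, hY', indicator_of_mem h3] at h1

end Weighted

/-! ### The weighted relative entropy -/

/-- The entropy relative to the shock `(uL, uR)` at `y = 0`, weighted by `a` on the right. -/
noncomputable def weightedEntropy (m a : ℝ) (uL uR : State) (y : ℝ) (v : State) : ℝ :=
  if y < 0 then relEntropy m v uL else a * relEntropy m v uR

/-- The flux of `weightedEntropy`. -/
noncomputable def weightedEntropyFlux (m a : ℝ) (uL uR : State) (y : ℝ) (v : State) : ℝ :=
  if y < 0 then relEntropyFlux m v uL else a * relEntropyFlux m v uR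

section Weighted

variable {m a : ℝ} {uL uR : State}

lemma weightedEntropy_of_side {y y' : ℝ} (h : y < 0 ↔ y' < 0) (v : State) :
    weightedEntropy m a uL uR y v = weightedEntropy m a uL uR y' v := by
  simp only [weightedEntropy, h]

lemma measurable_weightedEntropy :
    Measurable fun z : ℝ × State => weightedEntropy m a uL uR z.1 z.2 :=
  Measurable.ite (measurableSet_lt measurable_fst measurable_const)
    ((continuous_relEntropy m uL).measurable.comp measurable_snd)
    (((continuous_relEntropy m uR).measurable.comp measurable_snd).const_mul a)

lemma measurable_weightedEntropyFlux :
    Measurable fun z : ℝ × State => weightedEntropyFlux m a uL uR z.1 z.2 :=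
  Measurable.ite (measurableSet_lt measurable_fst measurable_const)
    ((continuous_relEntropyFlux m uL).measurable.comp measurable_snd)
    (((continuous_relEntropyFlux m uR).measurable.comp measurable_snd).const_mul a)

lemma weightedEntropy_nonneg (hm : 0 < m) (ha : 0 < a) (y : ℝ) (v : State) :
    0 ≤ weightedEntropy m a uL uR y v := by
  unfold weightedEntropy
  split_ifs
  · exact relEntropy_nonneg hm _ _
  · exact mul_nonneg ha.le (relEntropy_nonneg hm _ _)

lemma le_weightedEntropy (hm : 0 < m) (ha : 0 < a) (y : ℝ) (v : State) :
    min 1 a * (min 1 m / 2) * ‖v - shockProfile uL uR y‖ ^ 2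
      ≤ weightedEntropy m a uL uR y v := by
  have hm' : 0 < min 1 m / 2 := by positivity
  unfold weightedEntropy shockProfile
  split_ifs
  · rw [mul_assoc]
    exact (mul_le_of_le_one_left (by positivity) (min_le_left _ _)).trans (le_relEntropy _ _)
  · rw [mul_assoc]
    exact mul_le_mul (min_le_right _ _) (le_relEntropy _ _) (by positivity) ha.le

lemma weightedEntropy_le {M : ℝ} (hm : 0 < m) (hL : ‖uL‖ ≤ M) (hR : ‖uR‖ ≤ M)
    (y : ℝ) {v : State} (hv : ‖v‖ ≤ M) :
    weightedEntropy m a uL uR y v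
      ≤ max 1 a * (1 + 2 * M ^ 2 + m) * ‖v - shockProfile uL uR y‖ ^ 2 := by
  unfold weightedEntropy shockProfile
  split_ifs
  · rw [mul_assoc]
    exact (relEntropy_le hm hv hL).trans
      (le_mul_of_one_le_left (by positivity) (le_max_left _ _))
  · rw [mul_assoc]
    exact mul_le_mul (le_max_right _ _) (relEntropy_le hm hv hR) (relEntropy_nonneg hm _ _)
      (by positivity)

/-- The flux is the product of both increments with a secant slope of the stress, bounded on bounded
sets. By AM–GM the product is at most half the squared distance, which the relative entropy
controls. The constant is the opening speed of the cones used later. -/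
lemma abs_relEntropyFlux_le {M : ℝ} (hm : 0 < m) {v b : State} (hv : ‖v‖ ≤ M) (hb : ‖b‖ ≤ M) :
    |relEntropyFlux m v b| ≤ (3 * M ^ 2 + m) / min 1 m * relEntropy m v b := by
  have hmm : 0 < min 1 m := by positivity
  have hM : 0 ≤ M := (norm_nonneg v).trans hv
  have v0 := (State.abs_apply_le v 0).trans hv
  have b0 := (State.abs_apply_le b 0).trans hb
  have h1 : |v 0 ^ 2 + v 0 * b 0 + b 0 ^ 2 + m| ≤ 3 * M ^ 2 + m := by
    have e1 : |v 0 * b 0| ≤ M * M := by rw [abs_mul]; gcongr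
    have e2 : v 0 ^ 2 ≤ M ^ 2 := sq_le_sq' (abs_le.1 v0).1 (abs_le.1 v0).2
    have e3 : b 0 ^ 2 ≤ M ^ 2 := sq_le_sq' (abs_le.1 b0).1 (abs_le.1 b0).2
    have e4 := abs_le.1 e1
    have e5 := sq_nonneg (v 0)
    have e6 := sq_nonneg (b 0)
    have e7 : M * M = M ^ 2 := by ring
    refine abs_le.2 ⟨by nlinarith [sq_nonneg (v 0 + b 0)], by linarith [e4.2]⟩
  have h2 : |v 1 - b 1| * |v 0 - b 0| ≤ ‖v - b‖ ^ 2 / 2 := by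
    rw [State.norm_sq_eq, PiLp.sub_apply, PiLp.sub_apply, ← sq_abs (v 0 - b 0),
      ← sq_abs (v 1 - b 1)]
    nlinarith [sq_nonneg (|v 1 - b 1| - |v 0 - b 0|)]
  have e : relEntropyFlux m v b
      = -((v 1 - b 1) * (v 0 - b 0) * (v 0 ^ 2 + v 0 * b 0 + b 0 ^ 2 + m)) := by
    rw [relEntropyFlux_eq]; simp only [stress]; ring
  rw [e, abs_neg, abs_mul, abs_mul]
  calc |v 1 - b 1| * |v 0 - b 0| * |v 0 ^ 2 + v 0 * b 0 + b 0 ^ 2 + m|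
      ≤ (‖v - b‖ ^ 2 / 2) * (3 * M ^ 2 + m) := by gcongr
    _ = (3 * M ^ 2 + m) / min 1 m * (min 1 m / 2 * ‖v - b‖ ^ 2) := by field_simp
    _ ≤ _ := by
      gcongr
      exact le_relEntropy _ _

lemma abs_weightedEntropyFlux_le {M : ℝ} (hm : 0 < m) (ha : 0 < a) (hL : ‖uL‖ ≤ M)
    (hR : ‖uR‖ ≤ M) (y : ℝ) {v : State} (hv : ‖v‖ ≤ M) :
    |weightedEntropyFlux m a uL uR y v|
      ≤ (3 * M ^ 2 + m) / min 1 m * weightedEntropy m a uL uR y v := by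
  unfold weightedEntropyFlux weightedEntropy
  split_ifs
  · exact abs_relEntropyFlux_le hm hv hL
  · rw [abs_mul, abs_of_pos ha, mul_left_comm]
    exact mul_le_mul_of_nonneg_left (abs_relEntropyFlux_le hm hv hR) ha.le

lemma exists_lipschitz_relEntropy {V : Set State} (hV : IsCompact V) (m : ℝ) (b : State) :
    ∃ K : ℝ≥0, LipschitzOnWith K (fun v => relEntropy m v b) V := by
  have h : ContDiff ℝ 1 fun v : State => relEntropy m v b := by
    simp only [relEntropy_eq]
    fun_prop
  exact h.locallyLipschitz.locallyLipschitzOn.exists_lipschitzOnWith_of_compact hV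

lemma exists_weightedEntropy_le_add {V : Set State} (hV : IsCompact V) (ha : 0 < a) :
    ∃ C, 0 ≤ C ∧ ∀ v ∈ V, ∀ v' ∈ V, ∀ y,
      weightedEntropy m a uL uR y v ≤ weightedEntropy m a uL uR y v' + C * ‖v - v'‖ := by
  obtain ⟨K₁, h₁⟩ := exists_lipschitz_relEntropy hV m uL
  obtain ⟨K₂, h₂⟩ := exists_lipschitz_relEntropy hV m uR
  refine ⟨K₁ + a * K₂, by positivity, fun v hv v' hv' y => ?_⟩
  have g₁ := (le_abs_self _).trans (h₁.dist_le_mul v hv v' hv')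
  have g₂ := (le_abs_self _).trans (h₂.dist_le_mul v hv v' hv')
  rw [dist_eq_norm] at g₁ g₂
  have n1 : 0 ≤ (K₁ : ℝ) * ‖v - v'‖ := by positivity
  have n2 : 0 ≤ a * (K₂ * ‖v - v'‖) := by positivity
  unfold weightedEntropy
  split_ifs
  · linarith
  · have := mul_le_mul_of_nonneg_left g₂ ha.le
    linarith

end Weighted

/-! ### Initial values and decay of the weighted entropy -/

section Solutions

variable {m : ℝ} {V : Set State} {u : ℝ × ℝ → State}

/-- As u takes values in V, the distance of u₀(x) to V is at most |u(t, x) - u₀(x)|. Its integral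
does not depend on δ, yet it is bounded by averages that tend to zero. -/
lemma ae_mem_of_isInitialValue (hV : IsClosed V)
    (huV : ∀ᵐ z ∂(volume.restrict spaceTime), u z ∈ V) {u₀ : ℝ → State}
    (hI : IsInitialValue u u₀) : ∀ᵐ x, u₀ x ∈ V := by
  have hf : AEMeasurable (fun x => Metric.infEDist (u₀ x) V) volume :=
    Metric.continuous_infEDist.measurable.comp_aemeasurable hI.1.aemeasurable
  have key : ∀ n : ℕ, ∀ᵐ x ∂(volume.restrict (Ioo (-((n : ℝ) + 1)) ((n : ℝ) + 1))), u₀ x ∈ V := by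
    intro n
    set I := Ioo (-((n : ℝ) + 1)) ((n : ℝ) + 1) with hIdef
    have hle : ∀ δ > 0, ∫⁻ x in I, Metric.infEDist (u₀ x) V
        ≤ (∫⁻ z in Ioo 0 δ ×ˢ I, ‖u z - u₀ z.2‖ₑ) / ENNReal.ofReal δ := by
      intro δ hδ
      have h1 : ∫⁻ z in Ioo 0 δ ×ˢ I, Metric.infEDist (u₀ z.2) V
          = (∫⁻ x in I, Metric.infEDist (u₀ x) V) * ENNReal.ofReal δ := by
        rw [Measure.volume_eq_prod, setLIntegral_prod]
        · simp
        · exact (hf.comp_quasiMeasurePreserving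
            Measure.quasiMeasurePreserving_snd).restrict
      rw [ENNReal.le_div_iff_mul_le (by simp [hδ]) (by simp), ← h1]
      refine lintegral_mono_ae ?_
      have hsub : Ioo 0 δ ×ˢ I ⊆ spaceTime := prod_mono Ioo_subset_Ioi_self (subset_univ _)
      filter_upwards [ae_restrict_of_ae_restrict_of_subset hsub huV] with z hz
      rw [← edist_eq_enorm_sub, edist_comm]
      exact Metric.infEDist_le_edist_of_mem hz
    have h0 : ∫⁻ x in I, Metric.infEDist (u₀ x) V = 0 := by
      refine le_antisymm (ge_of_tendsto (hI.2 ((n : ℝ) + 1) (by positivity)) ?_) zero_le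
      filter_upwards [self_mem_nhdsWithin] with δ hδ using hle δ hδ
    filter_upwards [(lintegral_eq_zero_iff' hf.restrict).1 h0] with x hx
    exact (Metric.mem_iff_infEDist_zero_of_closed hV).2 hx
  have hU : (univ : Set ℝ) = ⋃ n : ℕ, Ioo (-((n : ℝ) + 1)) ((n : ℝ) + 1) := by
    refine (eq_univ_of_forall fun x => mem_iUnion.2 ?_).symm
    obtain ⟨n, hn⟩ := exists_nat_gt |x|
    exact ⟨n, abs_lt.1 (by linarith)⟩
  rw [← Measure.restrict_univ (μ := volume), hU, ae_restrict_iUnion_iff]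
  exact key

/-- The weighted relative entropy is dissipated by a curve with nonpositive dissipation. -/
lemma IsSWeak.integral_weightedEntropy_nonneg (H : IsSWeak m V u) (hV : IsCompact V) {a : ℝ}
    (ha : 0 < a) {uL uR : State} {h : ℝ → ℝ} {L : ℝ≥0} (hL : LipschitzWith L h)
    {um up : ℝ → State} (hum : HasTrace (-1) u h um) (hup : HasTrace 1 u h up)
    (humm : AEStronglyMeasurable um (volume.restrict (Ioi 0)))
    (hupm : AEStronglyMeasurable up (volume.restrict (Ioi 0)))
    (hd : ∀ᵐ t ∂(volume.restrict (Ioi 0)), dissipation m a uL uR (um t) (up t) (deriv h t) ≤ 0)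
    {K : ℝ≥0} {ψ : ℝ × ℝ → ℝ} (hψ : IsLipschitzTest K ψ) :
    0 ≤ ∫ z in spaceTime,
      (fderiv ℝ ψ z (1, 0) * weightedEntropy m a uL uR (z.2 - h z.1) (u z)
        + fderiv ℝ ψ z (0, 1) * weightedEntropyFlux m a uL uR (z.2 - h z.1) (u z)) := by
  have hb : ∀ b : State, ∃ B, (∀ v ∈ V, |relEntropy m v b| ≤ B) ∧
      ∀ v ∈ V, |relEntropyFlux m v b| ≤ B := fun b => by
    obtain ⟨B₁, hB₁⟩ := exists_bound_comp hV (continuous_relEntropy m b)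
    obtain ⟨B₂, hB₂⟩ := exists_bound_comp hV (continuous_relEntropyFlux m b)
    exact ⟨max B₁ B₂, fun v hv => (hB₁ v hv).trans (le_max_left _ _),
      fun v hv => (hB₂ v hv).trans (le_max_right _ _)⟩
  obtain ⟨BL, hL1, hL2⟩ := hb uL
  obtain ⟨BR, hR1, hR2⟩ := hb uR
  have meas : ∀ {G : State → ℝ}, Continuous G →
      AEStronglyMeasurable (fun z => G (u z)) (volume.restrict spaceTime) := fun hG =>
    hG.comp_aestronglyMeasurable H.aestronglyMeasurable
  have bd : ∀ {G : State → ℝ} {B : ℝ}, (∀ v ∈ V, |G v| ≤ B) →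
      ∀ᵐ z ∂(volume.restrict spaceTime), |G (u z)| ≤ B := fun hG =>
    H.mem_stateSpace.mono fun z hz => hG (u z) hz
  have hl := (H.isSubPair_relEntropy hV uL).trace (meas (continuous_relEntropy m uL))
    (meas (continuous_relEntropyFlux m uL)) (bd hL1) (bd hL2) hL (e := -1) (by simp)
    (hum.comp (G := fun v => relEntropy m v uL) (continuous_relEntropy m uL))
    (hum.comp (G := fun v => relEntropyFlux m v uL) (continuous_relEntropyFlux m uL)) hψ
  have hr := (H.isSubPair_relEntropy hV uR).trace (meas (continuous_relEntropy m uR))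
    (meas (continuous_relEntropyFlux m uR)) (bd hR1) (bd hR2) hL (e := 1) (by simp)
    (hup.comp (G := fun v => relEntropy m v uR) (continuous_relEntropy m uR))
    (hup.comp (G := fun v => relEntropyFlux m v uR) (continuous_relEntropyFlux m uR)) hψ
  have il := hum.integrable_flux (by norm_num) hL hV.isClosed H.mem_stateSpace humm hL1 hL2
    (continuous_relEntropy m uL) (continuous_relEntropyFlux m uL) hψ
  have ir := hup.integrable_flux one_ne_zero hL hV.isClosed H.mem_stateSpace hupm hR1 hR2
    (continuous_relEntropy m uR) (continuous_relEntropyFlux m uR) hψ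
  have xl : IntegrableOn (fun z => fderiv ℝ ψ z (1, 0) * relEntropy m (u z) uL
      + fderiv ℝ ψ z (0, 1) * relEntropyFlux m (u z) uL) spaceTime :=
    (integrable_fderiv_smul hψ.lipschitz hψ.compact (meas (continuous_relEntropy m uL))
      (bd hL1) _).add (integrable_fderiv_smul hψ.lipschitz hψ.compact
      (meas (continuous_relEntropyFlux m uL)) (bd hL2) _)
  have xr : IntegrableOn (fun z => fderiv ℝ ψ z (1, 0) * relEntropy m (u z) uR
      + fderiv ℝ ψ z (0, 1) * relEntropyFlux m (u z) uR) spaceTime :=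
    (integrable_fderiv_smul hψ.lipschitz hψ.compact (meas (continuous_relEntropy m uR))
      (bd hR1) _).add (integrable_fderiv_smul hψ.lipschitz hψ.compact
      (meas (continuous_relEntropyFlux m uR)) (bd hR2) _)
  have hms : ∀ e : ℝ, MeasurableSet {z : ℝ × ℝ | 0 < e * (z.2 - h z.1)} := fun e => by
    have := hL.continuous.measurable
    exact measurableSet_lt measurable_const (by fun_prop)
  -- The two trace terms combine into minus the dissipation, integrated against ψ along the curve.
  have hdis : (∫ t in Ioi 0, ψ (t, h t) *
      (relEntropyFlux m (um t) uL - deriv h t * relEntropy m (um t) uL))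
      - a * (∫ t in Ioi 0, ψ (t, h t) *
      (relEntropyFlux m (up t) uR - deriv h t * relEntropy m (up t) uR)) ≥ 0 := by
    rw [← integral_const_mul, ← integral_sub il (ir.const_mul a)]
    refine integral_nonneg_of_ae (hd.mono fun t ht => ?_)
    have h1 := mul_nonneg (hψ.nonneg (t, h t)) (neg_nonneg.2 ht)
    simp only [dissipation] at h1
    simp only [Pi.zero_apply]
    linarith
  have hsum := integral_add (xl.indicator (hms (-1))) ((xr.indicator (hms 1)).const_mul a)
  rw [integral_const_mul] at hsum
  have hfin : ∫ z in spaceTime,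
      (fderiv ℝ ψ z (1, 0) * weightedEntropy m a uL uR (z.2 - h z.1) (u z)
        + fderiv ℝ ψ z (0, 1) * weightedEntropyFlux m a uL uR (z.2 - h z.1) (u z))
      = (∫ z in spaceTime, {z : ℝ × ℝ | 0 < -1 * (z.2 - h z.1)}.indicator
          (fun z => fderiv ℝ ψ z (1, 0) * relEntropy m (u z) uL
            + fderiv ℝ ψ z (0, 1) * relEntropyFlux m (u z) uL) z)
        + a * ∫ z in spaceTime, {z : ℝ × ℝ | 0 < 1 * (z.2 - h z.1)}.indicator
          (fun z => fderiv ℝ ψ z (1, 0) * relEntropy m (u z) uR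
            + fderiv ℝ ψ z (0, 1) * relEntropyFlux m (u z) uR) z := by
    rw [← hsum]
    refine integral_congr_ae (ae_restrict_of_ae ?_)
    filter_upwards [ae_ne_graph hL.continuous.measurable one_ne_zero 0] with z hz
    rw [one_mul] at hz
    rcases lt_or_gt_of_ne hz with h1 | h1
    · rw [indicator_of_mem (show z ∈ {z : ℝ × ℝ | 0 < -1 * (z.2 - h z.1)} by
          rw [mem_ofPred_eq]; linarith),
        indicator_of_notMem (show z ∉ {z : ℝ × ℝ | 0 < 1 * (z.2 - h z.1)} by
          rw [mem_ofPred_eq]; linarith), weightedEntropy, weightedEntropyFlux, if_pos h1,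
        if_pos h1]
      ring
    · rw [indicator_of_notMem (show z ∉ {z : ℝ × ℝ | 0 < -1 * (z.2 - h z.1)} by
          rw [mem_ofPred_eq]; linarith),
        indicator_of_mem (show z ∈ {z : ℝ × ℝ | 0 < 1 * (z.2 - h z.1)} by
          rw [mem_ofPred_eq]; linarith), weightedEntropy, weightedEntropyFlux, if_neg h1.not_gt,
        if_neg h1.not_gt]
      ring
  rw [hfin]
  have := mul_nonneg ha.le hr
  linarith

end Solutions

/-! ### The initial layer and removal of the cutoff -/

section Layer

variable {m a B C Λ : ℝ} {uL uR : State} {V : Set State}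

lemma aestronglyMeasurable_weightedEntropy {X : Type*} [MeasurableSpace X] {μ : Measure X}
    {y : X → ℝ} (hy : AEMeasurable y μ) {g : X → State} (hg : AEStronglyMeasurable g μ) :
    AEStronglyMeasurable (fun x => weightedEntropy m a uL uR (y x) (g x)) μ :=
  (measurable_weightedEntropy.comp_aemeasurable (hy.prodMk hg.aemeasurable)).aestronglyMeasurable

lemma aestronglyMeasurable_weightedEntropyFlux {X : Type*} [MeasurableSpace X] {μ : Measure X}
    {y : X → ℝ} (hy : AEMeasurable y μ) {g : X → State} (hg : AEStronglyMeasurable g μ) :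
    AEStronglyMeasurable (fun x => weightedEntropyFlux m a uL uR (y x) (g x)) μ :=
  (measurable_weightedEntropyFlux.comp_aemeasurable
    (hy.prodMk hg.aemeasurable)).aestronglyMeasurable

/-- Moving the interface from 0 to s changes the side of x only when |x| ≤ r, which costs at most
2rB. Elsewhere the weighted entropy varies in the state by at most C|g - g₀|. -/
lemma integral_coneCutoff_weightedEntropy_le (hm : 0 < m) (ha : 0 < a) (hΛ : 0 ≤ Λ)
    (hB : ∀ v ∈ V, ∀ y, |weightedEntropy m a uL uR y v| ≤ B) (hC0 : 0 ≤ C)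
    (hC : ∀ v ∈ V, ∀ v' ∈ V, ∀ y,
      weightedEntropy m a uL uR y v ≤ weightedEntropy m a uL uR y v' + C * ‖v - v'‖)
    {R t s r : ℝ} (ht : 0 ≤ t) (hs : |s| ≤ r) {g g₀ : ℝ → State}
    (hg₀m : AEStronglyMeasurable g₀) (hg : ∀ᵐ x, g x ∈ V) (hg₀ : ∀ᵐ x, g₀ x ∈ V) {I : Set ℝ}
    (hI : MeasurableSet I) (hRI : Icc (-(|R| + 1)) (|R| + 1) ⊆ I)
    (hgi : IntegrableOn (fun x => ‖g x - g₀ x‖) I) :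
    ∫ x, coneCutoff Λ R (t, x) * weightedEntropy m a uL uR (x - s) (g x)
      ≤ (∫ x, coneCutoff Λ R (0, x) * weightedEntropy m a uL uR x (g₀ x))
        + C * (∫ x in I, ‖g x - g₀ x‖) + B * (2 * r) := by
  have hr : 0 ≤ r := (abs_nonneg s).trans hs
  have i1 : Integrable fun x => coneCutoff Λ R (0, x) * weightedEntropy m a uL uR x (g₀ x) :=
    integrable_coneCutoff_mul hΛ R le_rfl
      (aestronglyMeasurable_weightedEntropy aemeasurable_id hg₀m) (hg₀.mono fun x hx => hB _ hx _)
  have i2 := ((integrable_indicator_iff hI).2 hgi).const_mul C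
  have i3 := integrable_indicator_Icc (-r) r B
  have e2 : C * (∫ x in I, ‖g x - g₀ x‖)
      = ∫ x, C * I.indicator (fun x => ‖g x - g₀ x‖) x := by
    rw [integral_const_mul, integral_indicator hI]
  have e3 : B * (2 * r) = ∫ x, (Icc (-r) r).indicator (fun _ => B) x := by
    rw [integral_indicator measurableSet_Icc, setIntegral_const, Real.volume_real_Icc_of_le
      (by linarith), smul_eq_mul]
    ring
  have e4 := integral_add (i1.add i2) i3
  simp only [Pi.add_apply] at e4
  rw [e2, e3, ← integral_add i1 i2, ← e4]
  refine integral_mono_of_nonneg (.of_forall fun x => mul_nonneg (coneCutoff_nonneg _ _ _)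
    (weightedEntropy_nonneg hm ha _ _)) ((i1.add i2).add i3) ?_
  filter_upwards [hg, hg₀] with x h1 h2
  have p1 : 0 ≤ coneCutoff Λ R (0, x) * weightedEntropy m a uL uR x (g₀ x) :=
    mul_nonneg (coneCutoff_nonneg _ _ _) (weightedEntropy_nonneg hm ha _ _)
  have p2 : 0 ≤ C * I.indicator (fun x => ‖g x - g₀ x‖) x :=
    mul_nonneg hC0 (indicator_nonneg (fun x _ => norm_nonneg _) x)
  have hB0 : 0 ≤ B := (abs_nonneg _).trans (hB _ h1 0)
  have p3 : 0 ≤ (Icc (-r) r).indicator (fun _ => B) x := indicator_nonneg (fun x _ => hB0) x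
  have q0 := coneCutoff_nonneg Λ R (t, x)
  have q1 := coneCutoff_le_one Λ R (t, x)
  by_cases hx : x ∈ Icc (-(|R| + 1)) (|R| + 1)
  · by_cases hxr : x ∈ Icc (-r) r
    · rw [indicator_of_mem hxr]
      have := mul_le_mul q1 ((le_abs_self _).trans (hB _ h1 (x - s)))
        (weightedEntropy_nonneg hm ha _ _) zero_le_one
      linarith
    · rw [indicator_of_mem (hRI hx)]
      have hside : x - s < 0 ↔ x < 0 := by
        have hs' := abs_le.1 hs
        rw [mem_Icc, not_and_or, not_le, not_le] at hxr
        rcases hxr with h | h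
        · exact ⟨fun _ => by linarith, fun _ => by linarith [hs'.1]⟩
        · exact ⟨fun _ => by linarith [hs'.2], fun _ => by linarith⟩
      rw [weightedEntropy_of_side hside]
      have h3 := mul_le_mul_of_nonneg_left (hC _ h1 _ h2 x) q0
      have h4 : coneCutoff Λ R (t, x) ≤ coneCutoff Λ R (0, x) := by
        have := coneCutoff_antitone_line (Λ := Λ) (R := R) (ξ := 0) (by simpa) (0, x) ht
        simpa using this
      have h5 := mul_le_mul_of_nonneg_right h4
        (weightedEntropy_nonneg (uL := uL) (uR := uR) hm ha x (g₀ x))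
      have h6 : coneCutoff Λ R (t, x) * (C * ‖g x - g₀ x‖) ≤ C * ‖g x - g₀ x‖ :=
        mul_le_of_le_one_left (by positivity) q1
      linarith
  · have h3 := abs_coneCutoff_mul_le hΛ R ht (x := x) (hB _ h1 (x - s))
    rw [indicator_of_notMem hx] at h3
    have := (le_abs_self _).trans h3
    linarith

/-- The localized weighted entropy is controlled by its initial value for short times. -/
lemma exists_average_coneMass_le (hm : 0 < m) (ha : 0 < a) (hΛ : 0 ≤ Λ) (hV : IsCompact V)
    (hB : ∀ v ∈ V, ∀ y, |weightedEntropy m a uL uR y v| ≤ B) {u : ℝ × ℝ → State}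
    (hu : AEStronglyMeasurable u (volume.restrict spaceTime))
    (huV : ∀ᵐ z ∂(volume.restrict spaceTime), u z ∈ V) {u₀ : ℝ → State}
    (hI : IsInitialValue u u₀) {h : ℝ → ℝ} {L : ℝ≥0} (hL : LipschitzWith L h) (h0 : h 0 = 0)
    (R : ℝ) :
    ∃ E : ℝ → ℝ, Tendsto E (𝓝[>] 0) (𝓝 0) ∧ ∀ᶠ δ in 𝓝[>] 0,
      1 / δ * ∫ t in Ioo δ (δ + δ),
        coneMass Λ R (fun z => weightedEntropy m a uL uR (z.2 - h z.1) (u z)) t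
      ≤ (∫ x, coneCutoff Λ R (0, x) * weightedEntropy m a uL uR x (u₀ x)) + E δ := by
  obtain ⟨C, hC0, hC⟩ := exists_weightedEntropy_le_add (m := m) (uL := uL) (uR := uR) hV ha
  obtain ⟨M, hM⟩ := hV.isBounded.exists_norm_le
  have hu₀V := ae_mem_of_isInitialValue hV.isClosed huV hI
  set Y₀ := ∫ x, coneCutoff Λ R (0, x) * weightedEntropy m a uL uR x (u₀ x) with hY₀
  set I := Ioo (-(|R| + 2)) (|R| + 2) with hIdef
  have hRI : Icc (-(|R| + 1)) (|R| + 1) ⊆ I := fun x hx =>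
    ⟨by linarith [hx.1], by linarith [hx.2]⟩
  set F : ℝ × ℝ → State := fun z => u z - u₀ z.2 with hF
  set J : ℝ → ℝ := fun τ =>
    ((∫⁻ z in Ioo 0 τ ×ˢ I, ‖F z‖ₑ) / ENNReal.ofReal τ).toReal with hJ
  have hJlim : Tendsto J (𝓝[>] 0) (𝓝 0) := by
    have := (ENNReal.tendsto_toReal ENNReal.zero_ne_top).comp
      (hI.2 (|R| + 2) (by positivity))
    rw [ENNReal.toReal_zero] at this
    exact this
  have hJlim2 : Tendsto (fun δ => J (δ + δ)) (𝓝[>] 0) (𝓝 0) := by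
    refine hJlim.comp (tendsto_nhdsWithin_iff.2 ⟨?_, ?_⟩)
    · have : Tendsto (fun δ : ℝ => δ + δ) (𝓝 0) (𝓝 (0 + 0)) :=
        (continuous_id.add continuous_id).tendsto 0
      rw [add_zero] at this
      exact this.mono_left nhdsWithin_le_nhds
    · filter_upwards [self_mem_nhdsWithin] with δ hδ
      have : 0 < δ := hδ
      exact mem_Ioi.2 (by linarith)
  have hFm : AEStronglyMeasurable F (volume.restrict spaceTime) := by
    have h1 : AEStronglyMeasurable (fun z : ℝ × ℝ => u₀ z.2) volume := hI.1.comp_snd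
    exact hu.sub h1.restrict
  have hFB : ∀ᵐ z ∂(volume.restrict spaceTime), ‖F z‖ ≤ M + M := by
    have h1 : ∀ᵐ z : ℝ × ℝ, u₀ z.2 ∈ V := Measure.quasiMeasurePreserving_snd.ae hu₀V
    filter_upwards [huV, ae_restrict_of_ae h1] with z g1 g2
    exact (norm_sub_le _ _).trans (add_le_add (hM _ g1) (hM _ g2))
  have hFi : ∀ τ : ℝ, Integrable (fun z => ‖F z‖)
      ((volume.restrict (Ioo 0 τ)).prod (volume.restrict I)) := fun τ => by
    have hsub : Ioo 0 τ ×ˢ I ⊆ spaceTime := prod_mono Ioo_subset_Ioi_self (subset_univ _)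
    rw [Measure.prod_restrict, ← Measure.volume_eq_prod]
    refine Integrable.mono' (g := fun _ => M + M) (integrableOn_const ?_)
      (hFm.mono_set hsub).norm
      ((ae_restrict_of_ae_restrict_of_subset hsub hFB).mono fun z hz => by rwa [norm_norm])
    rw [Measure.volume_eq_prod, Measure.prod_prod]
    exact ENNReal.mul_ne_top (by simp) (by simp [hIdef])
  have hFint : ∀ τ > 0, ∫ t in Ioo 0 τ, ∫ x in I, ‖F (t, x)‖ = τ * J τ := fun τ hτ => by
    have hsub : Ioo 0 τ ×ˢ I ⊆ spaceTime := prod_mono Ioo_subset_Ioi_self (subset_univ _)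
    rw [← integral_prod _ (hFi τ), Measure.prod_restrict, ← Measure.volume_eq_prod,
      integral_norm_eq_lintegral_enorm (hFm.mono_set hsub), hJ]
    simp only
    rw [ENNReal.toReal_div, ENNReal.toReal_ofReal hτ.le]
    field_simp
  have huV' := huV
  rw [volume_restrict_spaceTime] at huV'
  -- The first error is the mean deviation from the initial value over (0, 2δ); passing to the
  -- average over (δ, 2δ) costs the factor 2. The second comes from the shift, which has moved by at
  -- most 2Lδ.
  refine ⟨fun δ => C * (2 * J (δ + δ)) + B * (2 * (L * (δ + δ))), ?_, ?_⟩
  · have h2 : Tendsto (fun δ : ℝ => B * (2 * (L * (δ + δ)))) (𝓝[>] 0) (𝓝 0) := by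
      have : Continuous fun δ : ℝ => B * (2 * (L * (δ + δ))) := by fun_prop
      have := this.tendsto 0
      simp only [add_zero, mul_zero] at this
      exact this.mono_left nhdsWithin_le_nhds
    simpa using ((hJlim2.const_mul 2).const_mul C).add h2
  filter_upwards [self_mem_nhdsWithin] with δ hδ'
  have hδ : 0 < δ := hδ'
  have hsub : Ioo δ (δ + δ) ⊆ Ioo 0 (δ + δ) := Ioo_subset_Ioo_left hδ.le
  have hDi : IntegrableOn (fun t => ∫ x in I, ‖F (t, x)‖) (Ioo 0 (δ + δ)) :=
    (hFi (δ + δ)).integral_prod_left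
  have hpt : ∀ᵐ t ∂(volume.restrict (Ioo δ (δ + δ))),
      coneMass Λ R (fun z => weightedEntropy m a uL uR (z.2 - h z.1) (u z)) t
        ≤ (Y₀ + B * (2 * (L * (δ + δ)))) + C * ∫ x in I, ‖F (t, x)‖ := by
    filter_upwards [ae_restrict_of_ae_restrict_of_subset (hsub.trans Ioo_subset_Ioi_self)
      (Measure.ae_ae_of_ae_prod huV'), ae_restrict_of_ae_restrict_of_subset hsub
      (hFi (δ + δ)).prod_right_ae, ae_restrict_mem measurableSet_Ioo] with t g1 g2 g3
    have ht : 0 ≤ t := hδ.le.trans g3.1.le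
    have hh : |h t| ≤ L * (δ + δ) := by
      have h1 := hL.dist_le_mul t 0
      rw [h0, dist_zero_right, dist_zero_right, Real.norm_eq_abs, Real.norm_eq_abs,
        abs_of_nonneg ht] at h1
      exact h1.trans (mul_le_mul_of_nonneg_left g3.2.le L.coe_nonneg)
    have := integral_coneCutoff_weightedEntropy_le hm ha hΛ hB hC0 hC (R := R) ht hh hI.1 g1 hu₀V
      measurableSet_Ioo hRI g2
    unfold coneMass
    simp only [hF]
    linarith
  have ic : Integrable (fun _ => Y₀ + B * (2 * (L * (δ + δ)))) (volume.restrict (Ioo δ (δ + δ))) :=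
    integrableOn_const (by simp)
  have iD := (hDi.mono_set hsub).const_mul C
  have hmono : ∫ t in Ioo δ (δ + δ),
      coneMass Λ R (fun z => weightedEntropy m a uL uR (z.2 - h z.1) (u z)) t
      ≤ ∫ t in Ioo δ (δ + δ), ((Y₀ + B * (2 * (L * (δ + δ)))) + C * ∫ x in I, ‖F (t, x)‖) :=
    integral_mono_of_nonneg (.of_forall fun t => integral_nonneg fun x =>
      mul_nonneg (coneCutoff_nonneg _ _ _) (weightedEntropy_nonneg hm ha _ _)) (ic.add iD) hpt
  have hD : ∫ t in Ioo δ (δ + δ), ∫ x in I, ‖F (t, x)‖ ≤ (δ + δ) * J (δ + δ) := by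
    rw [← hFint (δ + δ) (by linarith)]
    exact setIntegral_mono_set hDi (.of_forall fun t => integral_nonneg fun x => norm_nonneg _)
      hsub.eventuallyLE
  rw [integral_add ic iD, integral_const_mul, setIntegral_const, Real.volume_real_Ioo_of_le (by linarith),
    add_sub_cancel_right, smul_eq_mul] at hmono
  rw [one_div, inv_mul_le_iff₀ hδ]
  have := mul_le_mul_of_nonneg_left hD hC0
  linarith

/-- Fatou's lemma removes the cutoff on the left. It also makes the bound meaningful when the
right-hand side is infinite. -/
lemma lintegral_le_of_coneCutoff (hΛ : 0 ≤ Λ) {t : ℝ} (ht : 0 ≤ t) {f f₀ : ℝ → ℝ}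
    (hfm : AEStronglyMeasurable f) (hf₀m : AEStronglyMeasurable f₀) (hf : ∀ᵐ x, |f x| ≤ B)
    (hf₀ : ∀ᵐ x, |f₀ x| ≤ B) (hf0 : ∀ x, 0 ≤ f x) (hf₀0 : ∀ x, 0 ≤ f₀ x)
    (H : ∀ n : ℕ, ∫ x, coneCutoff Λ n (t, x) * f x ≤ ∫ x, coneCutoff Λ n (0, x) * f₀ x) :
    ∫⁻ x, ENNReal.ofReal (f x) ≤ ∫⁻ x, ENNReal.ofReal (f₀ x) := by
  have i1 : ∀ n : ℕ, Integrable fun x => coneCutoff Λ n (t, x) * f x := fun n =>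
    integrable_coneCutoff_mul hΛ n ht hfm hf
  have i2 : ∀ n : ℕ, Integrable fun x => coneCutoff Λ n (0, x) * f₀ x := fun n =>
    integrable_coneCutoff_mul hΛ n le_rfl hf₀m hf₀
  have hle : ∀ n : ℕ, ∫⁻ x, ENNReal.ofReal (coneCutoff Λ n (t, x) * f x)
      ≤ ∫⁻ x, ENNReal.ofReal (f₀ x) := fun n => by
    calc ∫⁻ x, ENNReal.ofReal (coneCutoff Λ n (t, x) * f x)
        = ENNReal.ofReal (∫ x, coneCutoff Λ n (t, x) * f x) :=
          (ofReal_integral_eq_lintegral_ofReal (i1 n)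
            (.of_forall fun x => mul_nonneg (coneCutoff_nonneg _ _ _) (hf0 x))).symm
      _ ≤ ENNReal.ofReal (∫ x, coneCutoff Λ n (0, x) * f₀ x) := ENNReal.ofReal_le_ofReal (H n)
      _ = ∫⁻ x, ENNReal.ofReal (coneCutoff Λ n (0, x) * f₀ x) :=
          ofReal_integral_eq_lintegral_ofReal (i2 n)
            (.of_forall fun x => mul_nonneg (coneCutoff_nonneg _ _ _) (hf₀0 x))
      _ ≤ _ := lintegral_mono fun x => ENNReal.ofReal_le_ofReal
          (mul_le_of_le_one_left (hf₀0 x) (coneCutoff_le_one _ _ _))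
  have hlim : ∀ x, liminf (fun n : ℕ => ENNReal.ofReal (coneCutoff Λ n (t, x) * f x)) atTop
      = ENNReal.ofReal (f x) := fun x => by
    refine (tendsto_const_nhds.congr' ?_).liminf_eq
    filter_upwards [tendsto_natCast_atTop_atTop.eventually_ge_atTop (|x| + Λ * t)] with n hn
    rw [coneCutoff_eq_one hn, one_mul]
  calc ∫⁻ x, ENNReal.ofReal (f x)
      = ∫⁻ x, liminf (fun n : ℕ => ENNReal.ofReal (coneCutoff Λ n (t, x) * f x)) atTop := by
        simp only [hlim]
    _ ≤ liminf (fun n : ℕ => ∫⁻ x, ENNReal.ofReal (coneCutoff Λ n (t, x) * f x)) atTop :=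
        lintegral_liminf_le' fun n => (i1 n).aestronglyMeasurable.aemeasurable.ennreal_ofReal
    _ ≤ _ := liminf_le_of_frequently_le' (.of_forall hle)

end Layer

/-! ### From weighted entropy to L² stability -/

lemma eLpNorm_two_sq {X E : Type*} [MeasurableSpace X] [NormedAddCommGroup E] (f : X → E)
    (μ : Measure X) : eLpNorm f 2 μ ^ 2 = ∫⁻ x, ENNReal.ofReal (‖f x‖ ^ 2) ∂μ := by
  have := eLpNorm_nnreal_pow_eq_lintegral (f := f) (μ := μ) (p := 2) two_ne_zero
  simp only [NNReal.coe_ofNat, ENNReal.coe_ofNat, ENNReal.rpow_ofNat] at this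
  rw [this]
  refine lintegral_congr fun x => ?_
  rw [ENNReal.ofReal_pow (norm_nonneg _), ofReal_norm]

lemma eLpNorm_two_le_of_lintegral_le {f g : ℝ → State} {φ γ : ℝ → ℝ} {c₁ c₂ : ℝ} (hc₁ : 0 < c₁)
    (hc₂ : 0 ≤ c₂) (hf : ∀ᵐ x, c₁ * ‖f x‖ ^ 2 ≤ φ x) (hg : ∀ᵐ x, γ x ≤ c₂ * ‖g x‖ ^ 2)
    (h : ∫⁻ x, ENNReal.ofReal (φ x) ≤ ∫⁻ x, ENNReal.ofReal (γ x)) :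
    eLpNorm f 2 volume ≤ ENNReal.ofReal √(c₂ / c₁) * eLpNorm g 2 volume := by
  rw [← ENNReal.pow_le_pow_left_iff two_ne_zero, mul_pow, eLpNorm_two_sq, eLpNorm_two_sq,
    ← ENNReal.ofReal_pow (Real.sqrt_nonneg _), Real.sq_sqrt (by positivity)]
  have h1 : ENNReal.ofReal c₁ * ∫⁻ x, ENNReal.ofReal (‖f x‖ ^ 2)
      ≤ ENNReal.ofReal c₂ * ∫⁻ x, ENNReal.ofReal (‖g x‖ ^ 2) := by
    rw [← lintegral_const_mul' _ _ ENNReal.ofReal_ne_top,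
      ← lintegral_const_mul' _ _ ENNReal.ofReal_ne_top]
    refine (lintegral_mono_ae ?_).trans (h.trans (lintegral_mono_ae ?_))
    · filter_upwards [hf] with x hx
      rw [← ENNReal.ofReal_mul hc₁.le]
      exact ENNReal.ofReal_le_ofReal hx
    · filter_upwards [hg] with x hx
      rw [← ENNReal.ofReal_mul hc₂]
      exact ENNReal.ofReal_le_ofReal hx
  have hc : ENNReal.ofReal c₁ ≠ 0 := by simpa using hc₁
  rw [ENNReal.ofReal_div_of_pos hc₁, ENNReal.mul_comm_div, ← mul_div_assoc,
    ENNReal.le_div_iff_mul_le (.inl hc) (.inl ENNReal.ofReal_ne_top), mul_comm]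
  simpa [mul_comm] using h1

/-- Admissible velocities yield stability up to a shift, with a uniform constant. -/
theorem exists_isStableUpToShift {m : ℝ} (hm : 0 < m) {V : Set State} (hV : IsCompact V) {a : ℝ}
    (ha : 0 < a) :
    ∃ C > 0, ∀ uL ∈ V, ∀ uR ∈ V, ∀ Λ : State → ℝ, Continuous Λ →
      IsAdmissibleVelocity m V a uL uR Λ → IsStableUpToShift m V a C uL uR := by
  obtain ⟨M, hM⟩ := hV.isBounded.exists_norm_le
  set c₁ := min 1 a * (min 1 m / 2) with hc₁
  set c₂ := max 1 a * (1 + 2 * M ^ 2 + m) with hc₂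
  have hc₁0 : 0 < c₁ := by positivity
  have hc₂0 : 0 < c₂ := by positivity
  -- The constant compares the upper and lower quadratic bounds of the weighted entropy; it involves
  -- m, M and a but not the shock.
  refine ⟨√(c₂ / c₁), by positivity, fun uL huL uR huR Λ hΛ hadm u H => ?_⟩
  obtain ⟨h, L, hL, h0, hh⟩ := exists_shift hV H.aestronglyMeasurable H.mem_stateSpace hΛ
  have hhm : Measurable h := hL.continuous.measurable
  have hcurve : IsLipschitzCurve h := ⟨L, hL.lipschitzOnWith⟩
  obtain ⟨um, up, htr⟩ := H.strongTraces h hcurve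
  obtain ⟨tp, tm⟩ := htr.hasTrace H.aestronglyMeasurable hhm
  have mm := htr.1.aestronglyMeasurable
  have mp := htr.2.1.aestronglyMeasurable
  have hd : ∀ᵐ t ∂(volume.restrict (Ioi 0)),
      dissipation m a uL uR (um t) (up t) (deriv h t) ≤ 0 := by
    filter_upwards [hh um up tm tp mm mp, H.rankineHugoniot hV hL tm tp mm mp,
      H.lax h um up hcurve htr,
      tm.mem_of_isClosed (by norm_num) hhm hV.isClosed H.mem_stateSpace,
      tp.mem_of_isClosed one_ne_zero hhm hV.isClosed H.mem_stateSpace] with t g1 g2 g3 g4 g5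
    exact hadm _ g4 _ g5 _ g1.1 g1.2 fun hne => ⟨g2, g3 hne⟩
  refine ⟨h, hcurve, h0, ⟨um, up, htr, hd⟩, fun u₀ hI => ?_⟩
  have hu₀V := ae_mem_of_isInitialValue hV.isClosed H.mem_stateSpace hI
  set Λ₀ := (3 * M ^ 2 + m) / min 1 m with hΛ₀
  have hΛ₀0 : 0 ≤ Λ₀ := by positivity
  have hM0 : 0 ≤ M := (norm_nonneg _).trans (hM _ huL)
  set B := c₂ * (2 * M) ^ 2 with hBdef
  have hup : ∀ v ∈ V, ∀ y, weightedEntropy m a uL uR y v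
      ≤ c₂ * ‖v - shockProfile uL uR y‖ ^ 2 := fun v hv y =>
    weightedEntropy_le hm (hM _ huL) (hM _ huR) y (hM _ hv)
  have hB : ∀ v ∈ V, ∀ y, |weightedEntropy m a uL uR y v| ≤ B := fun v hv y => by
    rw [abs_of_nonneg (weightedEntropy_nonneg hm ha _ _)]
    refine (hup v hv y).trans ?_
    have : ‖shockProfile uL uR y‖ ≤ M := by
      unfold shockProfile; split_ifs
      exacts [hM _ huL, hM _ huR]
    have h2 : ‖v - shockProfile uL uR y‖ ≤ 2 * M :=
      (norm_sub_le _ _).trans (by linarith [hM _ hv])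
    rw [hBdef]
    gcongr
  set W : ℝ × ℝ → ℝ := fun z => weightedEntropy m a uL uR (z.2 - h z.1) (u z) with hW
  have hside : AEMeasurable (fun z : ℝ × ℝ => z.2 - h z.1) (volume.restrict spaceTime) := by
    have : Measurable fun z : ℝ × ℝ => z.2 - h z.1 := by fun_prop
    exact this.aemeasurable
  -- Integer radii keep the exceptional set of times null.
  have hmass : ∀ᵐ t ∂(volume.restrict (Ioi 0)), ∀ n : ℕ, coneMass Λ₀ n W t
      ≤ ∫ x, coneCutoff Λ₀ n (0, x) * weightedEntropy m a uL uR x (u₀ x) := by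
    rw [ae_all_iff]
    intro n
    obtain ⟨E, hE, hEY⟩ := exists_average_coneMass_le hm ha hΛ₀0 hV hB H.aestronglyMeasurable
      H.mem_stateSpace hI hL h0 n
    refine ae_coneMass_le (B := B)
      (Q := fun z => weightedEntropyFlux m a uL uR (z.2 - h z.1) (u z)) hΛ₀0 (by positivity)
      (aestronglyMeasurable_weightedEntropy hside H.aestronglyMeasurable)
      (aestronglyMeasurable_weightedEntropyFlux hside H.aestronglyMeasurable)
      (.of_forall fun z => weightedEntropy_nonneg hm ha _ _)
      (H.mem_stateSpace.mono fun z hz => hB _ hz _)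
      (H.mem_stateSpace.mono fun z hz =>
        abs_weightedEntropyFlux_le hm ha (hM _ huL) (hM _ huR) _ (hM _ hz))
      (fun K ψ hψ => H.integral_weightedEntropy_nonneg hV ha hL tm tp mm mp hd hψ) n hE hEY
  have hum := H.aestronglyMeasurable
  have huV := H.mem_stateSpace
  rw [volume_restrict_spaceTime] at hum huV
  filter_upwards [hmass, hum.prodMk_left, Measure.ae_ae_of_ae_prod huV,
    ae_restrict_mem measurableSet_Ioi] with t g1 g2 g3 g4
  have ht : 0 ≤ t := le_of_lt g4
  have key := lintegral_le_of_coneCutoff hΛ₀0 ht (B := B)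
    (f := fun x => weightedEntropy m a uL uR (x - h t) (u (t, x)))
    (f₀ := fun x => weightedEntropy m a uL uR x (u₀ x))
    (aestronglyMeasurable_weightedEntropy (by fun_prop) g2)
    (aestronglyMeasurable_weightedEntropy aemeasurable_id hI.1)
    (g3.mono fun x hx => hB _ hx _) (hu₀V.mono fun x hx => hB _ hx _)
    (fun x => weightedEntropy_nonneg hm ha _ _) (fun x => weightedEntropy_nonneg hm ha _ _) g1
  -- Translation by h(t) places the interface at the origin.
  rw [← lintegral_add_right_eq_self _ (h t)] at key
  simp only [add_sub_cancel_right] at key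
  exact eLpNorm_two_le_of_lintegral_le hc₁0 hc₂0.le
    (.of_forall fun x => le_weightedEntropy hm ha x _)
    (hu₀V.mono fun x hx => hup _ hx _) key

end Elastodynamics

theorem mainTheorem3 (m : ℝ) (hm : 0 < m) (V : Set Elastodynamics.State) (hV : IsCompact V) :
    (∀ uL ∈ V, uL 0 ≠ 0 →
      ∃ ε > 0, ∃ a : ℝ, 0 < a ∧ a < 1 ∧ ∃ C > 0, ∀ s₀ : ℝ, 0 < s₀ → s₀ < ε →
        ∀ uR ∈ V, uR = Elastodynamics.shockCurve1 m uL (Real.sign (uL 0) * s₀) →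
          Elastodynamics.IsStableUpToShift m V a C uL uR) ∧
    (∀ uR ∈ V, uR 0 ≠ 0 →
      ∃ ε > 0, ∃ a : ℝ, 1 < a ∧ ∃ C > 0, ∀ s₀ : ℝ, 0 < s₀ → s₀ < ε →
        ∀ uL ∈ V, uL = Elastodynamics.shockCurve2 m uR (Real.sign (uR 0) * s₀) →
          Elastodynamics.IsStableUpToShift m V a C uL uR) := by
  refine ⟨fun uL huL hw => ?_, fun uR huR hw => ?_⟩
  · obtain ⟨ε, hε, a, ha, ha1, H⟩ := Elastodynamics.exists_admissible_one hm hV huL hw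
    obtain ⟨C, hC, hstab⟩ := Elastodynamics.exists_isStableUpToShift hm hV ha
    refine ⟨ε, hε, a, ha, ha1, C, hC, fun s₀ hs hs' uR huR hR => ?_⟩
    obtain ⟨Λ, hΛ, hadm⟩ := H s₀ hs hs' uR huR hR
    exact hstab uL huL uR huR Λ hΛ hadm
  · obtain ⟨ε, hε, a, ha, H⟩ := Elastodynamics.exists_admissible_two hm hV huR hw
    obtain ⟨C, hC, hstab⟩ := Elastodynamics.exists_isStableUpToShift hm hV (zero_lt_one.trans ha)
    refine ⟨ε, hε, a, ha, C, hC, fun s₀ hs hs' uL huL hL => ?_⟩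
    obtain ⟨Λ, hΛ, hadm⟩ := H s₀ hs hs' uL huL hL
    exact hstab uL huL uR huR Λ hΛ hadm
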